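/- There are a deterministic dynamic algorithm (one uniform program) and an absolute constant $C$ such that the following holds for every metric space $(X,d)$, every real $\Delta\ge 2$ with $1\le d(x,y)\le\Delta$ for all distinct $x,y\in X$, and every integer $k\ge 1$. Let the input $P\subseteq X$ be initially empty and change by a sequence of updates, each inserting a point $x\in X\setminus P$ into $P$ or deleting a point $x\in P$ from $P$; let $P_i$ be the input after $i$ updates. The algorithm receives the updates one at a time, knows $k$, does not know future updates, and accesses the metric only by querying distances between points that it has received. After the first $i$ updates it displays a set of centers $U_i$ (so $U_i$ depends only on $k$, on these updates and on the distances), such that: 1. ($O(1)$ approximation ratio) for every $i\ge 0$, $U_i\subseteq P_i$, $|U_i|\le k$ and $\operatorname{cost}(U_i,P_i)\le C\cdot\mathrm{OPT}_k(P_i)$. Here $\operatorname{cost}(U,P)=\sum_{p\in P}\min_{q\in U}d(p,q)$ (which is $\infty$ if $U=\emptyset\ne P$), and $\mathrm{OPT}_k(P)=\inf\{\operatorname{cost}(S,P): S\subseteq X,\ |S|\le k\}$, so that the optimum may even open centers outside of $P$. 2. ($O(\log^2\Delta)$ amortized recourse) for every $T\ge 0$, $\sum_{i=0}^{T-1}|U_i\oplus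 U_{i+1}|\le C\cdot\log_2^2\Delta\cdot T$, where $\oplus$ is the symmetric difference. 3. (exponential time) if $|P_0|,\dots,|P_i|\le n$, then handling the $i$-th update (or the initialization, if $i=0$) takes at most $2^{C(n+k)}\cdot(\log_2\Delta)^{C}$ steps. The program is written in a deterministic WHILE language over binary trees whose leaves are nil, real numbers, and points; forming and taking apart pairs, branching, adding, subtracting, multiplying and comparing real numbers, and querying the distance of two points take unit time. -/

import Mathlib

open scoped ENNReal

universe u

namespace DynKMedian

/-! ## The `k`-median objective -/

/-- The cost of the centre set `U` on the point set `P`: the sum over `p ∈ P` of the distance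
from `p` to its nearest centre in `U`. It is `∞` if there are points but no centres. -/
noncomputable def cost {X : Type u} [MetricSpace X] (U P : Finset X) : ℝ≥0∞ :=
  ∑ p ∈ P, Metric.infEDist p (U : Set X)

/-- The optimal `k`-median cost of `P`, where the at most `k` centres may be any points of the
underlying space `X`. -/
noncomputable def OPT {X : Type u} [MetricSpace X] (k : ℕ) (P : Finset X) : ℝ≥0∞ :=
  ⨅ (S : Finset X) (_ : S.card ≤ k), cost S P

/-! ## Dynamic input -/

/-- An update inserts a point into the input or deletes a point from it. -/
inductive Update (X : Type u) : Type u
  | insert (x : X)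
  | delete (x : X)

/-- The input after an update. -/
def Update.apply {X : Type u} [DecidableEq X] (P : Finset X) : Update X → Finset X
  | .insert x => Insert.insert x P
  | .delete x => P.erase x

/-- Only absent points are inserted, and only present points are deleted. -/
def Update.Allowed {X : Type u} (P : Finset X) : Update X → Prop
  | .insert x => x ∉ P
  | .delete x => x ∈ P

/-- The input set after the first `i` updates; it is empty at the beginning. -/
def input {X : Type u} [DecidableEq X] (σ : ℕ → Update X) : ℕ → Finset X
  | 0 => ∅
  | i + 1 => (σ i).apply (input σ i)

/-- A sequence of updates each of which is allowed at the time when it is issued. -/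
def ValidUpdates {X : Type u} [DecidableEq X] (σ : ℕ → Update X) : Prop :=
  ∀ i, (σ i).Allowed (input σ i)

/-! ## The machine model

A `WHILE` language over binary trees (pure Lisp data) with a step count. The atoms of the trees are
`nil`, real numbers and points of the metric space. Real arithmetic, comparison of reals and
distance queries take one step each, as on a real RAM with a distance oracle. Points are opaque: the
only thing a program can do with them, besides moving them around, is to query distances.
The syntax of programs does not mention the metric space. -/

/-- The data on which programs work. -/
inductive Val (X : Type u) : Type u
  | nil
  | real (r : ℝ)
  | point (x : X)
  | cons (a b : Val X)

/-- The truth value "true"; "false" is `nil`. Every value other than `nil` counts as true. -/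
def Val.tt {X : Type u} : Val X := .cons .nil .nil

/-- A list of points, as a `nil`-terminated chain of pairs. -/
def Val.ofList {X : Type u} : List X → Val X
  | [] => .nil
  | x :: l => .cons (.point x) (Val.ofList l)

/-- The elementary operations. -/
inductive Prim : Type
  | id
  | nil
  | one
  | hd
  | tl
  | add
  | sub
  | mul
  | le
  | dist

/-- The effect of an elementary operation; a binary operation expects a pair of arguments. The
result is `nil` on arguments of the wrong shape. -/
noncomputable def Prim.eval {X : Type u} [MetricSpace X] : Prim → Val X → Val X
  | .id, v => v
  | .nil, _ => .nil
  | .one, _ => .real 1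
  | .hd, .cons a _ => a
  | .tl, .cons _ b => b
  | .add, .cons (.real a) (.real b) => .real (a + b)
  | .sub, .cons (.real a) (.real b) => .real (a - b)
  | .mul, .cons (.real a) (.real b) => .real (a * b)
  | .le, .cons (.real a) (.real b) => if a ≤ b then .tt else .nil
  | .dist, .cons (.point x) (.point y) => .real (Dist.dist x y)
  | _, _ => .nil

/-- Programs. A program transforms one value into another. -/
inductive Prog : Type
  /-- an elementary operation -/
  | prim (o : Prim)
  /-- run both programs on the input and pair the results -/
  | pair (p q : Prog)
  /-- run `p`, then `q` on its result -/
  | seq (p q : Prog)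
  /-- run `c` on the input; if the result is not `nil` run `p` on the input, otherwise `q` -/
  | ite (c p q : Prog)
  /-- as long as the result of `c` on the current value is not `nil`, apply `p` to that value -/
  | loop (c p : Prog)

/-- `Run p v t w`: started on `v`, the program `p` halts after exactly `t` steps with result `w`. -/
inductive Run {X : Type u} [MetricSpace X] : Prog → Val X → ℕ → Val X → Prop
  | prim (o : Prim) (v : Val X) : Run (.prim o) v 1 (o.eval v)
  | pair {p q : Prog} {v a b : Val X} {s t : ℕ} :
      Run p v s a → Run q v t b → Run (.pair p q) v (s + t + 1) (.cons a b)
  | seq {p q : Prog} {v w z : Val X} {s t : ℕ} :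
      Run p v s w → Run q w t z → Run (.seq p q) v (s + t + 1) z
  | ite_true {c p q : Prog} {v b w : Val X} {s t : ℕ} :
      Run c v s b → b ≠ .nil → Run p v t w → Run (.ite c p q) v (s + t + 1) w
  | ite_false {c p q : Prog} {v w : Val X} {s t : ℕ} :
      Run c v s .nil → Run q v t w → Run (.ite c p q) v (s + t + 1) w
  | loop_done {c p : Prog} {v : Val X} {s : ℕ} :
      Run c v s .nil → Run (.loop c p) v (s + 1) v
  | loop_step {c p : Prog} {v b w z : Val X} {s t r : ℕ} :
      Run c v s b → b ≠ .nil → Run p v t w → Run (.loop c p) w r z →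
        Run (.loop c p) v (s + t + r + 1) z

/-- Programs are deterministic: the input determines the running time and the result. -/
theorem Run.deterministic {X : Type u} [MetricSpace X] {p : Prog} {v w w' : Val X} {t t' : ℕ}
    (h : Run p v t w) (h' : Run p v t' w') : t = t' ∧ w = w' := by
  induction h generalizing t' w' with
  | prim o v => cases h'; exact ⟨rfl, rfl⟩
  | pair _ _ ih₁ ih₂ =>
    cases h' with
    | pair h₁ h₂ =>
      obtain ⟨rfl, rfl⟩ := ih₁ h₁
      obtain ⟨rfl, rfl⟩ := ih₂ h₂
      exact ⟨rfl, rfl⟩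
  | seq _ _ ih₁ ih₂ =>
    cases h' with
    | seq h₁ h₂ =>
      obtain ⟨rfl, rfl⟩ := ih₁ h₁
      obtain ⟨rfl, rfl⟩ := ih₂ h₂
      exact ⟨rfl, rfl⟩
  | ite_true _ hb _ ih₁ ih₂ =>
    cases h' with
    | ite_true h₁ _ h₂ =>
      obtain ⟨rfl, rfl⟩ := ih₁ h₁
      obtain ⟨rfl, rfl⟩ := ih₂ h₂
      exact ⟨rfl, rfl⟩
    | ite_false h₁ _ => exact absurd (ih₁ h₁).2 hb
  | ite_false _ _ ih₁ ih₂ =>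
    cases h' with
    | ite_true h₁ hb _ => exact absurd (ih₁ h₁).2.symm hb
    | ite_false h₁ h₂ =>
      obtain ⟨rfl, -⟩ := ih₁ h₁
      obtain ⟨rfl, rfl⟩ := ih₂ h₂
      exact ⟨rfl, rfl⟩
  | loop_done _ ih₁ =>
    cases h' with
    | loop_done h₁ =>
      obtain ⟨rfl, -⟩ := ih₁ h₁
      exact ⟨rfl, rfl⟩
    | loop_step h₁ hb _ _ => exact absurd (ih₁ h₁).2.symm hb
  | loop_step _ hb _ _ ih₁ ih₂ ih₃ =>
    cases h' with
    | loop_done h₁ => exact absurd (ih₁ h₁).2 hb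
    | loop_step h₁ _ h₂ h₃ =>
      obtain ⟨rfl, rfl⟩ := ih₁ h₁
      obtain ⟨rfl, rfl⟩ := ih₂ h₂
      obtain ⟨rfl, rfl⟩ := ih₃ h₃
      exact ⟨rfl, rfl⟩

/-! ## Dynamic algorithms -/

/-- A dynamic algorithm: `init` turns the number `k` into an initial state, and `step` turns the
current state and the next update into the next state. -/
structure DynAlg : Type where
  init : Prog
  step : Prog

/-- An update as part of the input of a program: a pair of a truth value, which tells insertions
from deletions, and the point. -/
def Update.encode {X : Type u} : Update X → Val X
  | .insert x => .cons .tt (.point x)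
  | .delete x => .cons .nil (.point x)

/-- `A.Executes k σ s t`: on the parameter `k` and the updates `σ`, the algorithm `A` has state `s i`
after the first `i` updates; it spends `t 0` steps on its initialization and `t (i + 1)` steps
on the update `σ i`. -/
structure DynAlg.Executes {X : Type u} [MetricSpace X] (A : DynAlg) (k : ℕ) (σ : ℕ → Update X)
    (s : ℕ → Val X) (t : ℕ → ℕ) : Prop where
  run_init : Run A.init (.real k) (t 0) (s 0)
  run_step : ∀ i, Run A.step (.cons (s i) (σ i).encode) (t (i + 1)) (s (i + 1))

/-- The state `v` displays the solution `U`: its first component is a list of the centres in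
`U`. -/
def Displays {X : Type u} [DecidableEq X] (v : Val X) (U : Finset X) : Prop :=
  ∃ (l : List X) (rest : Val X), v = .cons (.ofList l) rest ∧ l.toFinset = U

end DynKMedian

/-! Time is cut into epochs. An epoch starts with a set `U` of min(k, |P|) centres that is within a
factor 2^24 of optimal and robust: no centre is beaten by a point that is far closer to it than the
other centres are. Exhaustive search finds a smallest S ⊆ U that is 2^43-competitive with all
solutions of 2k - |S| centres. The k - |S| spare centres allow as many updates to be handled lazily:
an inserted point becomes a centre, and a deleted representative is replaced by a nearest remaining
point. The displayed set costs at most twice what S cost at the start, and an optimum for the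
current input together with the deleted points is one of the solutions S competes with. This gives
the ratio 2^45 (`Invariant.feasible`).

The epoch ends with L = k - |S| + 1 updates. By minimality of S, no subset of `U` of size k - L
competes with k + L centres. Hence a good new solution needs only O(L) centres outside `U`
(`exists_next`). To see this, let V be optimal with k + L centres for the old input. If many centres
of V were badly separated compared with their distance to `U`, thinning out `U` or V would give a
solution W with far fewer than k centres (`exists_small_of_badCenters`). Interpolating between W and
V (`exists_interpolation`) would show that k centres do about as well as k + L. Then `U` would be
competitive with V, and so would W moved into `U`, against minimality (`card_badCenters_le`). So all
but O(L) centres of V have a partner in `U` at tiny relative distance. By robustness this partner is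
not beaten by its centre of V, and an unbeaten point serves the whole cluster at constant loss
(`sum_dist_le_of_not_beats`).

Here w beats x at distance d if the ball of radius d/512 around w holds the majority of the points
within 16d of x. Near any point there is one that is unbeaten up to a prescribed scale
(`exists_unbeaten`), so robustness can be restored by short moves (`robustify_spec`). The moves are
paid for by a potential: every centre carries a level g, certifying that nothing within 2^g beats
it, and centres of high level are far apart. A move raises the level by one (`Levels.replace`),
while an update destroys at most one certificate per level, so it costs at most G levels for each of
G centres, where 2^G > Δ (`Levels.update`). This is the source of log²Δ. Since S ⊆ `U` lacks fewer
than L centres, the remaining recourse of an epoch is O(L), apart from a factor G for the levels of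
new centres (`Invariant.renew`).

All searches run over sublists of the input. The running time is a fixed power of N = 2^(n+k+3),
whose exponent is read off the program text (`Prog.ex`). -/

set_option linter.unusedSectionVars false

/-! ### A calculus of running times, and list programming in the WHILE language. -/

namespace DynKMedian

variable {X : Type u} [MetricSpace X]

/-! ## Running times as powers of a size parameter -/

/-- The running time of a program all of whose loops take at most `N` rounds is at most
`N ^ p.ex`. -/
def Prog.ex : Prog → ℕ
  | .prim _ => 0
  | .pair p q => max p.ex q.ex + 1
  | .seq p q => max p.ex q.ex + 1
  | .ite c p q => max c.ex (max p.ex q.ex) + 1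
  | .loop c p => max c.ex p.ex + 2

/-- `p` turns `v` into `w` within `N ^ p.ex` steps. -/
def Runs (N : ℕ) (p : Prog) (v w : Val X) : Prop := ∃ t, t ≤ N ^ p.ex ∧ Run p v t w

section basic

variable {N : ℕ} [hN : Fact (5 ≤ N)] {p q c : Prog} {v w z a b : Val X}

theorem Runs.of_eq (h : Runs N p v w) (e : w = z) : Runs N p v z := e ▸ h

theorem Runs.prim (o : Prim) (v : Val X) : Runs N (.prim o) v (o.eval v) :=
  ⟨1, by simp [Prog.ex], .prim o v⟩

/-- One more factor `N` pays for two subprograms and the step of the constructor that joins them. -/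
theorem pow_add_pow_add_one_le {a b m : ℕ} (ha : a ≤ m) (hb : b ≤ m) :
    N ^ a + N ^ b + 1 ≤ N ^ (m + 1) := by
  have h5 := hN.out
  have h1 : N ^ a ≤ N ^ m := Nat.pow_le_pow_right (by omega) ha
  have h2 : N ^ b ≤ N ^ m := Nat.pow_le_pow_right (by omega) hb
  have h3 : 1 ≤ N ^ m := Nat.one_le_pow _ _ (by omega)
  rw [pow_succ]
  nlinarith

theorem Runs.pair (hp : Runs N p v a) (hq : Runs N q v b) : Runs N (.pair p q) v (.cons a b) := by
  obtain ⟨s, hs, h1⟩ := hp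
  obtain ⟨t, ht, h2⟩ := hq
  refine ⟨s + t + 1, ?_, .pair h1 h2⟩
  have := pow_add_pow_add_one_le (N := N) (le_max_left p.ex q.ex) (le_max_right p.ex q.ex)
  simp only [Prog.ex]
  omega

theorem Runs.seq (hp : Runs N p v w) (hq : Runs N q w z) : Runs N (.seq p q) v z := by
  obtain ⟨s, hs, h1⟩ := hp
  obtain ⟨t, ht, h2⟩ := hq
  refine ⟨s + t + 1, ?_, .seq h1 h2⟩
  have := pow_add_pow_add_one_le (N := N) (le_max_left p.ex q.ex) (le_max_right p.ex q.ex)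
  simp only [Prog.ex]
  omega

theorem Runs.ite_true (hc : Runs N c v b) (hb : b ≠ .nil) (hp : Runs N p v w) :
    Runs N (.ite c p q) v w := by
  obtain ⟨s, hs, h1⟩ := hc
  obtain ⟨t, ht, h2⟩ := hp
  refine ⟨s + t + 1, ?_, .ite_true h1 hb h2⟩
  have := pow_add_pow_add_one_le (N := N) (le_max_left c.ex (max p.ex q.ex))
    ((le_max_left p.ex q.ex).trans (le_max_right c.ex _))
  simp only [Prog.ex]
  omega

theorem Runs.ite_false (hc : Runs N c v .nil) (hq : Runs N q v w) :
    Runs N (.ite c p q) v w := by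
  obtain ⟨s, hs, h1⟩ := hc
  obtain ⟨t, ht, h2⟩ := hq
  refine ⟨s + t + 1, ?_, .ite_false h1 h2⟩
  have := pow_add_pow_add_one_le (N := N) (le_max_left c.ex (max p.ex q.ex))
    ((le_max_right p.ex q.ex).trans (le_max_right c.ex _))
  simp only [Prog.ex]
  omega

end basic

/-! ## Encodings -/

/-- Lists are encoded as `nil`-terminated chains of pairs. -/
def encList {α : Type*} (enc : α → Val X) : List α → Val X
  | [] => .nil
  | a :: l => .cons (enc a) (encList enc l)

theorem ofList_eq_encList (l : List X) : Val.ofList l = encList Val.point l := by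
  induction l with
  | nil => rfl
  | cons a l ih => simp [Val.ofList, encList, ih]

open Classical in
/-- The encoding of a truth value. -/
noncomputable def Val.bool (p : Prop) : Val X := if p then .tt else .nil

theorem Val.bool_true {p : Prop} (h : p) : (Val.bool p : Val X) = .tt := if_pos h
theorem Val.bool_false {p : Prop} (h : ¬p) : (Val.bool p : Val X) = .nil := if_neg h

/-! ## Derived programs

Programs are written for inputs that are environments `cons a₀ (cons a₁ …)`. -/

namespace Prog

/-- The `i`-th entry of the environment. -/
def var : ℕ → Prog
  | 0 => .prim .hd
  | i + 1 => .seq (.prim .tl) (var i)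

def hd (p : Prog) : Prog := .seq p (.prim .hd)
def tl (p : Prog) : Prog := .seq p (.prim .tl)
def op (o : Prim) (p q : Prog) : Prog := .seq (.pair p q) (.prim o)
def zero : Prog := op .sub (.prim .one) (.prim .one)
def tt : Prog := .pair (.prim .nil) (.prim .nil)
def and (p q : Prog) : Prog := .ite p q (.prim .nil)
def or (p q : Prog) : Prog := .ite p tt q
def not (p : Prog) : Prog := .ite p (.prim .nil) tt

/-- Run `q` in the environment extended by the result of `p`. -/
def letIn (p q : Prog) : Prog := .seq (.pair p (.prim .id)) q

/-- Multiplication by `2 ^ j`. -/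
def scale : ℕ → Prog → Prog
  | 0, p => p
  | j + 1, p => .seq (scale j p) (op .add (.prim .id) (.prim .id))

/-- Equality of points. -/
def eqPt (p q : Prog) : Prog := op .le (op .dist p q) zero

/-- The loop of `fold`; it works on `cons list (cons accumulator environment)`. -/
def foldLoop (step : Prog) : Prog :=
  .loop (.prim .hd)
    (.pair (tl (.prim .hd))
      (.pair (.seq (.pair (hd (.prim .hd)) (.prim .tl)) step) (tl (.prim .tl))))

/-- Left fold; `step` finds the current element and the accumulator on top of the environment. -/
def fold (l init step : Prog) : Prog :=
  .seq (.pair l (.pair init (.prim .id))) (.seq (foldLoop step) (hd (.prim .tl)))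

/-- Run `p` in an environment without the entry in second position. -/
def skip (p : Prog) : Prog := .seq (.pair (.prim .hd) (tl (.prim .tl))) p

/-- Does `p` hold for all entries of the list? -/
def all (l p : Prog) : Prog := fold l tt (and (var 1) (skip p))

/-- Does `p` hold for some entry of the list? -/
def any (l p : Prog) : Prog := not (all l (not p))

/-- The entries satisfying `p`, in reverse order. -/
def filter (l p : Prog) : Prog :=
  fold l (.prim .nil) (.ite (skip p) (.pair (var 0) (var 1)) (var 1))

/-- The images under `p` of the entries, in reverse order. -/
def map (l p : Prog) : Prog := fold l (.prim .nil) (.pair (skip p) (var 1))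

/-- The sum of the values of `p`. -/
def sum (l p : Prog) : Prog := fold l zero (op .add (var 1) (skip p))

def length (l : Prog) : Prog := sum l (.prim .one)

/-- The entry with the smallest value of `key`. -/
def minBy (l key : Prog) : Prog :=
  fold l (hd l)
    (.ite (op .le (.seq (.pair (var 1) (tl (.prim .tl))) key) (skip key)) (var 1) (var 0))

/-- Push the entries of the first list onto the second one. -/
def revAppend (l m : Prog) : Prog := fold l m (.pair (var 0) (var 1))

/-- All sublists. -/
def subs (l : Prog) : Prog :=
  fold l (.pair (.prim .nil) (.prim .nil))
    (fold (var 1) (var 1) (.pair (.pair (var 2) (var 0)) (var 1)))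

end Prog

section derived

variable {N : ℕ} [hN : Fact (5 ≤ N)] {p q c : Prog} {v w z a b ρ : Val X} {r s : ℝ} {P Q : Prop}

theorem Runs.top : Runs N (.var 0) (.cons a ρ) a := Runs.prim .hd _

theorem Runs.up {i : ℕ} (h : Runs N (.var i) ρ w) : Runs N (.var (i + 1)) (.cons a ρ) w :=
  (Runs.prim .tl _).seq h

theorem Runs.hd (h : Runs N p ρ (.cons a b)) : Runs N p.hd ρ a := h.seq (Runs.prim .hd _)
theorem Runs.tl (h : Runs N p ρ (.cons a b)) : Runs N p.tl ρ b := h.seq (Runs.prim .tl _)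
theorem Runs.id : Runs N (.prim .id) ρ ρ := by simpa [Prim.eval] using Runs.prim (N := N) .id ρ
theorem Runs.nil : Runs N (.prim .nil) ρ .nil := by
  simpa [Prim.eval] using Runs.prim (N := N) .nil ρ
theorem Runs.one : Runs N (.prim .one) ρ (.real 1) := by
  simpa [Prim.eval] using Runs.prim (N := N) .one ρ

theorem Runs.add (hp : Runs N p ρ (.real r)) (hq : Runs N q ρ (.real s)) :
    Runs N (.op .add p q) ρ (.real (r + s)) := (hp.pair hq).seq (Runs.prim .add _)
theorem Runs.sub (hp : Runs N p ρ (.real r)) (hq : Runs N q ρ (.real s)) :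
    Runs N (.op .sub p q) ρ (.real (r - s)) := (hp.pair hq).seq (Runs.prim .sub _)
theorem Runs.dist {x y : X} (hp : Runs N p ρ (.point x)) (hq : Runs N q ρ (.point y)) :
    Runs N (.op .dist p q) ρ (.real (dist x y)) := (hp.pair hq).seq (Runs.prim .dist _)

theorem Runs.congr (h : Runs N p ρ (.bool P)) (hPQ : P ↔ Q) : Runs N p ρ (.bool Q) := by
  rwa [← propext hPQ]

theorem Runs.le (hp : Runs N p ρ (.real r)) (hq : Runs N q ρ (.real s)) :
    Runs N (.op .le p q) ρ (.bool (r ≤ s)) := by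
  have := (hp.pair hq).seq (Runs.prim .le _)
  by_cases h : r ≤ s
  · exact Runs.of_eq this (by simp [Prim.eval, h, Val.bool_true])
  · exact Runs.of_eq this (by simp [Prim.eval, h, Val.bool_false])

theorem Runs.zero : Runs N .zero ρ (.real 0) := by
  exact Runs.of_eq ((Runs.one (N := N) (ρ := ρ)).sub Runs.one) (by simp)

theorem Runs.tt : Runs N .tt ρ .tt := Runs.nil.pair Runs.nil

theorem Runs.ite (hc : Runs N c ρ (.bool P)) (hp : P → Runs N p ρ w) (hq : ¬P → Runs N q ρ w) :
    Runs N (.ite c p q) ρ w := by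
  by_cases h : P
  · exact Runs.ite_true hc (by simp [Val.bool_true h, Val.tt]) (hp h)
  · rw [Val.bool_false h] at hc
    exact Runs.ite_false hc (hq h)

theorem Runs.bool_of_true (hp : Runs N p ρ .tt) (h : P) : Runs N p ρ (.bool P) := by
  rwa [Val.bool_true h]

theorem Runs.bool_of_false (hp : Runs N p ρ .nil) (h : ¬P) : Runs N p ρ (.bool P) := by
  rwa [Val.bool_false h]

theorem Runs.and (hp : Runs N p ρ (.bool P)) (hq : P → Runs N q ρ (.bool Q)) :
    Runs N (.and p q) ρ (.bool (P ∧ Q)) :=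
  hp.ite (fun h => (hq h).congr (by tauto)) (fun h => Runs.nil.bool_of_false (by tauto))

theorem Runs.or (hp : Runs N p ρ (.bool P)) (hq : ¬P → Runs N q ρ (.bool Q)) :
    Runs N (.or p q) ρ (.bool (P ∨ Q)) :=
  hp.ite (fun h => Runs.tt.bool_of_true (by tauto)) (fun h => (hq h).congr (by tauto))

theorem Runs.not (hp : Runs N p ρ (.bool P)) : Runs N (.not p) ρ (.bool (¬P)) :=
  hp.ite (fun h => Runs.nil.bool_of_false (by tauto)) (fun h => Runs.tt.bool_of_true h)

theorem Runs.letIn (hp : Runs N p ρ a) (hq : Runs N q (.cons a ρ) w) :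
    Runs N (.letIn p q) ρ w := (hp.pair Runs.id).seq hq

theorem Runs.scale (hp : Runs N p ρ (.real r)) (j : ℕ) :
    Runs N (.scale j p) ρ (.real (2 ^ j * r)) := by
  induction j with
  | zero => simpa [Prog.scale] using hp
  | succ j ih =>
    have := ih.seq (Runs.id.add Runs.id)
    rwa [show 2 ^ j * r + 2 ^ j * r = 2 ^ (j + 1) * r by ring] at this

theorem Runs.eqPt {x y : X} (hp : Runs N p ρ (.point x)) (hq : Runs N q ρ (.point y)) :
    Runs N (.eqPt p q) ρ (.bool (x = y)) :=
  ((hp.dist hq).le Runs.zero).congr dist_le_zero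

theorem Runs.skip (h : Runs N p (.cons a ρ) w) : Runs N p.skip (.cons a (.cons b ρ)) w :=
  ((Runs.prim .hd _).pair (Runs.prim .tl _).tl).seq h

/-- A list is nonempty iff its encoding is not `nil`. -/
theorem Runs.ite_list {α : Type*} {enc : α → Val X} {l : List α} (hc : Runs N c ρ (encList enc l))
    (hp : l ≠ [] → Runs N p ρ w) (hq : l = [] → Runs N q ρ w) : Runs N (.ite c p q) ρ w := by
  cases l with
  | nil => exact Runs.ite_false hc (hq rfl)
  | cons a l => exact Runs.ite_true hc (by simp [encList]) (hp (by simp))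

variable {α β : Type*} {enc : α → Val X} {l : List α}

/-- The exponent of a loop exceeds that of its body by two. Dividing by `N` once leaves the price of
a single round; the second factor `N` is kept for the number of rounds. -/
theorem foldLoop_run {encB : β → Val X} {g : β → α → β} (I : List α → β → Prop) {step : Prog}
    (hstep : ∀ a l b, I (a :: l) b → I l (g b a) ∧
      Runs N step (.cons (enc a) (.cons (encB b) ρ)) (encB (g b a)))
    (l : List α) (b : β) (hb : I l b) :
    ∃ t, t ≤ l.length * (N ^ (Prog.foldLoop step).ex / N) + 2 ∧
      Run (.foldLoop step) (.cons (encList enc l) (.cons (encB b) ρ)) t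
        (.cons .nil (.cons (encB (l.foldl g b)) ρ)) := by
  induction l generalizing b with
  | nil => exact ⟨2, by simp, .loop_done (.prim .hd _)⟩
  | cons a l ih =>
    obtain ⟨hI, hs⟩ := hstep a l b hb
    obtain ⟨t, ht, hrun⟩ := ih _ hI
    have hbody : Runs N
        (.pair (.tl (.prim .hd))
          (.pair (.seq (.pair (.hd (.prim .hd)) (.prim .tl)) step) (.tl (.prim .tl))))
        (.cons (encList enc (a :: l)) (.cons (encB b) ρ))
        (.cons (encList enc l) (.cons (encB (g b a)) ρ)) :=
      (Runs.prim .hd _).tl.pair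
        ((((Runs.prim .hd _).hd.pair (Runs.prim .tl _)).seq hs).pair (Runs.prim .tl _).tl)
    obtain ⟨t', ht', hrun'⟩ := hbody
    refine ⟨1 + t' + t + 1, ?_, .loop_step (.prim .hd _) (by simp [Prim.eval, encList]) hrun' hrun⟩
    set e := Prog.ex (.pair (.tl (.prim .hd))
          (.pair (.seq (.pair (.hd (.prim .hd)) (.prim .tl)) step) (.tl (.prim .tl)))) with he
    have h5 := hN.out
    have hex : (Prog.foldLoop step).ex = e + 2 := by
      rw [Prog.foldLoop, Prog.ex, ← he, Prog.ex]
      simp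
    have hdiv : N ^ (e + 2) / N = N ^ (e + 1) := by
      rw [pow_succ (n := e + 1)]
      exact Nat.mul_div_cancel _ (by omega)
    rw [hex, hdiv] at ht ⊢
    have h1 : 1 ≤ N ^ e := Nat.one_le_pow _ _ (by omega)
    have h2 : 5 * N ^ e ≤ N ^ (e + 1) := by
      rw [pow_succ, mul_comm]
      exact Nat.mul_le_mul_left _ h5
    simp only [List.length_cons, Nat.add_mul, Nat.one_mul]
    omega

theorem Runs.fold_inv {encB : β → Val X} {g : β → α → β} (I : List α → β → Prop)
    {pl init step : Prog} {b : β} (hb : I l b) (hl : Runs N pl ρ (encList enc l))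
    (hlen : l.length < N) (hinit : Runs N init ρ (encB b))
    (hstep : ∀ a l b, I (a :: l) b → I l (g b a) ∧
      Runs N step (.cons (enc a) (.cons (encB b) ρ)) (encB (g b a))) :
    Runs N (.fold pl init step) ρ (encB (l.foldl g b)) := by
  refine (hl.pair (hinit.pair Runs.id)).seq (Runs.seq (w := .cons .nil (.cons (encB (l.foldl g b)) ρ)) ?_ (Runs.prim .tl _).hd)
  · obtain ⟨t, ht, hrun⟩ := foldLoop_run (N := N) I hstep l b hb
    refine ⟨t, ht.trans ?_, hrun⟩
    have h5 := hN.out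
    set e := (Prog.foldLoop step).ex with he
    obtain ⟨e', he'⟩ : ∃ e', e = e' + 2 := ⟨_, rfl⟩
    have hdiv : N ^ (e' + 2) / N = N ^ (e' + 1) := by
      rw [pow_succ (n := e' + 1)]
      exact Nat.mul_div_cancel _ (by omega)
    rw [he', hdiv, pow_succ (n := e' + 1)]
    have h1 : N ≤ N ^ (e' + 1) := Nat.le_self_pow (by omega) _
    -- As the list is shorter than `N`, one unpaid round remains and covers the two final steps.
    have h2 : N ^ (e' + 1) * (l.length + 1) ≤ N ^ (e' + 1) * N := Nat.mul_le_mul_left _ hlen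
    nlinarith

theorem Runs.fold {encB : β → Val X} {g : β → α → β} (I : β → Prop)
    {pl init step : Prog} {b : β} (hb : I b) (hl : Runs N pl ρ (encList enc l))
    (hlen : l.length < N) (hinit : Runs N init ρ (encB b))
    (hstep : ∀ a ∈ l, ∀ b, I b → I (g b a) ∧
      Runs N step (.cons (enc a) (.cons (encB b) ρ)) (encB (g b a))) :
    Runs N (.fold pl init step) ρ (encB (l.foldl g b)) :=
  Runs.fold_inv (fun l' b => l' ⊆ l ∧ I b) ⟨List.Subset.refl l, hb⟩ hl hlen hinit
    fun a _ b h => ⟨⟨fun _ hx => h.1 (List.mem_cons_of_mem _ hx),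
      (hstep a (h.1 List.mem_cons_self) b h.2).1⟩, (hstep a (h.1 List.mem_cons_self) b h.2).2⟩

theorem Runs.all {pl p : Prog} {f : α → Prop} (hl : Runs N pl ρ (encList enc l))
    (hlen : l.length < N) (hp : ∀ a ∈ l, Runs N p (.cons (enc a) ρ) (.bool (f a))) :
    Runs N (.all pl p) ρ (.bool (∀ a ∈ l, f a)) := by
  have h := Runs.fold (N := N) (encB := fun P : Prop => Val.bool P) (g := fun P a => P ∧ f a)
    (fun _ => True) (b := True) trivial hl hlen (Runs.tt.bool_of_true trivial)
    (step := .and (.var 1) (.skip p))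
    (fun a ha b _ => ⟨trivial, (Runs.up Runs.top).and fun _ => (hp a ha).skip⟩)
  refine Runs.congr h ?_
  clear h hp hl hlen
  suffices ∀ Q : Prop, l.foldl (fun P a => P ∧ f a) Q ↔ Q ∧ ∀ a ∈ l, f a by simpa using this True
  induction l with
  | nil => simp
  | cons a l ih =>
    intro Q
    rw [List.foldl_cons, ih]
    simp [and_assoc]

theorem Runs.any {pl p : Prog} {f : α → Prop} (hl : Runs N pl ρ (encList enc l))
    (hlen : l.length < N) (hp : ∀ a ∈ l, Runs N p (.cons (enc a) ρ) (.bool (f a))) :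
    Runs N (.any pl p) ρ (.bool (∃ a ∈ l, f a)) :=
  (Runs.all hl hlen fun a ha => (hp a ha).not).not.congr (by simp)

open Classical in
/-- The entries satisfying `f`, in reverse order. -/
noncomputable def rfilter (f : α → Prop) (l : List α) : List α :=
  (l.filter fun a => decide (f a)).reverse

@[simp]
theorem mem_rfilter {f : α → Prop} {a : α} : a ∈ rfilter f l ↔ a ∈ l ∧ f a := by
  simp [rfilter]

theorem nodup_rfilter {f : α → Prop} (h : l.Nodup) : (rfilter f l).Nodup := by
  simpa [rfilter] using h.filter _

theorem length_rfilter_le (f : α → Prop) (l : List α) : (rfilter f l).length ≤ l.length := by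
  simpa [rfilter] using List.length_filter_le _ _

theorem Runs.filter {pl p : Prog} {f : α → Prop} (hl : Runs N pl ρ (encList enc l))
    (hlen : l.length < N) (hp : ∀ a ∈ l, Runs N p (.cons (enc a) ρ) (.bool (f a))) :
    Runs N (.filter pl p) ρ (encList enc (rfilter f l)) := by
  classical
  have h := Runs.fold (N := N) (encB := encList enc) (g := fun m a => if f a then a :: m else m)
    (fun _ => True) (b := []) trivial hl hlen Runs.nil
    (step := .ite (.skip p) (.pair (.var 0) (.var 1)) (.var 1))
    (fun a ha b _ => ⟨trivial, (hp a ha).skip.ite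
      (fun h => by
        simpa [h, encList] using Runs.top.pair (Runs.up Runs.top))
      (fun h => by simpa [h] using (Runs.up Runs.top))⟩)
  refine Runs.of_eq h (congrArg _ (Eq.symm ?_))
  clear h hp hl hlen
  suffices ∀ m : List α, l.foldl (fun m a => if f a then a :: m else m) m = rfilter f l ++ m by
    simpa using (this []).symm
  induction l with
  | nil => simp [rfilter]
  | cons a l ih =>
    intro m
    rw [List.foldl_cons, ih]
    by_cases h : f a <;> simp [rfilter, h]

theorem Runs.map {pl p : Prog} {encB : β → Val X} {f : α → β}
    (hl : Runs N pl ρ (encList enc l)) (hlen : l.length < N)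
    (hp : ∀ a ∈ l, Runs N p (.cons (enc a) ρ) (encB (f a))) :
    Runs N (.map pl p) ρ (encList encB (l.map f).reverse) := by
  have h := Runs.fold (N := N) (encB := encList encB) (g := fun m a => f a :: m)
    (fun _ => True) (b := []) trivial hl hlen Runs.nil
    (step := .pair (.skip p) (.var 1))
    (fun a ha b _ => ⟨trivial, (hp a ha).skip.pair (Runs.up Runs.top)⟩)
  refine Runs.of_eq h (congrArg _ (Eq.symm ?_))
  clear h hp hl hlen
  simp

theorem Runs.sum {pl p : Prog} {f : α → ℝ} (hl : Runs N pl ρ (encList enc l))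
    (hlen : l.length < N) (hp : ∀ a ∈ l, Runs N p (.cons (enc a) ρ) (.real (f a))) :
    Runs N (.sum pl p) ρ (.real (l.map f).sum) := by
  have h := Runs.fold (N := N) (encB := Val.real) (g := fun s a => s + f a)
    (fun _ => True) (b := 0) trivial hl hlen Runs.zero
    (step := .op .add (.var 1) (.skip p))
    (fun a ha b _ => ⟨trivial, (Runs.up Runs.top).add (hp a ha).skip⟩)
  refine Runs.of_eq h (congrArg _ (Eq.symm ?_))
  clear h hp hl hlen
  suffices ∀ s : ℝ, l.foldl (fun s a => s + f a) s = s + (l.map f).sum by simpa using (this 0).symm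
  induction l with
  | nil => simp
  | cons a l ih =>
    intro s
    rw [List.foldl_cons, ih]
    simp [add_assoc]

theorem Runs.length {pl : Prog} (hl : Runs N pl ρ (encList enc l)) (hlen : l.length < N) :
    Runs N (.length pl) ρ (.real l.length) := by
  exact Runs.of_eq (Runs.sum (f := fun _ => (1 : ℝ)) hl hlen fun a _ => Runs.one) (by simp)

open Classical in
/-- An entry of `l`, or `d`, with the smallest value of `f`. -/
noncomputable def leastBy (f : α → ℝ) (l : List α) (d : α) : α :=
  l.foldl (fun b a => if f b ≤ f a then b else a) d

theorem leastBy_spec (f : α → ℝ) (l : List α) (d : α) :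
    (leastBy f l d ∈ l ∨ leastBy f l d = d) ∧ f (leastBy f l d) ≤ f d ∧
      ∀ a ∈ l, f (leastBy f l d) ≤ f a := by
  induction l generalizing d with
  | nil => simp [leastBy]
  | cons a l ih =>
    by_cases h : f d ≤ f a
    · have e : leastBy f (a :: l) d = leastBy f l d := by simp [leastBy, h]
      obtain ⟨h1, h2, h3⟩ := ih d
      rw [e]
      refine ⟨by simp; tauto, h2, ?_⟩
      simp only [List.mem_cons, forall_eq_or_imp]
      exact ⟨h2.trans h, h3⟩
    · have e : leastBy f (a :: l) d = leastBy f l a := by simp [leastBy, h]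
      obtain ⟨h1, h2, h3⟩ := ih a
      rw [e]
      refine ⟨by simp; tauto, h2.trans (not_le.1 h).le, ?_⟩
      simp only [List.mem_cons, forall_eq_or_imp]
      exact ⟨h2, h3⟩

theorem leastBy_mem {f : α → ℝ} {l : List α} {d : α} (hd : d ∈ l) : leastBy f l d ∈ l := by
  rcases (leastBy_spec f l d).1 with h | h
  · exact h
  · rwa [h]

theorem leastBy_le {f : α → ℝ} {l : List α} {d a : α} (ha : a ∈ l) : f (leastBy f l d) ≤ f a :=
  (leastBy_spec f l d).2.2 a ha

/-- The initial value `d` is whatever the head operation returns. For an empty list of lists this is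
`nil`, which decodes as the empty list, so membership of `d` is only asked of nonempty lists. -/
theorem Runs.minBy {pl key : Prog} {f : α → ℝ} {d : α} (hl : Runs N pl ρ (encList enc l))
    (hlen : l.length < N) (hd : Runs N pl.hd ρ (enc d)) (hdl : l ≠ [] → d ∈ l)
    (hp : ∀ a ∈ l, Runs N key (.cons (enc a) ρ) (.real (f a))) :
    Runs N (.minBy pl key) ρ (enc (leastBy f l d)) := by
  classical
  refine Runs.fold (N := N) (encB := enc) (fun b => l ≠ [] → b ∈ l) hdl hl hlen hd ?_
  intro a ha b hb
  have hne : l ≠ [] := List.ne_nil_of_mem ha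
  constructor
  · intro _
    split_ifs
    exacts [hb hne, ha]
  · refine Runs.ite (P := f b ≤ f a) (Runs.le ?_ (hp a ha).skip) (fun h => ?_) (fun h => ?_)
    · exact ((Runs.up Runs.top).pair (Runs.prim .tl _).tl).seq (hp b (hb hne))
    · simpa [h] using (Runs.up Runs.top)
    · simpa [h] using Runs.top

theorem Runs.revAppend {pl pm : Prog} {m : List α} (hl : Runs N pl ρ (encList enc l))
    (hlen : l.length < N) (hm : Runs N pm ρ (encList enc m)) :
    Runs N (.revAppend pl pm) ρ (encList enc (l.reverse ++ m)) := by
  have h := Runs.fold (N := N) (encB := encList enc) (g := fun m a => a :: m)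
    (fun _ => True) trivial hl hlen hm
    (step := .pair (.var 0) (.var 1))
    (fun a ha b _ => ⟨trivial, Runs.top.pair (Runs.up Runs.top)⟩)
  refine Runs.of_eq h (congrArg _ (Eq.symm ?_))
  clear h hl hlen hm
  induction l generalizing m with
  | nil => simp
  | cons a l ih => simp [← ih]

/-- All sublists, up to the order of the entries. -/
def sublistsOf (l : List α) : List (List α) :=
  l.foldl (fun m a => (m.map (a :: ·)).reverse ++ m) [[]]

theorem sublistsOf_eq (l : List α) : sublistsOf l =
    (l.reverse.foldr (fun a m => (m.map (a :: ·)).reverse ++ m) [[]]) := by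
  simp [sublistsOf, List.foldr_reverse]

theorem length_sublistsOf (l : List α) : (sublistsOf l).length = 2 ^ l.length := by
  rw [sublistsOf_eq, ← List.length_reverse (as := l)]
  induction l.reverse with
  | nil => simp
  | cons a l ih => simp [ih, pow_succ]; ring

theorem mem_sublistsOf {l s : List α} : s ∈ sublistsOf l ↔ s.Sublist l.reverse := by
  rw [sublistsOf_eq]
  induction l.reverse generalizing s with
  | nil => simp
  | cons a l ih =>
    simp only [List.foldr_cons, List.mem_append, List.mem_reverse, List.mem_map, ih,
      List.sublist_cons_iff]
    constructor
    · rintro (⟨t, h, rfl⟩ | h)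
      · exact .inr ⟨t, rfl, h⟩
      · exact .inl h
    · rintro (h | ⟨t, rfl, h⟩)
      · exact .inr h
      · exact .inl ⟨t, h, rfl⟩

theorem Runs.subs {pl : Prog} (hl : Runs N pl ρ (encList enc l)) (hlen : 2 ^ l.length < N) :
    Runs N (.subs pl) ρ (encList (encList enc) (sublistsOf l)) := by
  have hlen' : l.length < N := lt_trans Nat.lt_two_pow_self hlen
  -- Each remaining entry doubles the accumulator. Weighting its length by the doublings to come
  -- keeps every inner fold below `N` rounds.
  refine Runs.fold_inv (N := N) (encB := encList (encList enc))
    (fun l' m => m.length * 2 ^ l'.length ≤ 2 ^ l.length) (by simp) hl hlen'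
    (Runs.nil.pair Runs.nil) ?_
  intro a l' m hm
  refine ⟨?_, ?_⟩
  · simp only [List.length_cons, pow_succ] at hm
    simp only [List.length_append, List.length_reverse, List.length_map]
    linarith
  · have hmN : m.length < N := by
      refine lt_of_le_of_lt ?_ hlen
      refine le_trans ?_ hm
      exact Nat.le_mul_of_pos_right _ (by positivity)
    have h := Runs.fold (N := N) (encB := encList (encList enc)) (enc := encList enc)
      (ρ := .cons (enc a) (.cons (encList (encList enc) m) ρ))
      (pl := .var 1) (init := .var 1) (l := m) (b := m)
      (g := fun m s => (a :: s) :: m)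
      (fun _ => True) trivial (Runs.up Runs.top) hmN (Runs.up Runs.top)
      (step := .pair (.pair (.var 2) (.var 0)) (.var 1))
      (fun s hs b _ => ⟨trivial, ((Runs.up (Runs.up Runs.top)).pair
        Runs.top).pair (Runs.up Runs.top)⟩)
    refine Runs.of_eq h (congrArg _ (Eq.symm ?_))
    suffices ∀ m' : List (List α), m.foldl (fun m s => (a :: s) :: m) m' =
        (m.map (a :: ·)).reverse ++ m' from (this m).symm
    clear h hmN hm
    induction m with
    | nil => simp
    | cons s m ih =>
      intro m'
      rw [List.foldl_cons, ih]
      simp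

end derived

end DynKMedian

/-! ### Costs of centre sets, and when one centre beats another. -/

namespace DynKMedian

variable {X : Type u} [MetricSpace X] [DecidableEq X]

/-! ## Real-valued costs -/

/-- The cost as a real number; it is meaningful if there are centres. -/
noncomputable def rcost (S P : Finset X) : ℝ := ∑ p ∈ P, Metric.infDist p (S : Set X)

theorem exists_nearest {S : Finset X} (hS : S.Nonempty) (p : X) :
    ∃ s ∈ S, Metric.infDist p (S : Set X) = dist p s := by
  obtain ⟨s, hs, h⟩ := S.finite_toSet.isCompact.exists_infDist_eq_dist (by simpa using hS) p
  exact ⟨s, by simpa using hs, h⟩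

open Classical in
/-- A nearest point of `S`. -/
noncomputable def nn (S : Finset X) (p : X) : X :=
  if hS : S.Nonempty then (exists_nearest hS p).choose else p

theorem nn_mem {S : Finset X} (hS : S.Nonempty) (p : X) : nn S p ∈ S := by
  rw [nn, dif_pos hS]
  exact (exists_nearest hS p).choose_spec.1

theorem infDist_eq_dist_nn {S : Finset X} (hS : S.Nonempty) (p : X) :
    Metric.infDist p (S : Set X) = dist p (nn S p) := by
  rw [nn, dif_pos hS]
  exact (exists_nearest hS p).choose_spec.2

theorem infDist_le {S : Finset X} {s : X} (hs : s ∈ S) (p : X) :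
    Metric.infDist p (S : Set X) ≤ dist p s := Metric.infDist_le_dist_of_mem (by simpa using hs)

theorem dist_nn_le {S : Finset X} {s : X} (hs : s ∈ S) (p : X) : dist p (nn S p) ≤ dist p s := by
  rw [← infDist_eq_dist_nn ⟨s, hs⟩]
  exact infDist_le hs p

theorem nn_eq_self {S : Finset X} {s : X} (hs : s ∈ S) : nn S s = s := by
  have := dist_nn_le hs s
  rw [dist_self, dist_le_zero] at this
  exact this.symm

theorem rcost_nonneg (S P : Finset X) : 0 ≤ rcost S P :=
  Finset.sum_nonneg fun _ _ => Metric.infDist_nonneg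

theorem rcost_le_sum {S P : Finset X} {f : X → X} (hf : ∀ p ∈ P, f p ∈ S) :
    rcost S P ≤ ∑ p ∈ P, dist p (f p) :=
  Finset.sum_le_sum fun p hp => infDist_le (hf p hp) p

theorem rcost_anti {S T : Finset X} (h : S ⊆ T) (hS : S.Nonempty) (P : Finset X) :
    rcost T P ≤ rcost S P :=
  Finset.sum_le_sum fun _ _ =>
    Metric.infDist_le_infDist_of_subset (by simpa using h) (by simpa using hS)

theorem rcost_mono (S : Finset X) {P Q : Finset X} (h : P ⊆ Q) : rcost S P ≤ rcost S Q :=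
  Finset.sum_le_sum_of_subset_of_nonneg h fun _ _ _ => Metric.infDist_nonneg

/-- Points that are centres do not cost anything. -/
theorem rcost_union_le {S P Q : Finset X} (hS : S.Nonempty) (h : P ⊆ Q) :
    rcost (S ∪ (Q \ P)) Q ≤ rcost S P := by
  rw [rcost, ← Finset.sum_sdiff h, Finset.sum_eq_zero, zero_add]
  · exact rcost_anti Finset.subset_union_left hS P
  · intro p hp
    exact Metric.infDist_zero_of_mem (by
      rw [Finset.mem_coe]
      exact Finset.mem_union_right _ hp)

/-- Opening the new points as centres makes them free, and lost points only lower the cost. With the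
roles of the inputs exchanged, this carries a solution back to an older input. -/
theorem rcost_union_sdiff_le {S P Q : Finset X} (hS : S.Nonempty) :
    rcost (S ∪ (Q \ P)) Q ≤ rcost S P := by
  have h := rcost_union_le hS (Finset.inter_subset_right (s₁ := P) (s₂ := Q))
  rw [Finset.sdiff_inter_self_right] at h
  exact h.trans (rcost_mono S Finset.inter_subset_left)

/-- Replace the centres by their nearest points of `Z`. -/
theorem rcost_image_nn_le {S Z : Finset X} (hS : S.Nonempty) (hZ : Z.Nonempty) (P : Finset X) :
    rcost (S.image (nn Z)) P ≤ 2 * rcost S P + rcost Z P := by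
  refine (rcost_le_sum (f := fun p => nn Z (nn S p))
    fun p _ => Finset.mem_image_of_mem _ (nn_mem hS p)).trans ?_
  rw [rcost, rcost, Finset.mul_sum, ← Finset.sum_add_distrib]
  refine Finset.sum_le_sum fun p _ => ?_
  rw [infDist_eq_dist_nn hS, infDist_eq_dist_nn hZ]
  have h1 := dist_triangle p (nn S p) (nn Z (nn S p))
  have h2 := dist_nn_le (nn_mem hZ p) (nn S p)
  have h3 := dist_triangle (nn S p) p (nn Z p)
  rw [dist_comm (nn S p) p] at h3
  linarith

/-- Replace the centres by their nearest points of the input. -/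
theorem rcost_image_nn_self_le {S P : Finset X} (hS : S.Nonempty) :
    rcost (S.image (nn P)) P ≤ 2 * rcost S P := by
  refine (rcost_le_sum (f := fun p => nn P (nn S p))
    fun p _ => Finset.mem_image_of_mem _ (nn_mem hS p)).trans ?_
  rw [rcost, Finset.mul_sum]
  refine Finset.sum_le_sum fun p hp => ?_
  rw [infDist_eq_dist_nn hS]
  have h1 := dist_triangle p (nn S p) (nn P (nn S p))
  have h2 := dist_nn_le hp (nn S p)
  rw [dist_comm (nn S p) p] at h2
  linarith

theorem cost_eq_ofReal {S : Finset X} (hS : S.Nonempty) (P : Finset X) :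
    cost S P = ENNReal.ofReal (rcost S P) := by
  rw [cost, rcost, ENNReal.ofReal_sum_of_nonneg fun _ _ => Metric.infDist_nonneg]
  refine Finset.sum_congr rfl fun p _ => ?_
  rw [Metric.infDist, ENNReal.ofReal_toReal]
  exact Metric.infEDist_ne_top (by simpa using hS)

/-! ## Counting points in balls -/

/-- The number of points of `P` in the closed ball around `x` of radius `r`. -/
noncomputable def cnt (P : Finset X) (x : X) (r : ℝ) : ℕ := (P.filter fun p => dist p x ≤ r).card

theorem cnt_le_cnt {P : Finset X} {x y : X} {r s : ℝ}
    (h : ∀ p ∈ P, dist p x ≤ r → dist p y ≤ s) : cnt P x r ≤ cnt P y s := by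
  refine Finset.card_le_card fun p hp => ?_
  rw [Finset.mem_filter] at hp ⊢
  exact ⟨hp.1, h p hp.1 hp.2⟩

/-- Two balls that hold the majority of the points of larger balls intersect, provided that
each of them is contained in the larger ball of the other one. -/
theorem exists_mem_of_majorities {P : Finset X} {x w x' w' : X} {r s r' s' : ℝ}
    (h : cnt P x r < 2 * cnt P w s) (h' : cnt P x' r' < 2 * cnt P w' s')
    (hx : ∀ p ∈ P, dist p w ≤ s → dist p x' ≤ r') (hx' : ∀ p ∈ P, dist p w' ≤ s' → dist p x ≤ r)
    (hw : ∀ p ∈ P, dist p w ≤ s → dist p x ≤ r) (hw' : ∀ p ∈ P, dist p w' ≤ s' → dist p x' ≤ r') :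
    ∃ p ∈ P, dist p w ≤ s ∧ dist p w' ≤ s' := by
  by_contra! hne
  -- If the small balls were disjoint, each large ball would contain both. Then neither count could
  -- be less than twice the smaller of the two.
  have hdisj : Disjoint (P.filter fun p => dist p w ≤ s) (P.filter fun p => dist p w' ≤ s') := by
    rw [Finset.disjoint_filter]
    exact fun p hp h1 => not_le.2 (hne p hp h1)
  have key : ∀ {y t}, (∀ p ∈ P, dist p w ≤ s → dist p y ≤ t) →
      (∀ p ∈ P, dist p w' ≤ s' → dist p y ≤ t) → cnt P w s + cnt P w' s' ≤ cnt P y t := by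
    intro y t h1 h2
    rw [cnt, cnt, ← Finset.card_union_of_disjoint hdisj]
    refine Finset.card_le_card fun p hp => ?_
    simp only [Finset.mem_union, Finset.mem_filter] at hp ⊢
    rcases hp with hp | hp
    exacts [⟨hp.1, h1 p hp.1 hp.2⟩, ⟨hp.1, h2 p hp.1 hp.2⟩]
  have h1 := key hw hx'
  have h2 := key hx hw'
  omega

/-- The ball around `w` of radius `a * dist w x` holds the majority of the points in the ball
around `x` of radius `b * dist w x`. -/
def Majority (P : Finset X) (a b : ℝ) (w x : X) : Prop :=
  cnt P x (b * dist w x) < 2 * cnt P w (a * dist w x)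

/-- The point `w` is clearly a better centre than `x` for the points around `x`. -/
def Beats (P : Finset X) (w x : X) : Prop := Majority P (1 / 512) 16 w x

theorem Majority.mono {P : Finset X} {a b a' b' : ℝ} {w x : X} (h : Majority P a b w x)
    (ha : a ≤ a') (hb : b' ≤ b) : Majority P a' b' w x := by
  have hd : 0 ≤ dist w x := dist_nonneg
  have h1 : cnt P x (b' * dist w x) ≤ cnt P x (b * dist w x) := cnt_le_cnt fun p _ hp =>
    hp.trans (mul_le_mul_of_nonneg_right hb hd)
  have h2 : cnt P w (a * dist w x) ≤ cnt P w (a' * dist w x) := cnt_le_cnt fun p _ hp =>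
    hp.trans (mul_le_mul_of_nonneg_right ha hd)
  unfold Majority at *
  omega

/-- Every point is close to a point that is not beaten by any point that is not too far away. -/
theorem exists_unbeaten {P : Finset X} (hX : ∀ x y : X, x ≠ y → 1 ≤ dist x y) (n : ℕ) :
    ∀ s : ℝ, s < 8 ^ n → 0 ≤ s → ∀ u ∈ P, ∃ x ∈ P, dist u x ≤ 8 / 7 * s ∧
      (∀ w ∈ P, w ≠ x → dist w x ≤ s / 2 → ¬Beats P w x) ∧
      (x = u ∨ ¬Majority P (1 / 8) 8 u x) := by
  induction n with
  | zero =>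
    intro s hs hs0 u hu
    refine ⟨u, hu, by simpa using hs0, fun w _ hw hd => ?_, .inl rfl⟩
    have := hX w u hw
    rw [pow_zero] at hs
    linarith
  | succ n ih =>
    intro s hs hs0 u hu
    classical
    -- `F` uses constants weaker than those of `Beats`. The slack lets a point that beats a
    -- neighbour of `u` be recognised as a member of `F`.
    set F := P.filter fun w => w ≠ u ∧ dist w u ≤ s ∧ Majority P (1 / 256) 8 w u with hF
    rcases F.eq_empty_or_nonempty with h0 | h0
    · refine ⟨u, hu, by simpa using hs0, fun w hw hne hd hb => ?_, .inl rfl⟩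
      have : w ∈ F := by
        rw [hF, Finset.mem_filter]
        exact ⟨hw, hne, by linarith, hb.mono (by norm_num) (by norm_num)⟩
      simp [h0] at this
    · obtain ⟨w₀, hw₀, hmax⟩ := F.exists_max_image (fun w => dist w u) h0
      rw [hF, Finset.mem_filter] at hw₀
      obtain ⟨hw₀P, hne₀, hs₀, hmaj⟩ := hw₀
      have he1 : 1 ≤ dist w₀ u := hX _ _ hne₀
      set e := dist w₀ u with he
      rw [Majority, ← he] at hmaj
      obtain ⟨x, hx, hd, hunb, hself⟩ := ih (e / 8) (by rw [pow_succ] at hs; linarith) (by linarith)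
        w₀ hw₀P
      have hux : dist u x ≤ 8 / 7 * e := by
        have := dist_triangle u w₀ x
        rw [dist_comm u w₀] at this
        linarith
      have hux' : 6 / 7 * e ≤ dist u x := by
        have := dist_triangle_right w₀ u x
        linarith
      refine ⟨x, hx, by linarith, fun w hw hne hds hb => ?_, .inr fun hm => ?_⟩
      · set d := dist w x with hdd
        -- Points near `x` are excluded by induction, those at medium distance by the last clause of
        -- the induction hypothesis, and far ones by the maximality of `w₀`.
        rcases le_or_gt d (e / 16) with hsmall | hsmall
        · exact hunb w hw hne (by linarith) hb
        have hwu1 : dist w u ≤ d + dist u x := by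
          have := dist_triangle_right w u x
          linarith
        have hwu2 : d ≤ dist w u + dist u x := dist_triangle w u x
        rw [Beats, Majority, ← hdd] at hb
        rcases le_or_gt d (3 * e) with hlarge | hlarge
        -- Both `w` and `w₀` concentrate a majority, so their small balls meet and `w` lies next to
        -- `w₀`. Then `w₀` inherits the majority around `x`, which the induction hypothesis rules
        -- out.
        · obtain ⟨p, hp, hp1, hp2⟩ := exists_mem_of_majorities hb hmaj
            (fun p _ hp => by
              have := dist_triangle p w u
              linarith)
            (fun p _ hp => by
              have := dist_triangle p w₀ x
              linarith)
            (fun p _ hp => by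
              have := dist_triangle p w x
              linarith)
            (fun p _ hp => by
              have := dist_triangle p w₀ u
              linarith)
          have hww : dist w w₀ ≤ d / 512 + e / 256 := by
            have := dist_triangle_left w w₀ p
            linarith
          rcases hself with rfl | hself
          · linarith
          · refine hself ?_
            have h1 : dist w₀ x ≤ dist w w₀ + d := by
              have := dist_triangle_left w₀ x w
              linarith
            have h2 : d ≤ dist w w₀ + dist w₀ x := dist_triangle w w₀ x
            have h3 : cnt P x (8 * dist w₀ x) ≤ cnt P x (16 * d) := cnt_le_cnt fun p _ hp => by
              linarith
            have h4 : cnt P w (1 / 512 * d) ≤ cnt P w₀ (1 / 8 * dist w₀ x) :=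
              cnt_le_cnt fun p _ hp => by
                have := dist_triangle p w w₀
                linarith
            unfold Majority
            omega
        · have hwF : w ∈ F := by
            rw [hF, Finset.mem_filter]
            refine ⟨hw, ?_, by linarith, ?_⟩
            · rintro rfl
              linarith
            · have h3 : cnt P u (8 * dist w u) ≤ cnt P x (16 * d) := cnt_le_cnt fun p _ hp => by
                have := dist_triangle p u x
                linarith
              have h4 : cnt P w (1 / 512 * d) ≤ cnt P w (1 / 256 * dist w u) :=
                cnt_le_cnt fun p _ hp => by linarith
              unfold Majority
              omega
          have := hmax w hwF
          linarith
      -- If `u` held a majority around `x`, its small ball would meet that of `w₀`, although `u` and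
      -- `w₀` are far apart compared with both radii.
      · rw [Majority] at hm
        obtain ⟨p, hp, hp1, hp2⟩ := exists_mem_of_majorities hm hmaj
            (fun p _ hp => by linarith)
            (fun p _ hp => by
              have := dist_triangle p w₀ x
              linarith)
            (fun p _ hp => by
              have := dist_triangle p u x
              linarith)
            (fun p _ hp => by
              have := dist_triangle p w₀ u
              linarith)
        have := dist_triangle_left w₀ u p
        linarith

/-- If `u` does not beat `x`, then `x` is almost as good as `u` for every set that contains all
points around `x`. -/
theorem sum_dist_le_of_not_beats {P Q : Finset X} {u x : X} (h : ¬Beats P u x) (hQ : Q ⊆ P)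
    (hball : ∀ p ∈ P, dist p x ≤ 16 * dist u x → p ∈ Q) :
    ∑ p ∈ Q, dist p x ≤ 1026 * ∑ p ∈ Q, dist p u := by
  set d := dist u x with hd
  have hd0 : 0 ≤ d := dist_nonneg
  rw [Beats, Majority, not_lt, ← hd] at h
  set near := P.filter fun p => dist p u ≤ 1 / 512 * d with hnear
  set ball := P.filter fun p => dist p x ≤ 16 * d with hball'
  have hnb : near ⊆ ball := fun p hp => by
    rw [hnear, Finset.mem_filter] at hp
    rw [hball', Finset.mem_filter]
    refine ⟨hp.1, ?_⟩
    have := dist_triangle p u x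
    linarith [hp.2]
  have hbQ : ball ⊆ Q := fun p hp => by
    rw [hball', Finset.mem_filter] at hp
    exact hball p hp.1 hp.2
  -- As `near` is at most half of `ball`, each near point can be charged to a point of `ball` that
  -- pays at least d/512 to `u`. This costs a factor 513.
  have hcard : (near.card : ℝ) ≤ (ball \ near).card := by
    have h1 : 2 * near.card ≤ ball.card := h
    have h2 := Finset.card_sdiff_add_card_eq_card hnb
    exact_mod_cast (by omega : near.card ≤ (ball \ near).card)
  have h1 : ∑ p ∈ near, dist p x ≤ near.card * (513 / 512 * d) := by
    rw [← nsmul_eq_mul]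
    refine Finset.sum_le_card_nsmul _ _ _ fun p hp => ?_
    rw [hnear, Finset.mem_filter] at hp
    have := dist_triangle p u x
    linarith [hp.2]
  have h2 : (ball \ near).card * (1 / 512 * d) ≤ ∑ p ∈ ball \ near, dist p u := by
    rw [← nsmul_eq_mul]
    refine Finset.card_nsmul_le_sum _ _ _ fun p hp => ?_
    rw [Finset.mem_sdiff, hnear, hball', Finset.mem_filter, Finset.mem_filter] at hp
    by_contra! hlt
    exact hp.2 ⟨hp.1.1, hlt.le⟩
  have h3 : ∑ p ∈ ball \ near, dist p u ≤ ∑ p ∈ Q \ near, dist p u :=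
    Finset.sum_le_sum_of_subset_of_nonneg (Finset.sdiff_subset_sdiff hbQ le_rfl)
      fun _ _ _ => dist_nonneg
  -- Outside `near` the triangle inequality loses another factor 513, which makes 1026 in total.
  have h4 : ∑ p ∈ Q \ near, dist p x ≤ ∑ p ∈ Q \ near, 513 * dist p u := by
    refine Finset.sum_le_sum fun p hp => ?_
    rw [Finset.mem_sdiff, hnear, Finset.mem_filter] at hp
    have : 1 / 512 * d < dist p u := by
      by_contra! hle
      exact hp.2 ⟨hQ hp.1, hle⟩
    have := dist_triangle p u x
    linarith
  rw [← Finset.mul_sum] at h4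
  have h5 : ∑ p ∈ Q \ near, dist p u ≤ ∑ p ∈ Q, dist p u :=
    Finset.sum_le_sum_of_subset_of_nonneg Finset.sdiff_subset fun _ _ _ => dist_nonneg
  have h6 := Finset.sum_sdiff (hnb.trans hbQ) (f := fun p => dist p x)
  have h7 : near.card * (513 / 512 * d) ≤ 513 * ((ball \ near).card * (1 / 512 * d)) := by
    have := mul_le_mul_of_nonneg_right hcard hd0
    linarith
  linarith

end DynKMedian

/-! ### Comparing two solutions, and a new solution close to the old centres. -/

namespace DynKMedian

variable {X : Type u} [MetricSpace X] [DecidableEq X]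

theorem exists_optimal {P : Finset X} (hP : P.Nonempty) {k : ℕ} (hk : 1 ≤ k) :
    ∃ S ⊆ P, S.Nonempty ∧ S.card ≤ k ∧
      ∀ T ⊆ P, T.Nonempty → T.card ≤ k → rcost S P ≤ rcost T P := by
  obtain ⟨p, hp⟩ := hP
  obtain ⟨S, hS, hmin⟩ := (P.powerset.filter fun S => S.Nonempty ∧ S.card ≤ k).exists_min_image
    (fun S => rcost S P) ⟨{p}, by simpa using ⟨hp, hk⟩⟩
  rw [Finset.mem_filter, Finset.mem_powerset] at hS
  refine ⟨S, hS.1, hS.2.1, hS.2.2, fun T hT hne hc => hmin T ?_⟩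
  rw [Finset.mem_filter, Finset.mem_powerset]
  exact ⟨hT, hne, hc⟩

/-! ## Thinning out a solution -/

/-- A maximum independent set R of the graph of `f` works: any other point of `B` is mapped into R
or is an image of R. The points mapped into R are independent themselves, so they are no more
numerous than R. -/
theorem exists_independent (B : Finset X) (f : X → X) (hf : ∀ b ∈ B, f b ≠ b) :
    ∃ R ⊆ B, (∀ r ∈ R, f r ∉ R) ∧ B.card ≤ 3 * R.card := by
  obtain ⟨R, hR, hmax⟩ := (B.powerset.filter fun R => ∀ r ∈ R, f r ∉ R).exists_max_image
    Finset.card ⟨∅, by simp⟩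
  simp only [Finset.mem_filter, Finset.mem_powerset] at hR hmax
  refine ⟨R, hR.1, hR.2, ?_⟩
  set T := B.filter fun b => f b ∈ R with hT
  have hTR : T.card ≤ R.card := by
    refine hmax T ⟨Finset.filter_subset _ _, fun r hr h => ?_⟩
    rw [hT, Finset.mem_filter] at hr h
    exact hR.2 _ hr.2 h.2
  have hB : B ⊆ R ∪ T ∪ R.image f := by
    intro b hb
    by_contra hn
    simp only [Finset.mem_union, hT, Finset.mem_filter, Finset.mem_image, not_or, not_and,
      not_exists] at hn
    have := hmax (insert b R) ⟨Finset.insert_subset hb hR.1, ?_⟩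
    · rw [Finset.card_insert_of_notMem hn.1.1] at this
      omega
    · intro r hr h
      rw [Finset.mem_insert] at hr h
      rcases hr with rfl | hr
      · rcases h with h | h
        exacts [hf _ hb h, hn.1.2 hb h]
      · rcases h with h | h
        exacts [hn.2 _ hr h, hR.2 _ hr h]
  have h1 := Finset.card_le_card hB
  have h2 := Finset.card_union_le (R ∪ T) (R.image f)
  have h3 := Finset.card_union_le R T
  have h4 : (R.image f).card ≤ R.card := Finset.card_image_le
  omega

/-- Centres `u ∈ I` that have another centre close to them, in comparison to the distance of `u`
to another solution `V`, can be thinned out. -/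
theorem exists_thin {U V I : Finset X} (P : Finset X) (hU : U.Nonempty) (hI : I ⊆ U) {γ : ℝ} (hγ : 0 ≤ γ)
    (h : ∀ u ∈ I, ∃ u' ∈ U, u' ≠ u ∧ dist u u' ≤ γ * Metric.infDist u (V : Set X)) :
    ∃ W ⊆ U, W.Nonempty ∧ 3 * W.card + I.card ≤ 3 * U.card ∧
      rcost W P ≤ (1 + γ) * rcost U P + γ * rcost V P := by
  choose! f hfU hfne hfd using h
  obtain ⟨R, hRI, hR, hcard⟩ := exists_independent I f hfne
  have hRU := hRI.trans hI
  refine ⟨U \ R, Finset.sdiff_subset, ?_, ?_, ?_⟩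
  · obtain ⟨u, hu⟩ := hU
    by_cases huR : u ∈ R
    · exact ⟨f u, Finset.mem_sdiff.2 ⟨hfU u (hRI huR), hR u huR⟩⟩
    · exact ⟨u, Finset.mem_sdiff.2 ⟨hu, huR⟩⟩
  · have := Finset.card_sdiff_add_card_eq_card hRU
    omega
  · rw [rcost, rcost, rcost, Finset.mul_sum, Finset.mul_sum, ← Finset.sum_add_distrib]
    refine Finset.sum_le_sum fun p _ => ?_
    have hpU := infDist_eq_dist_nn hU p
    have hV0 : 0 ≤ Metric.infDist p (V : Set X) := Metric.infDist_nonneg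
    have hU0 : 0 ≤ Metric.infDist p (U : Set X) := Metric.infDist_nonneg
    by_cases hu : nn U p ∈ R
    -- The detour from a removed centre to its partner is at most `γ` times its distance to `V`,
    -- hence at most `γ` times the sum of the two costs of `p`. Independence keeps the partner in
    -- the solution.
    · have h1 := infDist_le (Finset.mem_sdiff.2 ⟨hfU _ (hRI hu), hR _ hu⟩) p
      have h2 := dist_triangle p (nn U p) (f (nn U p))
      have h3 := hfd _ (hRI hu)
      have h4 := Metric.infDist_le_infDist_add_dist (s := (V : Set X)) (x := nn U p) (y := p)
      rw [dist_comm (nn U p) p] at h4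
      have h5 := mul_le_mul_of_nonneg_left h4 hγ
      rw [hpU]
      linarith
    · have h1 := infDist_le (Finset.mem_sdiff.2 ⟨nn_mem hU p, hu⟩) p
      have := mul_nonneg hγ hV0
      have := mul_nonneg hγ hU0
      linarith

/-- The centre `v` of the solution `V` and its nearest centre in `U` are well separated from all
other centres of these solutions. -/
def WellSeparated (U V : Finset X) (v : X) : Prop :=
  (∀ u ∈ U, u ≠ nn U v → 8192 * dist (nn U v) v ≤ dist (nn U v) u) ∧
    ∀ v' ∈ V, v' ≠ v → 8192 * dist (nn U v) v ≤ dist v v'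

open Classical in
noncomputable def badCenters (U V : Finset X) : Finset X := V.filter fun v => ¬WellSeparated U V v

/-- If there are many centres that are not well separated, then there is a cheap solution with
fewer centres. -/
theorem exists_small_of_badCenters {U V : Finset X} (P : Finset X) {M : ℕ} (hU : U.Nonempty)
    (hV : V.Nonempty) (hUM : U.card ≤ M) (hVM : V.card ≤ M) :
    ∃ W : Finset X, (W ⊆ U ∨ W ⊆ V) ∧ W.Nonempty ∧ 6 * W.card + (badCenters U V).card ≤ 6 * M ∧
      rcost W P ≤ 16385 * (rcost U P + rcost V P) := by
  classical
  have hU0 := rcost_nonneg U P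
  have hV0 := rcost_nonneg V P
  set B := badCenters U V with hB
  set I := B.filter fun v => ∃ v' ∈ V, v' ≠ v ∧ dist v v' ≤ 8192 * Metric.infDist v (U : Set X)
    with hI
  set J := B.filter fun v => ¬∃ v' ∈ V, v' ≠ v ∧ dist v v' ≤ 8192 * Metric.infDist v (U : Set X)
    with hJ
  have hIJ : I.card + J.card = B.card := Finset.card_filter_add_card_filter_not _
  have hBV : B ⊆ V := Finset.filter_subset _ _
  -- Half of the bad centres fail for the same reason. Those in `I` are crowded inside `V`, which is
  -- thinned out. Those in `J` are isolated in `V`, so their nearest centres in `U` are distinct and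
  -- crowded, and `U` is thinned out. Half, and then a third by independence, explain the factor 6.
  rcases le_total J.card I.card with hle | hle
  · obtain ⟨W, hW, hne, hcard, hcost⟩ := exists_thin (I := I) P hV
      ((Finset.filter_subset _ _).trans hBV) (γ := 8192) (by norm_num) fun u hu => (Finset.mem_filter.1 hu).2
    exact ⟨W, .inr hW, hne, by omega, by linarith⟩
  · have hJsep : ∀ v ∈ J, ∀ v' ∈ V, v' ≠ v → 8192 * dist v (nn U v) < dist v v' := by
      intro v hv v' hv' hne
      rw [hJ, Finset.mem_filter] at hv
      by_contra! h
      exact hv.2 ⟨v', hv', hne, by rwa [infDist_eq_dist_nn hU]⟩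
    have hJV : ∀ v ∈ J, v ∈ V := fun v hv => hBV (Finset.mem_filter.1 hv).1
    have hinj : Set.InjOn (nn U) (J : Set X) := by
      intro v hv v' hv' heq
      by_contra hne
      have h1 := hJsep v hv v' (hJV v' hv') (Ne.symm hne)
      have h2 := hJsep v' hv' v (hJV v hv) hne
      rw [← heq, dist_comm v' v] at h2
      have h3 := dist_triangle_right v v' (nn U v)
      have := dist_nonneg (x := v) (y := nn U v)
      have := dist_nonneg (x := v') (y := nn U v)
      linarith
    obtain ⟨W, hW, hne, hcard, hcost⟩ := exists_thin (I := J.image (nn U)) P hU (by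
        intro u hu
        obtain ⟨v, -, rfl⟩ := Finset.mem_image.1 hu
        exact nn_mem hU v) (γ := 16384) (by norm_num) (by
      intro u hu
      obtain ⟨v, hv, rfl⟩ := Finset.mem_image.1 hu
      have hbad : ¬WellSeparated U V v := by
        have := (Finset.mem_filter.1 hv).1
        rw [hB, badCenters, Finset.mem_filter] at this
        exact this.2
      rw [WellSeparated, not_and_or] at hbad
      have hv' : ∀ v' ∈ V, v' ≠ v → 8192 * dist (nn U v) v ≤ dist v v' := by
        intro v' hv' hne
        rw [dist_comm]
        exact (hJsep v hv v' hv' hne).le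
      replace hbad := hbad.resolve_right (not_not.2 hv')
      push Not at hbad
      obtain ⟨u', hu', hne, hlt⟩ := hbad
      refine ⟨u', hu', hne, ?_⟩
      rw [infDist_eq_dist_nn hV]
      have hnear := nn_mem hV (nn U v)
      by_cases heq : nn V (nn U v) = v
      · rw [heq]
        linarith [dist_nonneg (x := nn U v) (y := v)]
      · have h1 := hv' _ hnear heq
        have h2 := dist_triangle_left v (nn V (nn U v)) (nn U v)
        linarith [dist_nonneg (x := nn U v) (y := v)])
    rw [Finset.card_image_of_injOn hinj] at hcard
    exact ⟨W, .inl hW, hne, by omega, by linarith⟩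

/-! ## Interpolating between two solutions -/

/-- Pigeonhole: among `K + 1` disjoint blocks of size `m`, one has at most the average weight. -/
theorem exists_cheap_subset (f : X → ℝ) (hf : ∀ x, 0 ≤ f x) (m K : ℕ) :
    ∀ S : Finset X, (K + 1) * m ≤ S.card →
      ∃ T ⊆ S, T.card = m ∧ ((K : ℝ) + 1) * ∑ x ∈ T, f x ≤ ∑ x ∈ S, f x := by
  induction K with
  | zero =>
    intro S hS
    obtain ⟨T, hT, hcard⟩ := Finset.exists_subset_card_eq (s := S) (n := m) (by omega)
    refine ⟨T, hT, hcard, ?_⟩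
    simpa using Finset.sum_le_sum_of_subset_of_nonneg hT fun _ _ _ => hf _
  | succ K ih =>
    intro S hS
    obtain ⟨T, hT, hcard⟩ := Finset.exists_subset_card_eq (s := S) (n := m) (by nlinarith)
    by_cases h : ((K + 1 : ℕ) + 1 : ℝ) * ∑ x ∈ T, f x ≤ ∑ x ∈ S, f x
    · exact ⟨T, hT, hcard, h⟩
    · have hsd := Finset.card_sdiff_add_card_eq_card hT
      obtain ⟨T', hT', hcard', hsum⟩ := ih (S \ T) (by
        have : (K + 1 + 1) * m = (K + 1) * m + m := by ring
        omega)
      refine ⟨T', hT'.trans Finset.sdiff_subset, hcard', ?_⟩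
      have h1 := Finset.sum_sdiff hT (f := f)
      push_cast at h ⊢
      have hK : (0 : ℝ) ≤ K := Nat.cast_nonneg K
      nlinarith

/-- Keep the centres of `B` nearest to `A`, so that a client of a closed centre can be rerouted
through `A` for an extra 2 d(p, A). Since `A` is small, the surplus of `B` can be chosen among `K +
1` disjoint groups, and the cheapest one is closed. -/
theorem exists_interpolation {A B : Finset X} (P : Finset X) (hA : A.Nonempty) (hB : B.Nonempty)
    {k K L : ℕ} (hAk : A.card + K * L ≤ k) (hBk : B.card ≤ k + L) :
    ∃ C ⊆ B, C.Nonempty ∧ C.card ≤ k ∧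
      ((K : ℝ) + 1) * rcost C P ≤ ((K : ℝ) + 1) * rcost B P + 2 * rcost A P := by
  set B' := A.image (nn B) with hB'
  have hB'B : B' ⊆ B := by
    intro b hb
    obtain ⟨a, -, rfl⟩ := Finset.mem_image.1 hb
    exact nn_mem hB a
  have hB'c : B'.card ≤ A.card := Finset.card_image_le
  have hsd := Finset.card_sdiff_add_card_eq_card hB'B
  set f : X → ℝ := fun y => ∑ p ∈ P with nn B p = y, 2 * Metric.infDist p (A : Set X) with hf
  have hnn : ∀ p, 0 ≤ 2 * Metric.infDist p (A : Set X) := fun p =>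
    mul_nonneg (by norm_num) Metric.infDist_nonneg
  obtain ⟨R, hR, hcard, hsum⟩ := exists_cheap_subset f (fun x => Finset.sum_nonneg fun p _ => hnn p)
    (B.card - k) K (B \ B') (by
      have : K * (B.card - k) ≤ K * L := Nat.mul_le_mul_left _ (by omega)
      have h2 : (K + 1) * (B.card - k) = K * (B.card - k) + (B.card - k) := by ring
      rcases le_or_gt B.card k with h | h
      · rw [Nat.sub_eq_zero_of_le h]
        simp
      · omega)
  have hRB : R ⊆ B := hR.trans Finset.sdiff_subset
  have hB'C : ∀ b ∈ B', b ∈ B \ R := fun b hb =>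
    Finset.mem_sdiff.2 ⟨hB'B hb, fun h => (Finset.mem_sdiff.1 (hR h)).2 hb⟩
  refine ⟨B \ R, Finset.sdiff_subset, ?_, ?_, ?_⟩
  · obtain ⟨a, ha⟩ := hA
    exact ⟨_, hB'C _ (Finset.mem_image_of_mem _ ha)⟩
  · have := Finset.card_sdiff_add_card_eq_card hRB
    omega
  · have h1 : rcost (B \ R) P ≤ rcost B P + ∑ y ∈ R, f y := by
      rw [hf, Finset.sum_fiberwise_eq_sum_filter, Finset.sum_filter, rcost, rcost,
        ← Finset.sum_add_distrib]
      refine Finset.sum_le_sum fun p _ => ?_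
      by_cases hp : nn B p ∈ R
      · rw [if_pos hp]
        have h1 := infDist_le (hB'C _ (Finset.mem_image_of_mem _ (nn_mem hA p))) p
        have h2 := dist_triangle p (nn A p) (nn B (nn A p))
        have h3 := dist_nn_le (nn_mem hB p) (nn A p)
        have h4 := dist_triangle_left (nn A p) (nn B p) p
        rw [infDist_eq_dist_nn hB, infDist_eq_dist_nn hA]
        linarith
      · rw [if_neg hp, add_zero, infDist_eq_dist_nn hB]
        exact infDist_le (Finset.mem_sdiff.2 ⟨nn_mem hB p, hp⟩) p
    have h2 : ∑ y ∈ B \ B', f y ≤ 2 * rcost A P := by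
      rw [hf, Finset.sum_fiberwise_eq_sum_filter, rcost, Finset.mul_sum]
      exact Finset.sum_le_sum_of_subset_of_nonneg (Finset.filter_subset _ _) fun _ _ _ => hnn _
    have hK : (0 : ℝ) ≤ (K : ℝ) + 1 := by positivity
    nlinarith [mul_le_mul_of_nonneg_left h1 hK]

/-! ## From one epoch to the next -/

/-- No centre of `U` is beaten by a point that is far away from the other centres. -/
def Robust (U P : Finset X) : Prop :=
  ∀ u ∈ U, ∀ v ∈ P, v ≠ u → (∀ u' ∈ U, u' ≠ u → 8192 * dist u v ≤ dist u u') → ¬Beats P v u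

/-- Replace every centre `v` of `V` by a point `φ v` that is not beaten by `v` and much closer to
`v` than the other centres. -/
theorem rcost_reassign_le {S V P : Finset X} (hV : V.Nonempty) (φ : X → X)
    (hφS : ∀ v ∈ V, φ v ∈ S)
    (hφ : ∀ v ∈ V, φ v = v ∨
      (¬Beats P v (φ v) ∧ ∀ v' ∈ V, v' ≠ v → 35 * dist v (φ v) ≤ dist v v')) :
    rcost S P ≤ 1026 * rcost V P := by
  refine (rcost_le_sum (f := fun p => φ (nn V p)) fun p _ => hφS _ (nn_mem hV p)).trans ?_
  have h2 : rcost V P = ∑ p ∈ P, dist p (nn V p) :=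
    Finset.sum_congr rfl fun p _ => infDist_eq_dist_nn hV p
  rw [h2, ← Finset.sum_fiberwise_of_maps_to (s := P) (t := V) (g := nn V) fun p _ => nn_mem hV p,
    ← Finset.sum_fiberwise_of_maps_to (s := P) (t := V) (g := nn V) fun p _ => nn_mem hV p,
    Finset.mul_sum]
  refine Finset.sum_le_sum fun v hv => ?_
  have e1 : ∑ p ∈ P with nn V p = v, dist p (φ (nn V p)) =
      ∑ p ∈ P with nn V p = v, dist p (φ v) :=
    Finset.sum_congr rfl fun p hp => by rw [(Finset.mem_filter.1 hp).2]
  have e2 : ∑ p ∈ P with nn V p = v, dist p (nn V p) = ∑ p ∈ P with nn V p = v, dist p v :=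
    Finset.sum_congr rfl fun p hp => by rw [(Finset.mem_filter.1 hp).2]
  rw [e1, e2]
  have h0 : 0 ≤ ∑ p ∈ P with nn V p = v, dist p v := Finset.sum_nonneg fun _ _ => dist_nonneg
  by_cases heq : φ v = v
  · rw [heq]
    linarith
  obtain ⟨hbeat, hsep⟩ := (hφ v hv).resolve_left heq
  have hd : 0 < dist v (φ v) := dist_pos.2 (Ne.symm heq)
  -- The ball of radius 16d around `φ v` lies in the cluster of `v`: a point in it is within 17d of
  -- `v`, while any other centre is at least 35d from `v`.
  refine sum_dist_le_of_not_beats hbeat (Finset.filter_subset _ _) fun p hp hpd => ?_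
  rw [Finset.mem_filter]
  refine ⟨hp, ?_⟩
  by_contra hne
  have h3 := hsep _ (nn_mem hV p) hne
  have h4 := dist_nn_le hv p
  have h5 := dist_triangle_left v (nn V p) p
  have h6 := dist_triangle_right p v (φ v)
  linarith

/-- Bad centres stay where they are, and a well separated one moves to its nearest centre in `U`,
which it does not beat by robustness. -/
theorem rcost_union_badCenters_le {U V P : Finset X} (hU : U.Nonempty) (hV : V.Nonempty)
    (hVP : V ⊆ P) (hrob : Robust U P) : rcost (U ∪ badCenters U V) P ≤ 1026 * rcost V P := by
  classical
  refine rcost_reassign_le hV (fun v => if v ∈ badCenters U V then v else nn U v)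
    (fun v _ => ?_) fun v hv => ?_
  · split_ifs with h
    exacts [Finset.mem_union_right _ h, Finset.mem_union_left _ (nn_mem hU v)]
  · split_ifs with h
    · exact .inl rfl
    · have hsep : WellSeparated U V v := by
        by_contra hn
        exact h (Finset.mem_filter.2 ⟨hv, hn⟩)
      rw [or_iff_not_imp_left]
      intro hne
      refine ⟨hrob _ (nn_mem hU v) v (hVP hv) (Ne.symm hne) hsep.1, fun v' hv' hne' => ?_⟩
      have := hsep.2 v' hv' hne'
      rw [dist_comm (nn U v)] at this
      linarith [dist_nonneg (x := v) (y := nn U v)]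

/-- If no small subset of `U` is competitive with the solutions that have `L` additional centres,
then most centres of an optimal solution with `L` additional centres are well separated. -/
theorem card_badCenters_le {U V P : Finset X} {k L : ℕ} (hU : U.Nonempty) (hV : V.Nonempty)
    (hUP : U ⊆ P) (hVP : V ⊆ P) (hUk : U.card ≤ k) (hVk : V.card ≤ k + L)
    (hkU : k ≤ U.card + L)
    (hcost : ∀ S ⊆ P, S.Nonempty → S.card ≤ k → rcost U P ≤ 2 ^ 24 * rcost S P)
    (hVopt : ∀ S ⊆ P, S.Nonempty → S.card ≤ k + L → rcost V P ≤ rcost S P)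
    (hmin : ∀ S ⊆ U, S.Nonempty → S.card + L = k → ∃ T ⊆ P, T.Nonempty ∧ T.card ≤ k + L ∧
      2 ^ 43 * rcost T P < rcost S P) :
    (badCenters U V).card ≤ 6 * 2 ^ 42 * L := by
  by_contra! hlt
  obtain ⟨W, hW, hWne, hWcard, hWcost⟩ := exists_small_of_badCenters (M := k + L) P hU hV
    (by omega) hVk
  have hWP : W ⊆ P := hW.elim (fun h => h.trans hUP) (fun h => h.trans hVP)
  -- Too many bad centres make `W` smaller than k - (2^42 - 1)L. The term for `W` contains the cost
  -- of `U`, hence up to about 2^39 times the cost of `C`. The factor 2^42 absorbs it and leaves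
  -- cost(C) ≤ 2 cost(V).
  obtain ⟨C, hCV, hCne, hCk, hCcost⟩ := exists_interpolation (K := 2 ^ 42 - 1) (L := L) (k := k) P
    hWne hV (by omega) hVk
  have hC1 := hcost C (hCV.trans hVP) hCne hCk
  have hC2 := hVopt C (hCV.trans hVP) hCne (by omega)
  have hV0 := rcost_nonneg V P
  have hVC : rcost C P ≤ 2 * rcost V P := by
    push_cast at hCcost
    norm_num at hCcost hC1
    linarith
  -- Now `U`, and with it `W`, is within a constant of `V`. Moved into `U` and filled up to k - L
  -- centres, `W` costs about 2^40 times as much as `V`, which contradicts `hmin`.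
  have hS := rcost_image_nn_le hWne hU P
  have hSU : W.image (nn U) ⊆ U := by
    intro x hx
    obtain ⟨w, -, rfl⟩ := Finset.mem_image.1 hx
    exact nn_mem hU w
  have hSc : (W.image (nn U)).card ≤ W.card := Finset.card_image_le
  obtain ⟨S, hS1, hS2, hS3⟩ := Finset.exists_subsuperset_card_eq (n := k - L) hSU (by omega)
    (by omega)
  obtain ⟨T, hTP, hTne, hTc, hT⟩ := hmin S hS2 ((hWne.image _).mono hS1) (by omega)
  have hST := rcost_anti hS1 (hWne.image _) P
  have hVT := hVopt T hTP hTne hTc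
  norm_num at hT hC1
  linarith

/-- After `L` updates there is a good solution that has only `O(L)` centres outside of `U`. -/
theorem exists_next {U P P' : Finset X} {k L : ℕ} (hk : 1 ≤ k) (hUP : U ⊆ P)
    (hU : U.card = min k P.card) (hkU : k ≤ U.card + L) (hrob : Robust U P)
    (hcost : ∀ S ⊆ P, S.Nonempty → S.card ≤ k → rcost U P ≤ 2 ^ 24 * rcost S P)
    (hmin : ∀ S ⊆ U, S.Nonempty → S.card + L = k → ∃ T ⊆ P, T.Nonempty ∧ T.card ≤ k + L ∧
      2 ^ 43 * rcost T P < rcost S P)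
    (hdel : (P \ P').card ≤ L) (hins : (P' \ P).card ≤ L) :
    ∃ W ⊆ P', W.card = min k P'.card ∧
      (∀ S ⊆ P', S.Nonempty → S.card ≤ k → rcost W P' ≤ 2 ^ 13 * rcost S P') ∧
      (W \ U).card ≤ 2 ^ 45 * L := by
  rcases P'.eq_empty_or_nonempty with rfl | hP'
  · refine ⟨∅, by simp, by simp, fun S hS hne => ?_, by simp⟩
    rw [Finset.subset_empty.1 hS] at hne
    simp at hne
  obtain ⟨O, hOP, hOne, hOk, hO⟩ := exists_optimal hP' hk
  -- a good solution that may be smaller than required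
  obtain ⟨W₀, hW₀P, hW₀ne, hW₀k, hW₀cost, hW₀U⟩ : ∃ W₀ ⊆ P', W₀.Nonempty ∧ W₀.card ≤ k ∧
      rcost W₀ P' ≤ 2 ^ 13 * rcost O P' ∧ (W₀ \ U).card ≤ 2 ^ 45 * L := by
    have hO0 := rcost_nonneg O P'
    rcases P.eq_empty_or_nonempty with rfl | hP
    · refine ⟨O, hOP, hOne, hOk, by norm_num; linarith, ?_⟩
      have := Finset.card_le_card (Finset.sdiff_subset (s := O) (t := U))
      rw [Finset.card_empty, Nat.min_zero] at hU
      omega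
    have hUne : U.Nonempty := by
      rw [← Finset.card_pos, hU]
      exact lt_min (by omega) (Finset.card_pos.2 hP)
    -- The `L` extra centres make room for the deleted points, so `V` on the old input is comparable
    -- with `O` on the new one.
    obtain ⟨V, hVP, hVne, hVk, hV⟩ := exists_optimal hP (k := k + L) (by omega)
    set B := badCenters U V with hB
    have hBc : B.card ≤ 6 * 2 ^ 42 * L :=
      card_badCenters_le hUne hVne hUP hVP (hU.trans_le (min_le_left _ _)) hVk hkU hcost hV hmin
    set Z := U ∪ B ∪ (P' \ P) with hZ
    have hZne : Z.Nonempty := hUne.mono fun x hx => by simp [hZ, hx]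
    have hZcost : rcost Z P' ≤ 2052 * rcost O P' := by
      have h1 : rcost Z P' ≤ rcost (U ∪ B) P :=
        rcost_union_sdiff_le (hUne.mono Finset.subset_union_left)
      have h2 := rcost_union_badCenters_le hUne hVne hVP hrob
      have h3 : rcost V P ≤ 2 * rcost O P' := by
        have hne : (O ∪ (P \ P')).Nonempty := hOne.mono Finset.subset_union_left
        have h4 := hV ((O ∪ (P \ P')).image (nn P)) (by
            intro x hx
            obtain ⟨y, -, rfl⟩ := Finset.mem_image.1 hx
            exact nn_mem hP y) (hne.image _) (by
            have h5 : ((O ∪ (P \ P')).image (nn P)).card ≤ (O ∪ (P \ P')).card :=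
              Finset.card_image_le
            have := Finset.card_union_le O (P \ P')
            omega)
        have h5 := rcost_image_nn_self_le (P := P) hne
        have h6 := rcost_union_sdiff_le (P := P') (Q := P) hOne
        linarith
      linarith
    -- Projecting `O` to `Z`, and then to the new input, gives at most `k` centres at factor 2(2 +
    -- 2052) ≤ 2^13. A projected centre outside `U` stems from a bad centre, an insertion or a
    -- deletion.
    set Z' := O.image (nn Z) with hZ'
    have hZ'ne : Z'.Nonempty := hOne.image _
    have hZ'cost := rcost_image_nn_le hOne hZne P'
    have hW := rcost_image_nn_self_le (P := P') hZ'ne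
    refine ⟨Z'.image (nn P'), ?_, hZ'ne.image _, ?_, ?_, ?_⟩
    · intro x hx
      obtain ⟨y, -, rfl⟩ := Finset.mem_image.1 hx
      exact nn_mem hP' y
    · have h1 : (Z'.image (nn P')).card ≤ Z'.card := Finset.card_image_le
      have h2 : Z'.card ≤ O.card := Finset.card_image_le
      omega
    · norm_num
      linarith
    · have hsub : Z'.image (nn P') \ U ⊆ (B ∪ (P' \ P) ∪ (P \ P')).image (nn P') := by
        intro x hx
        obtain ⟨hx, hxU⟩ := Finset.mem_sdiff.1 hx
        obtain ⟨z, hz, rfl⟩ := Finset.mem_image.1 hx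
        refine Finset.mem_image_of_mem _ ?_
        obtain ⟨o, -, rfl⟩ := Finset.mem_image.1 hz
        have hzZ := nn_mem hZne o
        simp only [hZ, Finset.mem_union, Finset.mem_sdiff] at hzZ ⊢
        rcases hzZ with (h | h) | h
        · by_cases hP'z : nn Z o ∈ P'
          · rw [nn_eq_self hP'z] at hxU
            exact absurd h hxU
          · exact .inr ⟨hUP h, hP'z⟩
        · exact .inl (.inl h)
        · exact .inl (.inr h)
      have h1 := Finset.card_le_card hsub
      have h2 : ((B ∪ (P' \ P) ∪ (P \ P')).image (nn P')).card ≤ _ := Finset.card_image_le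
      have h3 := Finset.card_union_le (B ∪ (P' \ P)) (P \ P')
      have h4 := Finset.card_union_le B (P' \ P)
      omega
  have hext : ∀ W ⊆ P', W₀ ⊆ W → ∀ S ⊆ P', S.Nonempty → S.card ≤ k →
      rcost W P' ≤ 2 ^ 13 * rcost S P' := by
    intro W hW hsub S hS hne hc
    have h1 := rcost_anti hsub hW₀ne P'
    have h2 := hO S hS hne hc
    norm_num at hW₀cost ⊢
    linarith
  have hW₀c : W₀.card ≤ min k P'.card := le_min hW₀k (Finset.card_le_card hW₀P)
  have hYP : W₀ ∪ U ∩ P' ⊆ P' := Finset.union_subset hW₀P Finset.inter_subset_right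
  -- Fill up with surviving centres of `U` first. If they run out, all of them are used, and the
  -- sizes show that at most 2L centres lie outside `U`.
  rcases le_total (min k P'.card) (W₀ ∪ U ∩ P').card with hY | hY
  · obtain ⟨W, hW1, hW2, hW3⟩ := Finset.exists_subsuperset_card_eq
      (Finset.subset_union_left (s₁ := W₀) (s₂ := U ∩ P')) hW₀c hY
    refine ⟨W, hW2.trans hYP, hW3, hext W (hW2.trans hYP) hW1, ?_⟩
    refine (Finset.card_le_card fun x hx => ?_).trans hW₀U
    have h1 := hW2 (Finset.mem_sdiff.1 hx).1
    have h2 := (Finset.mem_sdiff.1 hx).2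
    simp only [Finset.mem_union, Finset.mem_inter, Finset.mem_sdiff] at h1 ⊢
    tauto
  · obtain ⟨W, hW1, hW2, hW3⟩ := Finset.exists_subsuperset_card_eq hYP hY (min_le_right _ _)
    refine ⟨W, hW2, hW3, hext W hW2 (Finset.subset_union_left.trans hW1), ?_⟩
    have h1 : (U ∩ P').card ≤ (W ∩ U).card := Finset.card_le_card fun x hx =>
      Finset.mem_inter.2 ⟨hW1 (Finset.mem_union_right _ hx), (Finset.mem_inter.1 hx).1⟩
    have h2 := Finset.card_sdiff_add_card_inter W U
    have h3 := Finset.card_sdiff_add_card_inter U P'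
    have h4 : (U \ P').card ≤ (P \ P').card :=
      Finset.card_le_card (Finset.sdiff_subset_sdiff hUP le_rfl)
    have h5 := Finset.card_sdiff_add_card_inter P' P
    have h6 : (P' ∩ P).card ≤ P.card := Finset.card_le_card Finset.inter_subset_right
    omega

end DynKMedian

/-! ### Restoring robustness, and a potential that pays for it. -/

namespace DynKMedian

variable {X : Type u} [MetricSpace X] [DecidableEq X]

/-! ## Making the centres robust -/

/-- The centre `u` is beaten by a point that is far away from the other centres `O`. -/
def Violated (P : Finset X) (O : List X) (u : X) : Prop :=
  ∃ v ∈ P, v ≠ u ∧ (∀ o ∈ O, 4096 * dist u v ≤ dist u o) ∧ Beats P v u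

/-- The point `x` is an admissible replacement for the centre `u` if the other centres are `O`. -/
def Replaces (P : Finset X) (O : List X) (u x : X) : Prop :=
  (∀ o ∈ O, 256 * dist u x ≤ dist u o) ∧ (x = u ∨ ¬Beats P u x) ∧
    ∀ w ∈ P, w ≠ x → (∀ o ∈ O, 1024 * dist x w ≤ dist u o) → ¬Beats P w x

/-- `exists_unbeaten` is applied at scale d(u, O)/512. Without other centres the scale 2Δ covers the
whole space. -/
theorem exists_replaces {P : Finset X} {Δ : ℝ}
    (hX : ∀ x y : X, x ≠ y → 1 ≤ dist x y ∧ dist x y ≤ Δ) (hΔ : 0 ≤ Δ) (O : List X) {u : X}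
    (hu : u ∈ P) : ∃ x ∈ P, Replaces P O u x := by
  obtain ⟨s, hs, h1, h2⟩ : ∃ s : ℝ, 0 ≤ s ∧ (∀ o ∈ O, 512 * s ≤ dist u o) ∧
      ∀ x w : X, w ≠ x → (∀ o ∈ O, 1024 * dist x w ≤ dist u o) → dist x w ≤ s / 2 := by
    by_cases hO : O = []
    · refine ⟨2 * Δ, by linarith, by simp [hO], fun x w hne _ => ?_⟩
      have := (hX x w (Ne.symm hne)).2
      linarith
    · obtain ⟨o, ho, hmin⟩ := O.toFinset.exists_min_image (fun o => dist u o)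
        (by simpa [List.toFinset_nonempty_iff] using hO)
      rw [List.mem_toFinset] at ho
      refine ⟨dist u o / 512, by positivity, fun o' ho' => ?_, fun x w _ h => ?_⟩
      · have := hmin o' (by simpa using ho')
        linarith
      · have := h o ho
        linarith
  obtain ⟨n, hn⟩ := pow_unbounded_of_one_lt s (show (1 : ℝ) < 8 by norm_num)
  obtain ⟨x, hx, hd, hunb, hself⟩ := exists_unbeaten (fun x y h => (hX x y h).1) n s hn hs u hu
  refine ⟨x, hx, fun o ho => ?_, ?_, fun w hw hne hsep => ?_⟩
  · have := h1 o ho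
    linarith
  · exact hself.imp_right fun h hb => h (hb.mono (by norm_num) (by norm_num))
  · have := h2 x w hne hsep
    rw [dist_comm] at this
    exact hunb w hw hne this

open Classical in
/-- Replace `u` if necessary. -/
noncomputable def fixCenter (P O : List X) (u : X) : X :=
  if Violated P.toFinset O u then (rfilter (Replaces P.toFinset O u) P).headD u else u

/-- One step in the processing of the list of centres: the first component of the state consists of
the new centres, the second one of the centres that have not yet been processed. -/
noncomputable def robustifyStep (P : List X) (s : List X × List X) (u : X) : List X × List X :=
  (fixCenter P (s.1.reverse ++ s.2.tail) u :: s.1, s.2.tail)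

noncomputable def robustify (P W : List X) : List X := (W.foldl (robustifyStep P) ([], W)).1

theorem fixCenter_spec {P : List X} {Δ : ℝ}
    (hX : ∀ x y : X, x ≠ y → 1 ≤ dist x y ∧ dist x y ≤ Δ) (hΔ : 0 ≤ Δ) (O : List X) {u : X}
    (hu : u ∈ P) : fixCenter P O u ∈ P ∧
      ((fixCenter P O u = u ∧ ¬Violated P.toFinset O u) ∨
        (Violated P.toFinset O u ∧ Replaces P.toFinset O u (fixCenter P O u))) := by
  by_cases h : Violated P.toFinset O u
  · obtain ⟨x, hx, hr⟩ := exists_replaces hX hΔ O (List.mem_toFinset.2 hu)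
    have hmem : x ∈ rfilter (Replaces P.toFinset O u) P := mem_rfilter.2 ⟨by simpa using hx, hr⟩
    have : fixCenter P O u ∈ rfilter (Replaces P.toFinset O u) P := by
      rw [fixCenter, if_pos h]
      cases hf : rfilter (Replaces P.toFinset O u) P with
      | nil => simp [hf] at hmem
      | cons a l => simp
    rw [mem_rfilter] at this
    exact ⟨this.1, .inr ⟨h, this.2⟩⟩
  · have : fixCenter P O u = u := by rw [fixCenter, if_neg h]
    exact ⟨by rwa [this], .inl ⟨this, h⟩⟩

/-- What is known about the replacement `x` of `u` if the other centres were `O`. -/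
def Settled (P : Finset X) (O : Set X) (u x : X) : Prop :=
  x ∈ P ∧ (∀ o ∈ O, 256 * dist u x ≤ dist u o) ∧ (x = u ∨ ¬Beats P u x) ∧
    ∀ v ∈ P, v ≠ x → (∀ o ∈ O, 4096 * dist x v ≤ dist u o) → ¬Beats P v x

theorem settled_fixCenter {P : List X} {Δ : ℝ}
    (hX : ∀ x y : X, x ≠ y → 1 ≤ dist x y ∧ dist x y ≤ Δ) (hΔ : 0 ≤ Δ) (O : List X) {u : X}
    (hu : u ∈ P) : Settled P.toFinset {o | o ∈ O} u (fixCenter P O u) := by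
  obtain ⟨hmem, h⟩ := fixCenter_spec hX hΔ O hu
  refine ⟨by simpa using hmem, ?_⟩
  rcases h with ⟨he, hv⟩ | ⟨-, h1, h2, h3⟩
  · rw [he]
    refine ⟨by simp, .inl rfl, fun v hv' hne hsep hb => hv ⟨v, hv', hne, hsep, hb⟩⟩
  · refine ⟨h1, h2, fun v hv hne hsep => h3 v hv hne fun o ho => ?_⟩
    have := hsep o ho
    linarith [dist_nonneg (x := fixCenter P O u) (y := v)]

/-- `L` lists pairs of a centre and its replacement, the latest first. When a pair was made, the
other centres were the replacements of the pairs behind it and the originals of those in front of it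
or still waiting. -/
theorem foldl_robustifyStep_trace {P : List X} {Δ : ℝ}
    (hX : ∀ x y : X, x ≠ y → 1 ≤ dist x y ∧ dist x y ≤ Δ) (hΔ : 0 ≤ Δ) (rest : List X)
    (hrest : rest ⊆ P) (L : List (X × X))
    (hL : ∀ A q B, L = A ++ q :: B →
      Settled P.toFinset {o | o ∈ B.map Prod.snd ++ A.map Prod.fst ++ rest} q.1 q.2) :
    ∃ L' : List (X × X), (rest.foldl (robustifyStep P) (L.map Prod.snd, rest)).1 = L'.map Prod.snd ∧
      L'.map Prod.fst = rest.reverse ++ L.map Prod.fst ∧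
      ∀ A q B, L' = A ++ q :: B →
        Settled P.toFinset {o | o ∈ B.map Prod.snd ++ A.map Prod.fst} q.1 q.2 := by
  induction rest generalizing L with
  | nil => exact ⟨L, rfl, by simp, by simpa using hL⟩
  | cons u rest ih =>
    set x := fixCenter P ((L.map Prod.snd).reverse ++ rest) u with hx
    obtain ⟨L', h1, h2, h3⟩ := ih (fun _ h => hrest (List.mem_cons_of_mem _ h)) ((u, x) :: L) (by
      intro A q B hAB
      rcases A with _ | ⟨a, A⟩
      · simp only [List.nil_append, List.cons.injEq] at hAB
        obtain ⟨rfl, rfl⟩ := hAB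
        convert settled_fixCenter hX hΔ ((L.map Prod.snd).reverse ++ rest)
          (hrest (List.mem_cons_self (a := u) (l := rest))) using 1
        ext o
        simp
      · simp only [List.cons_append, List.cons.injEq] at hAB
        obtain ⟨rfl, hAB⟩ := hAB
        convert hL A q B hAB using 1
        ext o
        simp
        tauto)
    refine ⟨L', ?_, by rw [h2]; simp, h3⟩
    rw [← h1]
    simp [robustifyStep, hx]

/-- The centres together with their replacements. -/
theorem exists_robustify_pairs {P W : List X} {Δ : ℝ}
    (hX : ∀ x y : X, x ≠ y → 1 ≤ dist x y ∧ dist x y ≤ Δ) (hΔ : 0 ≤ Δ) (hWP : W ⊆ P)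
    (hW : W.Nodup) :
    ∃ L : List (X × X), robustify P W = L.map Prod.snd ∧ L.map Prod.fst = W.reverse ∧
      (∀ q ∈ L, ∀ q' ∈ L, q' ≠ q → 128 * dist q.1 q.2 ≤ dist q.1 q'.1) ∧
      ∀ q ∈ L, q.2 ∈ P ∧ (q.2 = q.1 ∨ ¬Beats P.toFinset q.1 q.2) ∧
        ∀ v ∈ P, v ≠ q.2 → (∀ q' ∈ L, q' ≠ q → 8192 * dist q.2 v ≤ dist q.2 q'.2) →
          ¬Beats P.toFinset v q.2 := by
  obtain ⟨L, h1, h2, h3⟩ := foldl_robustifyStep_trace hX hΔ W hWP [] (by simp)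
  rw [List.map_nil, List.append_nil] at h2
  have hnd : L.Nodup := List.Nodup.of_map Prod.fst (by rw [h2]; simpa using hW)
  -- The later centre `q'` was compared with the replacement of `q` and not with `q.1`. That
  -- replacement moved little, so 256 weakens to 128 and the bound becomes symmetric.
  have hord : ∀ A q' B q C, L = A ++ q' :: (B ++ q :: C) →
      128 * dist q.1 q.2 ≤ dist q.1 q'.1 ∧ 128 * dist q'.1 q'.2 ≤ dist q'.1 q.1 := by
    intro A q' B q C hL
    have hq := (h3 (A ++ q' :: B) q C (by simp [hL])).2.1 q'.1 (by simp)
    have hq' := (h3 A q' (B ++ q :: C) hL).2.1 q.2 (by simp)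
    have h4 := dist_triangle q'.1 q.1 q.2
    have h5 := dist_comm q.1 q'.1
    have := dist_nonneg (x := q.1) (y := q'.1)
    constructor <;> linarith
  have hsep : ∀ q ∈ L, ∀ q' ∈ L, q' ≠ q → 128 * dist q.1 q.2 ≤ dist q.1 q'.1 := by
    intro q hq q' hq' hne
    obtain ⟨A, B, hL⟩ := List.append_of_mem hq
    rw [hL, List.mem_append, List.mem_cons] at hq'
    rcases hq' with h | h | h
    · obtain ⟨A', B', rfl⟩ := List.append_of_mem h
      exact (hord A' q' B' q B (by simp [hL])).1
    · exact absurd h hne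
    · obtain ⟨A', B', rfl⟩ := List.append_of_mem h
      exact (hord A q A' q' B' hL).2
  refine ⟨L, h1, h2, hsep, fun q hq => ?_⟩
  obtain ⟨A, B, hL⟩ := List.append_of_mem hq
  obtain ⟨hqP, -, hself, hunb⟩ := h3 A q B hL
  refine ⟨by simpa using hqP, hself, fun v hv hne h => hunb v (by simpa using hv) hne fun o ho => ?_⟩
  -- Each centre moved by at most 1/128 of the original distances. Passing between originals and
  -- replacements thus fits between 8192 and 4096.
  have hother : ∀ q' ∈ L, q' ≠ q → 4096 * dist q.2 v ≤ dist q.1 q'.1 ∧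
      4096 * dist q.2 v ≤ dist q.1 q'.2 := by
    intro q' hq' hne'
    have h4 := h q' hq' hne'
    have h5 := hsep q hq q' hq' hne'
    have h6 := hsep q' hq' q hq hne'.symm
    rw [dist_comm q'.1 q.1] at h6
    have h7 := dist_triangle4 q.2 q.1 q'.1 q'.2
    rw [dist_comm q.2 q.1] at h7
    have h8 := dist_triangle_right q.1 q'.1 q'.2
    have := dist_nonneg (x := q.1) (y := q'.1)
    constructor <;> linarith
  rw [hL, List.nodup_append, List.nodup_cons] at hnd
  simp only [Set.mem_ofPred_eq, List.mem_append, List.mem_map] at ho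
  rcases ho with ⟨q', hq', rfl⟩ | ⟨q', hq', rfl⟩
  · refine (hother q' (by simp [hL, hq']) ?_).2
    rintro rfl
    exact hnd.2.1.1 hq'
  · refine (hother q' (by simp [hL, hq']) ?_).1
    rintro rfl
    exact hnd.2.2 q' hq' q' (by simp) rfl

/-- Moves by at most 1/128 of the mutual distances cannot merge two centres, and they leave the
separation 35 that `rcost_reassign_le` needs. -/
theorem robustify_spec {P W : List X} {Δ : ℝ}
    (hX : ∀ x y : X, x ≠ y → 1 ≤ dist x y ∧ dist x y ≤ Δ) (hΔ : 0 ≤ Δ) (hWP : W ⊆ P)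
    (hW : W.Nodup) :
    robustify P W ⊆ P ∧ (robustify P W).Nodup ∧ (robustify P W).length = W.length ∧
      Robust (robustify P W).toFinset P.toFinset ∧
      (W ≠ [] → rcost (robustify P W).toFinset P.toFinset ≤ 1026 * rcost W.toFinset P.toFinset) := by
  obtain ⟨L, h1, h2, hsep, hL⟩ := exists_robustify_pairs hX hΔ hWP hW
  have hnd : (L.map Prod.fst).Nodup := by rw [h2]; simpa using hW
  have hinj : ∀ q ∈ L, ∀ q' ∈ L, q ≠ q' → q.2 ≠ q'.2 := by
    intro q hq q' hq' hne heq
    have h3 := hsep q hq q' hq' hne.symm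
    have h4 := hsep q' hq' q hq hne
    rw [dist_comm q'.1 q.1] at h4
    have h5 := dist_triangle_right q.1 q'.1 q.2
    rw [heq] at h5 h3
    have h6 : dist q.1 q'.1 ≤ 0 := by linarith [dist_nonneg (x := q.1) (y := q'.1)]
    exact hne (Prod.ext (dist_le_zero.1 h6) heq)
  rw [h1]
  refine ⟨?_, ?_, ?_, ?_, ?_⟩
  · intro x hx
    obtain ⟨q, hq, rfl⟩ := List.mem_map.1 hx
    exact (hL q hq).1
  · refine List.Nodup.map_on (fun q hq q' hq' h => ?_) (List.Nodup.of_map _ hnd)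
    by_contra hne
    exact hinj q hq q' hq' hne h
  · rw [List.length_map, ← List.length_reverse (as := W), ← h2, List.length_map]
  · intro x hx v hv hne h
    obtain ⟨q, hq, rfl⟩ := List.mem_map.1 (List.mem_toFinset.1 hx)
    refine (hL q hq).2.2 v (List.mem_toFinset.1 hv) hne fun q' hq' hne' => h _ ?_ ?_
    · exact List.mem_toFinset.2 (List.mem_map_of_mem hq')
    · exact hinj q' hq' q hq hne'
  · intro hne
    have hex : ∀ u ∈ W, ∃ x, (u, x) ∈ L := by
      intro u hu
      have : u ∈ L.map Prod.fst := by rw [h2]; simpa using hu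
      obtain ⟨q, hq, rfl⟩ := List.mem_map.1 this
      exact ⟨q.2, hq⟩
    choose! φ hφ using hex
    refine rcost_reassign_le ((List.toFinset_nonempty_iff W).2 hne) φ (fun u hu => ?_)
      fun u hu => ?_
    · exact List.mem_toFinset.2 (List.mem_map.2 ⟨_, hφ u (List.mem_toFinset.1 hu), rfl⟩)
    · rw [List.mem_toFinset] at hu
      refine (hL _ (hφ u hu)).2.1.imp_right fun h => ⟨h, fun u' hu' hne' => ?_⟩
      rw [List.mem_toFinset] at hu'
      have := hsep _ (hφ u hu) _ (hφ u' hu') (fun h => hne' (congrArg Prod.fst h))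
      simp only at this
      linarith [dist_nonneg (x := u) (y := φ u)]

/-! ## The potential -/

/-- Certified levels of robustness: the centre `u` is not beaten by points at distance less than
`2 ^ g u`, and centres with high levels are far apart. -/
structure Levels (P W : Finset X) (G : ℕ) (g : X → ℕ) : Prop where
  le : ∀ u ∈ W, g u ≤ G
  unbeaten : ∀ u ∈ W, ∀ w ∈ P, w ≠ u → dist w u < 2 ^ g u → ¬Beats P w u
  sep : ∀ u ∈ W, ∀ u' ∈ W, u ≠ u' → ∀ i, 1 ≤ i → i ≤ g u → i ≤ g u' → 64 * 2 ^ i ≤ dist u u'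

def potential (W : Finset X) (G : ℕ) (g : X → ℕ) : ℕ := ∑ u ∈ W, (G - g u)

/-- The violating point lies beyond the certified radius 2^(g u), so all other centres are at least
4096 times that far from `u`. This leaves room to certify `x` at level `g u + 1`. The level stays at
most `G`, because no distance reaches 2^G. -/
theorem Levels.replace {P O : Finset X} {L : List X} {G : ℕ} {g : X → ℕ} {u x : X} {Δ : ℝ}
    (hX : ∀ x y : X, x ≠ y → 1 ≤ dist x y ∧ dist x y ≤ Δ) (hΔ : Δ < 2 ^ G) (hu : u ∉ O)
    (hLO : ∀ o, o ∈ L ↔ o ∈ O) (h : Levels P (insert u O) G g) (hviol : Violated P L u)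
    (hrep : Replaces P L u x) :
    x ∉ O ∧ ∃ g', Levels P (insert x O) G g' ∧
      potential (insert x O) G g' + 1 ≤ potential (insert u O) G g := by
  obtain ⟨v, hv, hvu, hvO, hb⟩ := hviol
  obtain ⟨hxO, -, hxunb⟩ := hrep
  simp only [hLO] at hvO hxO hxunb
  have huI : u ∈ insert u O := Finset.mem_insert_self _ _
  have hlow : 2 ^ g u ≤ dist u v := by
    by_contra! hlt
    rw [dist_comm] at hlt
    exact h.unbeaten u huI v hv hvu hlt hb
  have hgG : g u < G := by
    by_contra! hle
    have h1 : (2 : ℝ) ^ G ≤ 2 ^ g u := pow_le_pow_right₀ (by norm_num) hle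
    have h2 := (hX u v hvu.symm).2
    linarith
  have hfar : ∀ o ∈ O, 4096 * 2 ^ g u ≤ dist u o := fun o ho => by
    have := hvO o ho
    linarith
  have hpos : (0 : ℝ) < 2 ^ g u := by positivity
  have hxfar : ∀ o ∈ O, 4000 * 2 ^ g u ≤ dist x o := fun o ho => by
    have h1 := hfar o ho
    have h2 := hxO o ho
    have h3 := dist_triangle u x o
    linarith
  have hx : x ∉ O := fun hx => by
    have := hxfar x hx
    rw [dist_self] at this
    linarith
  refine ⟨hx, Function.update g x (g u + 1), ⟨?_, ?_, ?_⟩, ?_⟩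
  · intro w hw
    by_cases hwx : w = x
    · rw [hwx, Function.update_self]
      exact hgG
    · rw [Function.update_of_ne hwx]
      exact h.le w (Finset.mem_insert_of_mem ((Finset.mem_insert.1 hw).resolve_left hwx))
  · intro w hw y hy hne hd
    by_cases hwx : w = x
    · subst hwx
      rw [Function.update_self, pow_succ] at hd
      refine hxunb y hy hne fun o ho => ?_
      have := hfar o ho
      rw [dist_comm w y]
      linarith
    · rw [Function.update_of_ne hwx] at hd
      exact h.unbeaten w (Finset.mem_insert_of_mem ((Finset.mem_insert.1 hw).resolve_left hwx))
        y hy hne hd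
  · have key : ∀ o ∈ O, ∀ i, i ≤ g u + 1 → 64 * 2 ^ i ≤ dist x o := fun o ho i hi => by
      have h1 : (2 : ℝ) ^ i ≤ 2 ^ (g u + 1) := pow_le_pow_right₀ (by norm_num) hi
      rw [pow_succ] at h1
      have := hxfar o ho
      linarith
    intro w hw w' hw' hne i hi hiw hiw'
    rw [Finset.mem_insert] at hw hw'
    rcases hw with rfl | hw <;> rcases hw' with rfl | hw'
    · exact absurd rfl hne
    · rw [Function.update_self] at hiw
      exact key w' hw' i hiw
    · rw [Function.update_self] at hiw'
      rw [dist_comm]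
      exact key w hw i hiw'
    · rw [Function.update_of_ne (ne_of_mem_of_not_mem hw hx)] at hiw
      rw [Function.update_of_ne (ne_of_mem_of_not_mem hw' hx)] at hiw'
      exact h.sep w (Finset.mem_insert_of_mem hw) w' (Finset.mem_insert_of_mem hw') hne i hi hiw hiw'
  · rw [potential, potential, Finset.sum_insert hx, Finset.sum_insert hu, Function.update_self]
    have : ∑ y ∈ O, (G - Function.update g x (g u + 1) y) = ∑ y ∈ O, (G - g y) :=
      Finset.sum_congr rfl fun y hy => by
        rw [Function.update_of_ne (ne_of_mem_of_not_mem hy hx)]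
    omega

/-- A replacement creates at most one centre outside `W` and lowers the potential by at least one,
so their sum never grows. -/
theorem foldl_robustifyStep_levels {P : List X} {G : ℕ} {Δ : ℝ}
    (hX : ∀ x y : X, x ≠ y → 1 ≤ dist x y ∧ dist x y ≤ Δ) (hΔ0 : 0 ≤ Δ) (hΔ : Δ < 2 ^ G)
    (W : Finset X) (rest : List X) (hrest : rest ⊆ P) (done : List X) (g : X → ℕ)
    (hnd : (done ++ rest).Nodup) (h : Levels P.toFinset (done ++ rest).toFinset G g) :
    ∃ g', Levels P.toFinset (rest.foldl (robustifyStep P) (done, rest)).1.toFinset G g' ∧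
      potential (rest.foldl (robustifyStep P) (done, rest)).1.toFinset G g' +
        ((rest.foldl (robustifyStep P) (done, rest)).1.toFinset \ W).card ≤
      potential (done ++ rest).toFinset G g + ((done ++ rest).toFinset \ W).card := by
  induction rest generalizing done g with
  | nil => exact ⟨g, by simpa using h, by simp⟩
  | cons u rest ih =>
    have hrest' : rest ⊆ P := fun _ h => hrest (List.mem_cons_of_mem _ h)
    have huP : u ∈ P := hrest List.mem_cons_self
    set O := done.reverse ++ rest with hO
    set x := fixCenter P O u with hx
    have hset : (done ++ u :: rest).toFinset = insert u O.toFinset := by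
      ext
      simp [hO]
    have hset' : (x :: done ++ rest).toFinset = insert x O.toFinset := by
      ext
      simp [hO]
    have hnd' : u ∉ O ∧ (done ++ rest).Nodup := by
      have := List.nodup_middle.1 hnd
      rw [List.nodup_cons] at this
      simpa [hO] using this
    have hstep : (u :: rest).foldl (robustifyStep P) (done, u :: rest) =
        rest.foldl (robustifyStep P) (x :: done, rest) := by
      simp [robustifyStep, hx, hO]
    rw [hstep]
    rw [hset] at h ⊢
    obtain ⟨hxO, g₁, hg₁, hpot⟩ : x ∉ O ∧ ∃ g₁, Levels P.toFinset (insert x O.toFinset) G g₁ ∧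
        potential (insert x O.toFinset) G g₁ + (insert x O.toFinset \ W).card ≤
          potential (insert u O.toFinset) G g + (insert u O.toFinset \ W).card := by
      rcases (fixCenter_spec hX hΔ0 O huP).2 with ⟨he, -⟩ | ⟨hv, hr⟩
      · rw [hx, he]
        exact ⟨hnd'.1, g, h, le_rfl⟩
      · obtain ⟨h1, g₁, h2, h3⟩ := h.replace hX hΔ (by simpa using hnd'.1) (by simp) hv hr
        refine ⟨by simpa using h1, g₁, h2, ?_⟩
        have h4 : (insert x O.toFinset \ W).card ≤ (insert u O.toFinset \ W).card + 1 := by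
          have h5 : insert x O.toFinset \ W ⊆ insert x (insert u O.toFinset \ W) := by
            intro y
            simp only [Finset.mem_sdiff, Finset.mem_insert]
            tauto
          exact (Finset.card_le_card h5).trans (Finset.card_insert_le _ _)
        rw [← hx] at h3
        omega
    obtain ⟨g₂, hg₂, hpot₂⟩ := ih hrest' (x :: done) g₁
      (by
        rw [List.cons_append, List.nodup_cons]
        exact ⟨by simpa [hO] using hxO, hnd'.2⟩) (by rwa [hset'])
    rw [hset'] at hpot₂
    exact ⟨g₂, hg₂, hpot₂.trans hpot⟩

/-- Every replacement is paid for by the potential. -/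
theorem Levels.robustify {P W : List X} {G : ℕ} {Δ : ℝ} {g : X → ℕ}
    (hX : ∀ x y : X, x ≠ y → 1 ≤ dist x y ∧ dist x y ≤ Δ) (hΔ0 : 0 ≤ Δ) (hΔ : Δ < 2 ^ G)
    (hWP : W ⊆ P) (hW : W.Nodup) (h : Levels P.toFinset W.toFinset G g) :
    ∃ g', Levels P.toFinset (robustify P W).toFinset G g' ∧
      potential (DynKMedian.robustify P W).toFinset G g' +
        ((DynKMedian.robustify P W).toFinset \ W.toFinset).card ≤ potential W.toFinset G g := by
  obtain ⟨g', h1, h2⟩ := foldl_robustifyStep_levels hX hΔ0 hΔ W.toFinset W hWP [] g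
    (by simpa using hW) (by simpa using h)
  exact ⟨g', h1, by simpa [DynKMedian.robustify] using h2⟩

theorem cnt_congr {P P' : Finset X} {p x : X} {r : ℝ} (hP : ∀ q, q ≠ p → (q ∈ P' ↔ q ∈ P))
    (hp : r < dist p x) : cnt P' x r = cnt P x r := by
  rw [cnt, cnt]
  congr 1
  ext q
  simp only [Finset.mem_filter]
  refine and_congr_left fun hq => hP q ?_
  rintro rfl
  exact absurd hq (not_le.2 hp)

/-- An update of the input destroys at most one certificate per level. -/
theorem Levels.update {P P' W : Finset X} {G : ℕ} {Δ : ℝ} {g : X → ℕ} {p : X}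
    (hX : ∀ x y : X, x ≠ y → 1 ≤ dist x y ∧ dist x y ≤ Δ) (h : Levels P W G g)
    (hP : ∀ q, q ≠ p → (q ∈ P' ↔ q ∈ P)) :
    ∃ g', Levels P' W G g' ∧ potential W G g' ≤ potential W G g + G * G := by
  classical
  set B := W.filter fun u => ∃ w ∈ P', w ≠ u ∧ dist w u < 2 ^ g u ∧ Beats P' w u with hB
  -- A certificate breaks only if `p` enters one of the balls counted in `Beats`. Centres of equal
  -- level g ≥ 1 are 64·2^g apart, so `p` is this close to at most one of them.
  have hnear : ∀ u ∈ B, 1 ≤ g u ∧ dist p u ≤ 16 * 2 ^ g u := by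
    intro u hu
    rw [hB, Finset.mem_filter] at hu
    obtain ⟨huW, w, hw, hne, hd, hb⟩ := hu
    have h1 := (hX w u hne).1
    constructor
    · by_contra! h0
      rw [Nat.lt_one_iff.1 h0, pow_zero] at hd
      linarith
    · by_contra! hfar
      have hwp : w ≠ p := by
        rintro rfl
        linarith
      refine h.unbeaten u huW w ((hP w hwp).1 hw) hne hd ?_
      have h2 := dist_triangle p w u
      rw [Beats, Majority] at hb ⊢
      rwa [cnt_congr hP (by linarith), cnt_congr hP (by linarith)] at hb
  have hcard : B.card ≤ G := by
    have hinj : Set.InjOn g (B : Set X) := by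
      intro u hu u' hu' heq
      by_contra hne
      rw [Finset.mem_coe] at hu hu'
      obtain ⟨h1, h2⟩ := hnear u hu
      have h3 := (hnear u' hu').2
      have h4 := h.sep u (Finset.mem_filter.1 hu).1 u' (Finset.mem_filter.1 hu').1 hne (g u) h1
        le_rfl heq.le
      have h5 := dist_triangle_left u u' p
      rw [← heq] at h3
      have : (0 : ℝ) < 2 ^ g u := by positivity
      linarith
    have hmaps : ∀ u ∈ B, g u ∈ Finset.Icc 1 G := fun u hu =>
      Finset.mem_Icc.2 ⟨(hnear u hu).1, h.le u (Finset.mem_filter.1 hu).1⟩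
    simpa using Finset.card_le_card_of_injOn g hmaps hinj
  refine ⟨fun u => if u ∈ B then 0 else g u, ⟨?_, ?_, ?_⟩, ?_⟩
  · intro u hu
    split_ifs
    exacts [Nat.zero_le _, h.le u hu]
  · intro u hu w hw hne hd hb
    by_cases huB : u ∈ B
    · simp only [huB, if_true, pow_zero] at hd
      linarith [(hX w u hne).1]
    · simp only [huB, if_false] at hd
      exact huB (Finset.mem_filter.2 ⟨hu, w, hw, hne, hd, hb⟩)
  · intro u hu u' hu' hne i hi h1 h2
    split_ifs at h1 h2
    all_goals first | omega | exact h.sep u hu u' hu' hne i hi h1 h2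
  · calc potential W G _ ≤ ∑ u ∈ W, ((G - g u) + if u ∈ B then G else 0) := by
          refine Finset.sum_le_sum fun u _ => ?_
          dsimp only
          split_ifs <;> omega
      _ = potential W G g + (W.filter (· ∈ B)).card * G := by
          rw [Finset.sum_add_distrib, ← Finset.sum_filter, Finset.sum_const, smul_eq_mul, potential]
      _ ≤ potential W G g + G * G := by
          have : (W.filter (· ∈ B)).card ≤ B.card :=
            Finset.card_le_card fun u hu => (Finset.mem_filter.1 hu).2
          gcongr
          exact this.trans hcard

/-- New centres start at level zero. -/
theorem Levels.change {P W W' : Finset X} {G : ℕ} {Δ : ℝ} {g : X → ℕ}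
    (hX : ∀ x y : X, x ≠ y → 1 ≤ dist x y ∧ dist x y ≤ Δ) (h : Levels P W G g) :
    ∃ g', Levels P W' G g' ∧ potential W' G g' ≤ potential W G g + (W' \ W).card * G := by
  classical
  refine ⟨fun u => if u ∈ W then g u else 0, ⟨?_, ?_, ?_⟩, ?_⟩
  · intro u _
    split_ifs with hu
    exacts [h.le u hu, Nat.zero_le _]
  · intro u _ w hw hne hd hb
    by_cases hu : u ∈ W
    · simp only [hu, if_true] at hd
      exact h.unbeaten u hu w hw hne hd hb
    · simp only [hu, if_false, pow_zero] at hd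
      linarith [(hX w u hne).1]
  · intro u _ u' _ hne i hi h1 h2
    split_ifs at h1 h2 with hu hu'
    all_goals first | omega | exact h.sep u hu u' hu' hne i hi h1 h2
  · rw [potential, ← Finset.sum_inter_add_sum_sdiff W' W, potential]
    refine add_le_add ?_ ?_
    · refine le_trans (Finset.sum_le_sum (g := fun u => G - g u) fun u hu => ?_)
        (Finset.sum_le_sum_of_subset Finset.inter_subset_right)
      rw [if_pos (Finset.mem_inter.1 hu).2]
    · rw [← smul_eq_mul]
      exact Finset.sum_le_card_nsmul _ _ _ fun u _ => Nat.sub_le _ _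

end DynKMedian

/-! ### The algorithm as functions on lists, and a program computing them. -/

namespace DynKMedian

variable {X : Type u} [MetricSpace X] [DecidableEq X]

/-! ## The algorithm -/

/-- Are all nonempty sublists `T` of `P` with `f T` at most `2 ^ j` times better than `S`? -/
def Competitive (j : ℕ) (P S : List X) (f : List X → Prop) : Prop :=
  ∀ T ∈ sublistsOf P, T ≠ [] → f T → rcost S.toFinset P.toFinset ≤ 2 ^ j * rcost T.toFinset P.toFinset

/-- The solutions among which the centres of the next epoch are chosen. -/
noncomputable def nextCandidates (k : ℕ) (P : List X) : List (List X) :=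
  rfilter (fun W => (W.length ≤ k ∧ (W.length = k ∨ W.length = P.length)) ∧
    Competitive 13 P W fun T => T.length ≤ k) (sublistsOf P)

/-- A good solution that has as few centres outside of `U` as possible. -/
noncomputable def nextCenters (k : ℕ) (P U : List X) : List X :=
  leastBy (fun W => ((rfilter (· ∉ U) W).length : ℝ)) (nextCandidates k P)
    ((nextCandidates k P).headD [])

/-- With L = k - |S| spare centres, `S` must compete with k + L = 2k - |S| centres. Up to L later
deletions can then be added to a solution of size `k`. -/
noncomputable def startCandidates (k : ℕ) (P W : List X) : List (List X) :=
  rfilter (fun S => S ≠ [] ∧ Competitive 43 P S fun T => S.length + T.length ≤ 2 * k) (sublistsOf W)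

/-- The smallest subset of the centres that is good enough to start an epoch. -/
noncomputable def startCenters (k : ℕ) (P W : List X) : List X :=
  leastBy (fun S => (S.length : ℝ)) (startCandidates k P W) ((startCandidates k P W).headD [])

/-- The state of the algorithm: the input, the robust centres at the beginning of the epoch, the
centres used in this epoch together with their representatives in the input, the number of updates
after which the epoch ends, and the parameter `k`. -/
structure State (X : Type u) where
  pts : List X
  base : List X
  reps : List (X × X)
  rem : ℕ
  k : ℕ

def Update.point {X : Type u} : Update X → X
  | .insert x => x
  | .delete x => x

/-- The input after an update, as a list. -/
noncomputable def Update.applyList (P : List X) : Update X → List X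
  | .insert x => x :: P
  | .delete x => rfilter (· ≠ x) P

/-- A point of `P` that is nearest to `s`. -/
noncomputable def nearest (P : List X) (s : X) : X := leastBy (fun p => dist s p) P (P.headD s)

/-- The representatives after an update that led to the input `P`. -/
noncomputable def Update.applyReps (P : List X) (reps : List (X × X)) : Update X → List (X × X)
  | .insert x => (x, x) :: reps
  | .delete x => if P = [] then [] else
      (reps.map fun q => if q.2 = x then (q.1, nearest P q.1) else q).reverse

/-- The state at the beginning of an epoch. -/
noncomputable def newEpoch (k : ℕ) (P U : List X) : State X where
  pts := P
  base := robustify P (nextCenters k P U)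
  reps := ((startCenters k P (robustify P (nextCenters k P U))).map fun s => (s, s)).reverse
  rem := k - (startCenters k P (robustify P (nextCenters k P U))).length
  k := k

/-- The update that finds `rem` exhausted starts the next epoch, so an epoch spans one update more
than it has spare centres. -/
noncomputable def State.next (s : State X) (u : Update X) : State X :=
  if 1 ≤ s.rem then
    ⟨u.applyList s.pts, s.base, u.applyReps (u.applyList s.pts) s.reps, s.rem - 1, s.k⟩
  else newEpoch s.k (u.applyList s.pts) s.base

/-! ## The program -/

namespace Prog

def eqReal (p q : Prog) : Prog := and (op .le p q) (op .le q p)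

/-! The arguments of the following programs are positions in the environment. -/

def cost (S P : ℕ) : Prog :=
  sum (var P) (op .dist (var 0) (minBy (var (S + 1)) (op .dist (var 1) (var 0))))

/-- There is no division: 1/512 becomes a factor 2^9 on the other side. A position grows by one
under each binder, since `skip` hides the accumulator of a fold. -/
def beats (P w x : ℕ) : Prog :=
  not (op .le
    (scale 1 (length (filter (var P) (op .le (scale 9 (op .dist (var 0) (var (w + 1))))
      (op .dist (var (w + 1)) (var (x + 1)))))))
    (length (filter (var P) (op .le (op .dist (var 0) (var (x + 1)))
      (scale 4 (op .dist (var (w + 1)) (var (x + 1))))))))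

def violated (P O u : ℕ) : Prog :=
  any (var P) (and (not (eqPt (var 0) (var (u + 1))))
    (and (all (var (O + 1)) (op .le (scale 12 (op .dist (var (u + 2)) (var 1)))
      (op .dist (var (u + 2)) (var 0)))) (beats (P + 1) 0 (u + 1))))

def replaces (P O u x : ℕ) : Prog :=
  and (all (var O) (op .le (scale 8 (op .dist (var (u + 1)) (var (x + 1))))
      (op .dist (var (u + 1)) (var 0))))
    (and (or (eqPt (var x) (var u)) (not (beats P u x)))
      (all (var P) (or (eqPt (var 0) (var (x + 1)))
        (or (not (all (var (O + 1)) (op .le (scale 10 (op .dist (var (x + 2)) (var 1)))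
          (op .dist (var (u + 2)) (var 0))))) (not (beats (P + 1) 0 (x + 1)))))))

def fixCenter (P O u : ℕ) : Prog :=
  ite (violated P O u) (hd (filter (var P) (replaces (P + 1) (O + 1) (u + 1) 0))) (var u)

def robustify (P W : ℕ) : Prog :=
  hd (fold (var W) (pair (prim .nil) (var W))
    (letIn (revAppend (hd (var 1)) (tl (tl (var 1))))
      (pair (pair (fixCenter (P + 3) 0 1) (hd (var 2))) (tl (tl (var 2))))))

/-- The candidates `T` are the lists in `C`; they are bound to position `0` in `cond`. -/
def competitive (j C P S : ℕ) (cond : Prog) : Prog :=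
  all (var C) (ite (var 0)
    (or (not cond) (op .le (cost (S + 1) (P + 1)) (scale j (cost 0 (P + 1))))) tt)

def nextCenters (k C P U : ℕ) : Prog :=
  minBy (filter (var C) (and
      (and (op .le (length (var 0)) (var (k + 1)))
        (or (eqReal (length (var 0)) (var (k + 1))) (eqReal (length (var 0)) (length (var (P + 1))))))
      (competitive 13 (C + 1) (P + 1) 0 (op .le (length (var 0)) (var (k + 2))))))
    (length (filter (var 0) (not (any (var (U + 2)) (eqPt (var 1) (var 0))))))

def startCenters (k C P W : ℕ) : Prog :=
  minBy (filter (subs (var W)) (ite (var 0)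
      (competitive 43 (C + 1) (P + 1) 0
        (op .le (op .add (length (var 1)) (length (var 0))) (scale 1 (var (k + 2))))) (prim .nil)))
    (length (var 0))

/-- The input after the update; the environment starts with the point and the kind of the update. -/
def applyList (P : ℕ) : Prog :=
  ite (var 1) (pair (var 0) (var P)) (filter (var P) (not (eqPt (var 0) (var 1))))

/-- The new representatives; the environment starts with the new input, the point and the kind of
the update. -/
def applyReps (R : ℕ) : Prog :=
  ite (var 2) (pair (pair (var 1) (var 1)) (var R))
    (ite (var 0)
      (map (var R) (ite (eqPt (tl (var 0)) (var 2))
        (pair (hd (var 0)) (minBy (var 1) (op .dist (hd (var 1)) (var 0)))) (var 0)))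
      (prim .nil))

/-- The state, given the positions of its components. -/
def state (P W R rem k : ℕ) : Prog :=
  pair (map (var R) (tl (var 0)))
    (pair (var P) (pair (var W) (pair (var R) (pair (var rem) (pair (var k) (prim .nil))))))

/-- The environment consists of the new input, the point and kind of the update, and the state. -/
def continueEpoch : Prog :=
  letIn (applyReps 6) (letIn (op .sub (var 8) (prim .one)) (state 2 7 1 0 10))

def newEpoch : Prog :=
  letIn (subs (var 0))
    (letIn (nextCenters 9 0 1 6)
      (letIn (robustify 2 0)
        (letIn (startCenters 11 2 3 0)
          (letIn (map (var 0) (pair (var 0) (var 0)))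
            (letIn (op .sub (var 13) (length (var 1)))
              (state 6 3 1 0 14))))))

def init : Prog :=
  pair (prim .nil) (pair (prim .nil) (pair (prim .nil) (pair (prim .nil)
    (pair (prim .id) (pair (prim .id) (prim .nil))))))

/-- After `applyList` the positions are: 0 new input, 1 point, 2 kind, 3 display, 4 old input, 5
base, 6 representatives, 7 `rem`, 8 `k`. -/
def step : Prog :=
  seq (pair (tl (prim .tl)) (pair (hd (prim .tl)) (prim .hd)))
    (letIn (applyList 3) (ite (op .le (prim .one) (var 7)) continueEpoch newEpoch))

end Prog

/-- The algorithm. -/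
def algorithm : DynAlg := ⟨.init, .step⟩

/-! ## Correctness of the program -/

section program

variable {N : ℕ} [hN : Fact (5 ≤ N)] {p q c : Prog} {v w z a b ρ : Val X} {r s : ℝ} {Q Q' : Prop}

def Val.pts (l : List X) : Val X := encList Val.point l

theorem Runs.eqReal (hp : Runs N p ρ (.real r)) (hq : Runs N q ρ (.real s)) :
    Runs N (.eqReal p q) ρ (.bool (r = s)) :=
  ((hp.le hq).and fun _ => hq.le hp).congr le_antisymm_iff.symm

theorem Runs.cost {S P : List X} {i j : ℕ} (hS : Runs N (.var i) ρ (.pts S))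
    (hP : Runs N (.var j) ρ (.pts P)) (hSN : S.length < N) (hPN : P.length < N) (hSne : S ≠ [])
    (hPnd : P.Nodup) : Runs N (.cost i j) ρ (.real (rcost S.toFinset P.toFinset)) := by
  have h := Runs.sum (f := fun p => Metric.infDist p (S.toFinset : Set X)) hP hPN
    (p := .op .dist (.var 0) (.minBy (.var (i + 1)) (.op .dist (.var 1) (.var 0)))) (by
    intro p hp
    have h := Runs.minBy (f := fun s => Dist.dist p s) (d := S.head hSne)
      (key := .op .dist (.var 1) (.var 0)) (hS.up (a := .point p)) hSN (by
        obtain ⟨s, S', rfl⟩ := List.exists_cons_of_ne_nil hSne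
        exact hS.up.hd) (fun _ => List.head_mem hSne) (fun s _ => Runs.top.up.dist Runs.top)
    refine Runs.of_eq (Runs.top.dist h) (congrArg _ ?_)
    have hmem : leastBy (fun s => Dist.dist p s) S (S.head hSne) ∈ S := leastBy_mem (List.head_mem hSne)
    refine le_antisymm ?_ (infDist_le (List.mem_toFinset.2 hmem) p)
    rw [infDist_eq_dist_nn ((List.toFinset_nonempty_iff S).2 hSne)]
    exact leastBy_le (List.mem_toFinset.1 (nn_mem ((List.toFinset_nonempty_iff S).2 hSne) p)))
  refine Runs.of_eq h (congrArg _ ?_)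
  rw [rcost, List.sum_toFinset _ hPnd]

theorem length_rfilter {f : X → Prop} [DecidablePred f] {l : List X} (hl : l.Nodup) :
    (rfilter f l).length = (l.toFinset.filter f).card := by
  rw [← List.toFinset_card_of_nodup (nodup_rfilter hl)]
  congr 1
  ext
  simp

theorem Runs.beats {P : List X} {i j l : ℕ} {w x : X} (hP : Runs N (.var l) ρ (.pts P))
    (hw : Runs N (.var i) ρ (.point w)) (hx : Runs N (.var j) ρ (.point x)) (hPN : P.length < N)
    (hPnd : P.Nodup) : Runs N (.beats l i j) ρ (.bool (Beats P.toFinset w x)) := by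
  have h1 := Runs.filter (f := fun p => 2 ^ 9 * Dist.dist p w ≤ Dist.dist w x) hP hPN
    (p := .op .le (.scale 9 (.op .dist (.var 0) (.var (i + 1))))
      (.op .dist (.var (i + 1)) (.var (j + 1))))
    (fun p _ => ((Runs.top.dist hw.up).scale 9).le (hw.up.dist hx.up))
  have h2 := Runs.filter (f := fun p => Dist.dist p x ≤ 2 ^ 4 * Dist.dist w x) hP hPN
    (p := .op .le (.op .dist (.var 0) (.var (j + 1)))
      (.scale 4 (.op .dist (.var (i + 1)) (.var (j + 1)))))
    (fun p _ => (Runs.top.dist hx.up).le ((hw.up.dist hx.up).scale 4))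
  refine Runs.congr ((((h1.length ((length_rfilter_le _ _).trans_lt hPN)).scale 1).le
    (h2.length ((length_rfilter_le _ _).trans_lt hPN))).not) ?_
  classical
  rw [length_rfilter hPnd, length_rfilter hPnd, not_le, Beats, Majority, cnt, cnt]
  have e : P.toFinset.filter (fun p => 2 ^ 9 * Dist.dist p w ≤ Dist.dist w x) =
      P.toFinset.filter fun p => Dist.dist p w ≤ 1 / 512 * Dist.dist w x := by
    refine Finset.filter_congr fun p _ => ?_
    constructor <;> intro h <;> linarith
  have e' : P.toFinset.filter (fun p => Dist.dist p x ≤ 2 ^ 4 * Dist.dist w x) =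
      P.toFinset.filter fun p => Dist.dist p x ≤ 16 * Dist.dist w x := by norm_num
  rw [e, e']
  norm_cast

theorem Runs.violated {P O : List X} {i j l : ℕ} {u : X} (hP : Runs N (.var i) ρ (.pts P))
    (hO : Runs N (.var j) ρ (.pts O)) (hu : Runs N (.var l) ρ (.point u)) (hPN : P.length < N)
    (hON : O.length < N) (hPnd : P.Nodup) :
    Runs N (.violated i j l) ρ (.bool (Violated P.toFinset O u)) := by
  refine (Runs.any hP hPN fun v _ => (Runs.top.eqPt hu.up).not.and fun _ =>
    (Runs.all hO.up hON fun o _ => ((hu.up.up.dist Runs.top.up).scale 12).le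
      (hu.up.up.dist Runs.top)).and fun _ => Runs.beats hP.up Runs.top hu.up hPN hPnd).congr ?_
  norm_num [Violated]

theorem Runs.replaces {P O : List X} {i j l m : ℕ} {u x : X} (hP : Runs N (.var i) ρ (.pts P))
    (hO : Runs N (.var j) ρ (.pts O)) (hu : Runs N (.var l) ρ (.point u))
    (hx : Runs N (.var m) ρ (.point x)) (hPN : P.length < N) (hON : O.length < N) (hPnd : P.Nodup) :
    Runs N (.replaces i j l m) ρ (.bool (Replaces P.toFinset O u x)) := by
  refine ((Runs.all hO hON fun o _ => ((hu.up.dist hx.up).scale 8).le (hu.up.dist Runs.top)).and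
    fun _ => ((hx.eqPt hu).or fun _ => (Runs.beats hP hu hx hPN hPnd).not).and fun _ =>
    Runs.all hP hPN fun w _ => (Runs.top.eqPt hx.up).or fun _ =>
      (Runs.all hO.up hON fun o _ => ((hx.up.up.dist Runs.top.up).scale 10).le
        (hu.up.up.dist Runs.top)).not.or fun _ =>
        (Runs.beats hP.up Runs.top hx.up hPN hPnd).not).congr ?_
  simp only [Replaces, List.mem_toFinset, ne_eq, imp_iff_not_or (b := _ → _), imp_iff_not_or,
    not_not]
  norm_num

theorem Runs.fixCenter {P O : List X} {i j l : ℕ} {u : X} {Δ : ℝ}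
    (hX : ∀ x y : X, x ≠ y → 1 ≤ Dist.dist x y ∧ Dist.dist x y ≤ Δ) (hΔ : 0 ≤ Δ)
    (hP : Runs N (.var i) ρ (.pts P)) (hO : Runs N (.var j) ρ (.pts O))
    (hu : Runs N (.var l) ρ (.point u)) (hPN : P.length < N) (hON : O.length < N) (hPnd : P.Nodup)
    (huP : u ∈ P) : Runs N (.fixCenter i j l) ρ (.point (fixCenter P O u)) := by
  refine (Runs.violated hP hO hu hPN hON hPnd).ite (fun h => ?_) fun h => ?_
  · have h1 := Runs.filter (f := DynKMedian.Replaces P.toFinset O u) hP hPN fun x _ =>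
      Runs.replaces hP.up hO.up hu.up Runs.top hPN hON hPnd
    obtain ⟨x, hx, hr⟩ := exists_replaces hX hΔ O (List.mem_toFinset.2 huP)
    have hmem : x ∈ rfilter (DynKMedian.Replaces P.toFinset O u) P :=
      mem_rfilter.2 ⟨by simpa using hx, hr⟩
    rw [DynKMedian.fixCenter, if_pos h]
    cases hf : rfilter (DynKMedian.Replaces P.toFinset O u) P with
    | nil => simp [hf] at hmem
    | cons y l =>
      rw [hf] at h1
      exact h1.hd
  · rw [DynKMedian.fixCenter, if_neg h]
    exact hu

theorem Runs.robustify {P W : List X} {i j : ℕ} {Δ : ℝ}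
    (hX : ∀ x y : X, x ≠ y → 1 ≤ Dist.dist x y ∧ Dist.dist x y ≤ Δ) (hΔ : 0 ≤ Δ)
    (hP : Runs N (.var i) ρ (.pts P)) (hW : Runs N (.var j) ρ (.pts W)) (hPN : P.length < N)
    (hWN : W.length < N) (hPnd : P.Nodup) (hWP : W ⊆ P) :
    Runs N (.robustify i j) ρ (.pts (robustify P W)) := by
  have h := Runs.fold_inv (N := N) (enc := Val.point) (l := W)
    (encB := fun s : List X × List X => .cons (.pts s.1) (.pts s.2)) (g := robustifyStep P)
    (fun l s => s.2 = l ∧ l ⊆ P ∧ s.1.length + l.length = W.length) (b := ([], W))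
    ⟨rfl, hWP, by simp⟩ hW hWN (Runs.nil.pair hW)
    (step := .letIn (.revAppend (.hd (.var 1)) (.tl (.tl (.var 1))))
      (.pair (.pair (.fixCenter (i + 3) 0 1) (.hd (.var 2))) (.tl (.tl (.var 2))))) (by
    rintro u l ⟨done, rest⟩ ⟨rfl, hsub, hlen⟩
    rw [List.length_cons] at hlen
    dsimp only at hlen
    refine ⟨⟨rfl, fun _ h => hsub (List.mem_cons_of_mem _ h), ?_⟩, ?_⟩
    · simp only [robustifyStep, List.length_cons]
      omega
    · refine Runs.letIn (a := .pts (done.reverse ++ l)) (Runs.revAppend Runs.top.up.hd (by omega)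
        Runs.top.up.tl.tl) ?_
      exact ((Runs.fixCenter hX hΔ hP.up.up.up Runs.top Runs.top.up hPN (by simp; omega) hPnd
        (hsub List.mem_cons_self)).pair Runs.top.up.up.hd).pair Runs.top.up.up.tl.tl)
  exact h.hd

theorem Runs.competitive {P S : List X} {f : List X → Prop} {i j l m : ℕ} {cond : Prog}
    (hC : Runs N (.var i) ρ (encList .pts (sublistsOf P))) (hP : Runs N (.var j) ρ (.pts P))
    (hS : Runs N (.var l) ρ (.pts S)) (hPN : 2 ^ P.length < N) (hSN : S.length < N)
    (hPnd : P.Nodup) (hSne : P ≠ [] → S ≠ [])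
    (hcond : ∀ T ∈ sublistsOf P, Runs N cond (.cons (.pts T) ρ) (.bool (f T))) :
    Runs N (.competitive m i j l cond) ρ (.bool (Competitive m P S f)) := by
  have hPN' : P.length < N := Nat.lt_two_pow_self.trans hPN
  refine (Runs.all (f := fun T => T ≠ [] → f T → _ ≤ (_ : ℝ)) hC
    (by rwa [length_sublistsOf]) fun T hT => Runs.ite_list (Runs.top (a := .pts T)) (fun hne => ?_)
      fun he => Runs.tt.bool_of_true (by simp [he])).congr Iff.rfl
  have hsub := mem_sublistsOf.1 hT
  have hTlen : T.length < N := hsub.length_le.trans_lt (by simpa using hPN')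
  have hPne : P ≠ [] := by
    rintro rfl
    exact hne (by simpa using hsub)
  refine ((hcond T hT).not.or fun _ => (Runs.cost hS.up hP.up hSN hPN' (hSne hPne) hPnd).le
    ((Runs.cost Runs.top hP.up hTlen hPN' hne hPnd).scale m)).congr ?_
  tauto

theorem Runs.hd_lists {l : List (List X)} (h : Runs N p ρ (encList .pts l)) :
    Runs N p.hd ρ (.pts (l.headD [])) := by
  cases l with
  | nil => exact h.seq (Runs.prim .hd _)
  | cons a l => exact h.hd

theorem Runs.nextCenters {P U : List X} {k : ℕ} {i j l m : ℕ} (hk : 1 ≤ k)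
    (hkv : Runs N (.var i) ρ (.real k))
    (hC : Runs N (.var j) ρ (encList .pts (sublistsOf P))) (hP : Runs N (.var l) ρ (.pts P))
    (hU : Runs N (.var m) ρ (.pts U)) (hPN : 2 ^ P.length < N) (hUN : U.length < N)
    (hPnd : P.Nodup) : Runs N (.nextCenters i j l m) ρ (.pts (nextCenters k P U)) := by
  have hPN' : P.length < N := Nat.lt_two_pow_self.trans hPN
  have hlen : ∀ W ∈ sublistsOf P, W.length < N := fun W hW =>
    (mem_sublistsOf.1 hW).length_le.trans_lt (by simpa using hPN')
  have h1 : Runs N (.filter (.var j) (.and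
      (.and (.op .le (.length (.var 0)) (.var (i + 1)))
        (.or (.eqReal (.length (.var 0)) (.var (i + 1)))
          (.eqReal (.length (.var 0)) (.length (.var (l + 1))))))
      (.competitive 13 (j + 1) (l + 1) 0 (.op .le (.length (.var 0)) (.var (i + 2))))))
      ρ (encList .pts (nextCandidates k P)) :=
    Runs.filter hC (by rwa [length_sublistsOf]) fun W hW => Runs.and
      (((((Runs.top (a := .pts W)).length (hlen W hW)).le hkv.up).and fun _ =>
        (((Runs.top (a := .pts W)).length (hlen W hW)).eqReal hkv.up).or fun _ =>
          ((Runs.top (a := .pts W)).length (hlen W hW)).eqReal (hP.up.length hPN')).congr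
            (by norm_cast))
      fun hW' => Runs.competitive hC.up hP.up Runs.top hPN (hlen W hW) hPnd
        (fun hne => by
          rintro rfl
          rcases hW'.2 with h | h
          · simp at h
            omega
          · simp at h
            exact hne (List.length_eq_zero_iff.1 h.symm))
        fun T hT => (((Runs.top (a := .pts T)).length (hlen T hT)).le hkv.up.up).congr Nat.cast_le
  refine Runs.minBy (enc := Val.pts) h1 ?_ h1.hd_lists ?_ ?_
  · exact (length_rfilter_le _ _).trans_lt (by rwa [length_sublistsOf])
  · intro hne
    cases h : DynKMedian.nextCandidates k P with
    | nil => exact absurd h hne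
    | cons a l => simp
  · intro W hW
    have hWlen := hlen W (mem_rfilter.1 hW).1
    refine (Runs.filter (f := (· ∉ U)) Runs.top hWlen fun w _ => ?_).length
      ((length_rfilter_le _ _).trans_lt hWlen)
    exact (Runs.any (f := fun o => w = o) hU.up.up hUN
      fun o _ => Runs.top.up.eqPt Runs.top).not.congr (by simp)

theorem Runs.startCenters {P W : List X} {k : ℕ} {i j l m : ℕ}
    (hkv : Runs N (.var i) ρ (.real k))
    (hC : Runs N (.var j) ρ (encList .pts (sublistsOf P))) (hP : Runs N (.var l) ρ (.pts P))
    (hW : Runs N (.var m) ρ (.pts W)) (hPN : 2 ^ P.length < N) (hWN : 2 ^ W.length < N)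
    (hPnd : P.Nodup) : Runs N (.startCenters i j l m) ρ (.pts (startCenters k P W)) := by
  have hPN' : P.length < N := Nat.lt_two_pow_self.trans hPN
  have hWN' : W.length < N := Nat.lt_two_pow_self.trans hWN
  have hlen : ∀ T ∈ sublistsOf P, T.length < N := fun T hT =>
    (mem_sublistsOf.1 hT).length_le.trans_lt (by simpa using hPN')
  have hlen' : ∀ S ∈ sublistsOf W, S.length < N := fun S hS =>
    (mem_sublistsOf.1 hS).length_le.trans_lt (by simpa using hWN')
  have h1 : Runs N (.filter (.subs (.var m)) (.ite (.var 0)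
      (.competitive 43 (j + 1) (l + 1) 0
        (.op .le (.op .add (.length (.var 1)) (.length (.var 0))) (.scale 1 (.var (i + 2)))))
      (.prim .nil))) ρ (encList .pts (startCandidates k P W)) :=
    Runs.filter (Runs.subs hW hWN) (by rwa [length_sublistsOf]) fun S hS =>
      Runs.ite_list (Runs.top (a := .pts S))
        (fun hne => (Runs.competitive hC.up hP.up Runs.top hPN (hlen' S hS) hPnd (fun _ => hne)
          fun T hT => ((((Runs.top (a := .pts S)).up.length (hlen' S hS)).add
            ((Runs.top (a := .pts T)).length (hlen T hT))).le (hkv.up.up.scale 1)).congr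
              (by norm_cast)).congr (by simp [hne]))
        fun he => Runs.nil.bool_of_false (by simp [he])
  refine Runs.minBy (enc := Val.pts) h1 ?_ h1.hd_lists ?_ ?_
  · exact (length_rfilter_le _ _).trans_lt (by rwa [length_sublistsOf])
  · intro hne
    cases h : DynKMedian.startCandidates k P W with
    | nil => exact absurd h hne
    | cons a l => simp
  · intro S hS
    exact Runs.top.length (hlen' S (mem_rfilter.1 hS).1)

/-- The encoding of a centre and its representative. -/
def Val.ptPair (q : X × X) : Val X := .cons (.point q.1) (.point q.2)

/-- The encoding of a state. -/
def State.val (s : State X) : Val X :=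
  .cons (.pts (s.reps.map Prod.snd).reverse) (.cons (.pts s.pts) (.cons (.pts s.base)
    (.cons (encList .ptPair s.reps) (.cons (.real s.rem) (.cons (.real s.k) .nil)))))

def Update.isInsert {X : Type u} : Update X → Prop
  | .insert _ => True
  | .delete _ => False

theorem Update.encode_eq (u : Update X) : u.encode = .cons (.bool u.isInsert) (.point u.point) := by
  cases u <;> simp [Update.encode, Update.isInsert, Update.point, Val.bool]

theorem Runs.applyList {P : List X} {i : ℕ} (u : Update X)
    (hP : Runs N (.var i) (.cons (.point u.point) (.cons (.bool u.isInsert) ρ)) (.pts P))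
    (hPN : P.length < N) :
    Runs N (.applyList i) (.cons (.point u.point) (.cons (.bool u.isInsert) ρ))
      (.pts (u.applyList P)) := by
  refine Runs.top.up.ite (fun h => ?_) fun h => ?_
  · cases u with
    | insert x => exact Runs.top.pair hP
    | delete x => exact h.elim
  · cases u with
    | insert x => exact (h trivial).elim
    | delete x => exact Runs.filter hP hPN fun y _ => (Runs.top.eqPt Runs.top.up).not

theorem Runs.nearest {P : List X} {i j : ℕ} {s : X} (hP : Runs N (.var i) ρ (.pts P))
    (hPN : P.length < N) (hPne : P ≠ [])
    (hs : ∀ p, Runs N (.hd (.var j)) (.cons (.point p) ρ) (.point s)) :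
    Runs N (.minBy (.var i) (.op .dist (.hd (.var j)) (.var 0))) ρ (.point (nearest P s)) := by
  refine Runs.minBy hP hPN ?_ ?_ fun p _ => (hs p).dist Runs.top
  · cases P with
    | nil => exact absurd rfl hPne
    | cons a l => exact hP.hd
  · cases P with
    | nil => exact absurd rfl hPne
    | cons a l => simp

theorem Runs.applyReps {P : List X} {R : List (X × X)} {i : ℕ} (u : Update X)
    (hR : Runs N (.var i) (.cons (.pts P) (.cons (.point u.point) (.cons (.bool u.isInsert) ρ)))
      (encList .ptPair R)) (hPN : P.length < N) (hRN : R.length < N) :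
    Runs N (.applyReps i) (.cons (.pts P) (.cons (.point u.point) (.cons (.bool u.isInsert) ρ)))
      (encList .ptPair (u.applyReps P R)) := by
  classical
  refine Runs.top.up.up.ite (fun h => ?_) fun h => ?_
  · cases u with
    | insert x => exact (Runs.top.up.pair Runs.top.up).pair hR
    | delete x => exact h.elim
  · cases u with
    | insert x => exact (h trivial).elim
    | delete x =>
      refine Runs.ite_list (Runs.top (a := .pts P)) (fun hne => ?_) fun he => ?_
      · rw [Update.applyReps, if_neg hne]
        refine Runs.map hR hRN fun q _ => ?_
        refine ((Runs.top (a := .ptPair q)).tl.eqPt Runs.top.up.up).ite (fun h => ?_) fun h => ?_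
        · rw [if_pos (show q.2 = x from h)]
          exact (Runs.top (a := .ptPair q)).hd.pair
            (Runs.nearest Runs.top.up hPN hne fun p => (Runs.top (a := .ptPair q)).up.hd)
        · rw [if_neg (show ¬q.2 = x from h)]
          exact Runs.top
      · rw [Update.applyReps, if_pos he]
        exact Runs.nil

theorem Runs.state {s : State X} {P W R rem k : ℕ} (hP : Runs N (.var P) ρ (.pts s.pts))
    (hW : Runs N (.var W) ρ (.pts s.base)) (hR : Runs N (.var R) ρ (encList .ptPair s.reps))
    (hrem : Runs N (.var rem) ρ (.real s.rem)) (hk : Runs N (.var k) ρ (.real s.k))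
    (hRN : s.reps.length < N) : Runs N (.state P W R rem k) ρ s.val :=
  (Runs.map hR hRN fun _ _ => Runs.top.tl).pair
    (hP.pair (hW.pair (hR.pair (hrem.pair (hk.pair Runs.nil)))))

theorem Runs.init (k : ℕ) : Runs N .init (.real k : Val X) (State.val ⟨[], [], [], k, k⟩) :=
  Runs.nil.pair (Runs.nil.pair (Runs.nil.pair (Runs.nil.pair
    (Runs.id.pair (Runs.id.pair Runs.nil)))))

theorem leastBy_headD_mem {f : List X → ℝ} {l : List (List X)} (hl : l ≠ []) :
    leastBy f l (l.headD []) ∈ l := by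
  cases l with
  | nil => exact absurd rfl hl
  | cons a l => exact leastBy_mem (by simp)

theorem leastBy_headD_nil_or_mem {f : List X → ℝ} {l : List (List X)} :
    leastBy f l (l.headD []) = [] ∨ leastBy f l (l.headD []) ∈ l := by
  by_cases hl : l = []
  · exact .inl (by simp [hl, leastBy])
  · exact .inr (leastBy_headD_mem hl)

theorem nextCenters_sublist (k : ℕ) (P U : List X) : (nextCenters k P U).Sublist P.reverse := by
  rcases leastBy_headD_nil_or_mem (f := fun W => ((rfilter (· ∉ U) W).length : ℝ))
    (l := nextCandidates k P) with h | h
  · rw [nextCenters, h]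
    exact List.nil_sublist _
  · exact mem_sublistsOf.1 (mem_rfilter.1 h).1

theorem startCenters_sublist (k : ℕ) (P W : List X) : (startCenters k P W).Sublist W.reverse := by
  rcases leastBy_headD_nil_or_mem (f := fun S => (S.length : ℝ))
    (l := startCandidates k P W) with h | h
  · rw [startCenters, h]
    exact List.nil_sublist _
  · exact mem_sublistsOf.1 (mem_rfilter.1 h).1

theorem length_robustify (P W : List X) : (robustify P W).length = W.length := by
  suffices ∀ (l : List X) (s : List X × List X),
      (l.foldl (robustifyStep P) s).1.length = l.length + s.1.length by
    simpa [DynKMedian.robustify] using this W ([], W)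
  intro l
  induction l with
  | nil => simp
  | cons a l ih =>
    intro s
    rw [List.foldl_cons, ih]
    simp [robustifyStep]
    omega

/-- `hrem` makes the truncated subtraction in `newEpoch` agree with the real subtraction of the
program. -/
theorem Runs.step {s : State X} {Δ : ℝ} (u : Update X)
    (hX : ∀ x y : X, x ≠ y → 1 ≤ Dist.dist x y ∧ Dist.dist x y ≤ Δ) (hΔ : 0 ≤ Δ) (hk : 1 ≤ s.k)
    (hnd : (u.applyList s.pts).Nodup) (hPN : s.pts.length < N)
    (hPN' : 2 ^ (u.applyList s.pts).length < N) (hWN : s.base.length < N)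
    (hRN : s.reps.length + 1 < N) (hrem : (newEpoch s.k (u.applyList s.pts) s.base).reps.length ≤ s.k) :
    Runs N .step (.cons s.val u.encode) (s.next u).val := by
  rw [u.encode_eq]
  refine ((Runs.prim .tl _).tl.pair ((Runs.prim .tl _).hd.pair (Runs.prim .hd _))).seq ?_
  refine (Runs.applyList u Runs.top.up.up.up hPN).letIn ?_
  set P := u.applyList s.pts with hP
  have hPlt : P.length < N := Nat.lt_two_pow_self.trans hPN'
  refine Runs.ite (P := 1 ≤ s.rem)
    ((Runs.one.le (Runs.top (a := .real s.rem)).up.up.up.up.up.up.up).congr (by norm_cast))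
    (fun h => ?_) fun h => ?_
  · rw [State.next, if_pos h]
    refine (Runs.applyReps (R := s.reps) u Runs.top.up.up.up.up.up.up hPlt (by omega)).letIn ?_
    refine ((Runs.top (a := .real s.rem)).up.up.up.up.up.up.up.up.sub Runs.one).letIn ?_
    refine Runs.state Runs.top.up.up Runs.top.up.up.up.up.up.up.up Runs.top.up ?_
      Runs.top.up.up.up.up.up.up.up.up.up.up ?_
    · rw [Nat.cast_sub h, Nat.cast_one]
      exact Runs.top
    · dsimp only
      cases u with
      | insert x => simpa [Update.applyReps] using hRN
      | delete x =>
        rw [Update.applyReps]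
        split_ifs
        · simp
          omega
        · simp
          omega
  · rw [State.next, if_neg h]
    have hW₁ := nextCenters_sublist s.k P s.base
    have hW₁len : (DynKMedian.nextCenters s.k P s.base).length ≤ P.length := by
      simpa using hW₁.length_le
    have hS := (startCenters_sublist s.k P
      (DynKMedian.robustify P (DynKMedian.nextCenters s.k P s.base))).length_le
    rw [List.length_reverse, length_robustify] at hS
    refine (Runs.subs Runs.top hPN').letIn ?_
    refine (Runs.nextCenters hk Runs.top.up.up.up.up.up.up.up.up.up Runs.top Runs.top.up
      Runs.top.up.up.up.up.up.up hPN' hWN hnd).letIn ?_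
    refine (Runs.robustify hX hΔ Runs.top.up.up Runs.top hPlt (by omega) hnd
      fun x hx => by simpa using hW₁.subset hx).letIn ?_
    refine (Runs.startCenters Runs.top.up.up.up.up.up.up.up.up.up.up.up Runs.top.up.up
      Runs.top.up.up.up Runs.top hPN' ?_ hnd).letIn ?_
    · rw [length_robustify]
      exact (Nat.pow_le_pow_right (by norm_num) hW₁len).trans_lt hPN'
    refine (Runs.map (f := fun s => (s, s)) (encB := .ptPair) Runs.top (by omega)
      fun x _ => Runs.top.pair Runs.top).letIn ?_
    refine ((Runs.top (a := .real s.k)).up.up.up.up.up.up.up.up.up.up.up.up.up.sub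
      (Runs.top.up.length (by omega))).letIn ?_
    refine Runs.state Runs.top.up.up.up.up.up.up Runs.top.up.up.up Runs.top.up ?_
      Runs.top.up.up.up.up.up.up.up.up.up.up.up.up.up.up ?_
    · rw [DynKMedian.newEpoch, List.length_reverse, List.length_map] at hrem
      rw [DynKMedian.newEpoch, Nat.cast_sub hrem]
      exact Runs.top
    · simp only [DynKMedian.newEpoch, List.length_reverse, List.length_map, ← hP]
      omega

end program

end DynKMedian

/-! ### The invariant over epochs, and its consequences for cost, recourse and time. -/

namespace DynKMedian

variable {X : Type u} [MetricSpace X] [DecidableEq X]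

/-! ## Properties of the chosen solutions -/

theorem exists_mem_sublistsOf {l : List X} (hl : l.Nodup) {S : Finset X} (hS : S ⊆ l.toFinset) :
    ∃ s ∈ sublistsOf l, s.toFinset = S ∧ s.length = S.card := by
  have hset : (l.reverse.filter (· ∈ S)).toFinset = S := by
    ext x
    have := @hS x
    simp only [List.mem_toFinset] at this
    simp only [List.mem_toFinset, List.mem_filter, List.mem_reverse, decide_eq_true_eq]
    tauto
  refine ⟨l.reverse.filter (· ∈ S), mem_sublistsOf.2 List.filter_sublist, hset, ?_⟩
  rw [← List.toFinset_card_of_nodup ((List.nodup_reverse.2 hl).filter _), hset]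

theorem nodup_of_mem_sublistsOf {l s : List X} (hl : l.Nodup) (hs : s ∈ sublistsOf l) : s.Nodup :=
  (mem_sublistsOf.1 hs).nodup (List.nodup_reverse.2 hl)

theorem subset_of_mem_sublistsOf {l s : List X} (hs : s ∈ sublistsOf l) :
    s.toFinset ⊆ l.toFinset := fun x hx => by
  simpa using (mem_sublistsOf.1 hs).subset (List.mem_toFinset.1 hx)

theorem competitive_iff {j : ℕ} {P S : List X} (hP : P.Nodup) {f : ℕ → Prop} :
    Competitive j P S (fun T => f T.length) ↔ ∀ T ⊆ P.toFinset, T.Nonempty → f T.card →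
      rcost S.toFinset P.toFinset ≤ 2 ^ j * rcost T P.toFinset := by
  constructor
  · intro h T hT hne hf
    obtain ⟨t, ht, rfl, hlen⟩ := exists_mem_sublistsOf hP hT
    exact h t ht ((List.toFinset_nonempty_iff t).1 hne) (by simpa only [hlen] using hf)
  · intro h t ht hne hf
    refine h t.toFinset (subset_of_mem_sublistsOf ht) ((List.toFinset_nonempty_iff t).2 hne) ?_
    rwa [List.toFinset_card_of_nodup (nodup_of_mem_sublistsOf hP ht)]

/-- `W` is a witness from `exists_next`: it shows that candidates exist, and the chosen one leaves
`U` no more often than `W` does. -/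
theorem nextCenters_spec {k : ℕ} {P U : List X} (hP : P.Nodup) {W : Finset X} (hW : W ⊆ P.toFinset)
    (hcard : W.card = min k P.length)
    (hcost : ∀ S ⊆ P.toFinset, S.Nonempty → S.card ≤ k →
      rcost W P.toFinset ≤ 2 ^ 13 * rcost S P.toFinset) :
    nextCenters k P U ⊆ P ∧ (nextCenters k P U).Nodup ∧
      (nextCenters k P U).length = min k P.length ∧
      (∀ S ⊆ P.toFinset, S.Nonempty → S.card ≤ k →
        rcost (nextCenters k P U).toFinset P.toFinset ≤ 2 ^ 13 * rcost S P.toFinset) ∧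
      ((nextCenters k P U).toFinset \ U.toFinset).card ≤ (W \ U.toFinset).card := by
  have hkey : ∀ w : List X, w.Nodup →
      (rfilter (· ∉ U) w).length = (w.toFinset \ U.toFinset).card := by
    intro w hw
    rw [length_rfilter hw]
    congr 1
    ext
    simp
  obtain ⟨w, hw, rfl, hlen⟩ := exists_mem_sublistsOf hP hW
  have hwnd := nodup_of_mem_sublistsOf hP hw
  have hcand : w ∈ nextCandidates k P := by
    refine mem_rfilter.2 ⟨hw, ⟨by omega, by omega⟩, ?_⟩
    rwa [competitive_iff (f := fun n => n ≤ k) hP]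
  have hmem : nextCenters k P U ∈ nextCandidates k P :=
    leastBy_headD_mem (List.ne_nil_of_mem hcand)
  have hle : (rfilter (· ∉ U) (nextCenters k P U)).length ≤ (rfilter (· ∉ U) w).length := by
    exact_mod_cast leastBy_le (f := fun W => ((rfilter (· ∉ U) W).length : ℝ)) hcand
  obtain ⟨hsub, ⟨h1, h2⟩, h3⟩ := mem_rfilter.1 hmem
  have hnd := nodup_of_mem_sublistsOf hP hsub
  have hlen' := (mem_sublistsOf.1 hsub).length_le
  rw [List.length_reverse] at hlen'
  rw [competitive_iff (f := fun n => n ≤ k) hP] at h3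
  rw [hkey _ hnd, hkey _ hwnd] at hle
  refine ⟨fun x hx => ?_, hnd, by omega, h3, hle⟩
  simpa using subset_of_mem_sublistsOf hsub (List.mem_toFinset.2 hx)

/-- `W` itself is a candidate. If k ≤ |P| it has `k` centres and competes only with solutions of at
most `k`; otherwise it is all of `P` and costs nothing. -/
theorem startCenters_spec {k : ℕ} {P W : List X} (hP : P.Nodup) (hW : W.Nodup) (hWP : W ⊆ P)
    (hlen : W.length = min k P.length) (hk : 1 ≤ k)
    (hcost : ∀ S ⊆ P.toFinset, S.Nonempty → S.card ≤ k →
      rcost W.toFinset P.toFinset ≤ 2 ^ 24 * rcost S P.toFinset) :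
    (startCenters k P W).Nodup ∧ startCenters k P W ⊆ W ∧ (P ≠ [] → startCenters k P W ≠ []) ∧
      (∀ T ⊆ P.toFinset, T.Nonempty → (startCenters k P W).length + T.card ≤ 2 * k →
        rcost (startCenters k P W).toFinset P.toFinset ≤ 2 ^ 43 * rcost T P.toFinset) ∧
      ∀ S ⊆ W.toFinset, S.Nonempty → S.card < (startCenters k P W).length →
        ∃ T ⊆ P.toFinset, T.Nonempty ∧ S.card + T.card ≤ 2 * k ∧
          2 ^ 43 * rcost T P.toFinset < rcost S P.toFinset := by
  by_cases hPe : P = []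
  · subst hPe
    have hWe : W = [] := by simpa using hWP
    have hS : startCenters k [] W = [] := by
      have := (startCenters_sublist k [] W).length_le
      simpa [hWe] using this
    rw [hS]
    refine ⟨by simp, by simp, by simp, fun T hT hne => ?_, by simp⟩
    rw [List.toFinset_nil, Finset.subset_empty] at hT
    simp [hT] at hne
  obtain ⟨w, hw, hwW, hwlen⟩ := exists_mem_sublistsOf hW (Finset.Subset.refl W.toFinset)
  rw [List.toFinset_card_of_nodup hW] at hwlen
  have hWcard := List.toFinset_card_of_nodup hW
  have hPpos : 1 ≤ P.length := List.length_pos_iff.2 hPe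
  have hcand : w ∈ startCandidates k P W := by
    refine mem_rfilter.2 ⟨hw, ?_, ?_⟩
    · rintro rfl
      simp at hwlen
      omega
    · rw [competitive_iff (f := fun n => w.length + n ≤ 2 * k) hP, hwW]
      intro T hT hne hTk
      have hT0 := rcost_nonneg T P.toFinset
      by_cases hkP : k ≤ P.length
      · have := hcost T hT hne (by omega)
        norm_num at this ⊢
        linarith
      · have hWP' : W.toFinset = P.toFinset := Finset.eq_of_subset_of_card_le
          (fun x hx => List.mem_toFinset.2 (hWP (List.mem_toFinset.1 hx))) (by
            rw [hWcard, List.toFinset_card_of_nodup hP]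
            omega)
        have : rcost W.toFinset P.toFinset = 0 := by
          rw [hWP']
          exact Finset.sum_eq_zero fun p hp => Metric.infDist_zero_of_mem (by simpa using hp)
        rw [this]
        positivity
  have hmem : startCenters k P W ∈ startCandidates k P W :=
    leastBy_headD_mem (List.ne_nil_of_mem hcand)
  obtain ⟨hsub, hne, hcomp⟩ := mem_rfilter.1 hmem
  rw [competitive_iff (f := fun n => (startCenters k P W).length + n ≤ 2 * k) hP] at hcomp
  refine ⟨nodup_of_mem_sublistsOf hW hsub, fun x hx => ?_, fun _ => hne, hcomp, ?_⟩
  · simpa using subset_of_mem_sublistsOf hsub (List.mem_toFinset.2 hx)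
  · intro S hS hSne hSc
    obtain ⟨s, hs, rfl, hslen⟩ := exists_mem_sublistsOf hW hS
    by_contra! hno
    have hscand : s ∈ startCandidates k P W := by
      refine mem_rfilter.2 ⟨hs, (List.toFinset_nonempty_iff s).1 hSne, ?_⟩
      rw [competitive_iff (f := fun n => s.length + n ≤ 2 * k) hP]
      intro T hT hne hTk
      exact hno T hT hne (by omega)
    have : (startCenters k P W).length ≤ s.length := by
      exact_mod_cast leastBy_le (f := fun S : List X => (S.length : ℝ)) hscand
    omega

theorem length_nextCenters_le (k : ℕ) (P U : List X) : (nextCenters k P U).length ≤ k := by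
  rcases leastBy_headD_nil_or_mem (f := fun W => ((rfilter (· ∉ U) W).length : ℝ))
    (l := nextCandidates k P) with h | h
  · rw [nextCenters, h]
    exact Nat.zero_le _
  · exact (mem_rfilter.1 h).2.1.1

theorem length_reps_newEpoch_le (k : ℕ) (P U : List X) : (newEpoch k P U).reps.length ≤ k := by
  have h := (startCenters_sublist k P (robustify P (nextCenters k P U))).length_le
  rw [List.length_reverse, length_robustify] at h
  simpa [newEpoch] using h.trans (length_nextCenters_le k P U)

/-! ## The invariant -/

/-- The displayed solution. -/
def State.display (s : State X) : Finset X := (s.reps.map Prod.snd).toFinset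

/-- The state of the algorithm after `i` updates; `P` is the input, `R` is the recourse so far. The
current epoch began `j` updates ago, with the input `P₀` and the centres `S₀`. -/
structure Invariant (k G i : ℕ) (P : Finset X) (R : ℕ) (s : State X) (P₀ S₀ : Finset X) (j : ℕ)
    (g : X → ℕ) : Prop where
  k_eq : s.k = k
  nodup : s.pts.Nodup
  pts_eq : s.pts.toFinset = P
  base_nodup : s.base.Nodup
  base_sub : s.base.toFinset ⊆ P₀
  base_card : s.base.toFinset.card = min k P₀.card
  robust : Robust s.base.toFinset P₀
  base_cost : ∀ S ⊆ P₀, S.Nonempty → S.card ≤ k → rcost s.base.toFinset P₀ ≤ 2 ^ 24 * rcost S P₀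
  start_sub : S₀ ⊆ s.base.toFinset
  start_ne : P₀.Nonempty → S₀.Nonempty
  start_cost : ∀ T ⊆ P₀, T.Nonempty → S₀.card + T.card ≤ 2 * k → rcost S₀ P₀ ≤ 2 ^ 43 * rcost T P₀
  start_min : ∀ S ⊆ s.base.toFinset, S.Nonempty → S.card < S₀.card →
    ∃ T ⊆ P₀, T.Nonempty ∧ S.card + T.card ≤ 2 * k ∧ 2 ^ 43 * rcost T P₀ < rcost S P₀
  rem_eq : S₀.card + s.rem + j = k
  del : (P₀ \ P).card ≤ j
  ins : (P \ P₀).card ≤ j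
  reps_length : s.reps.length ≤ S₀.card + j
  reps_mem : ∀ q ∈ s.reps, q.2 ∈ P
  -- The second bound survives deletions because `p` itself remains eligible as representative.
  -- Together the bounds give d(p, q.2) ≤ 2 d(p, S₀).
  reps_cover : ∀ p ∈ P, (p, p) ∈ s.reps ∨ p ∈ P₀ ∧
    ∃ q ∈ s.reps, dist p q.1 ≤ Metric.infDist p (S₀ : Set X) ∧ dist q.1 q.2 ≤ dist q.1 p
  card_le : P.card ≤ i
  start_card_le : P₀.card + j ≤ i
  levels : Levels P s.base.toFinset G g
  -- The potential counts twice, as a replacement removes one centre and adds another. Finished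
  -- epochs are charged to their `i - j` updates. The first cost of the current one, dropping `base`
  -- to `S₀`, stays on the right until the epoch ends.
  budget : R + 2 * potential s.base.toFinset G g + S₀.card ≤ 2 ^ 48 * G ^ 2 * (i - j) +
    (s.base.toFinset \ S₀).card + 2 * j + s.display.card + 2 * G ^ 2 * j
  -- This bounds the way back from the display to `base`, where the next epoch begins its changes.
  debt : (symmDiff s.display s.base.toFinset).card + S₀.card ≤
    (s.base.toFinset \ S₀).card + 2 * j + s.display.card

theorem card_symmDiff_eq (A B : Finset X) :
    (symmDiff A B).card = (A \ B).card + (B \ A).card := by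
  rw [symmDiff_def, Finset.sup_eq_union, Finset.card_union_of_disjoint]
  exact Finset.disjoint_left.2 fun x hx hx' =>
    (Finset.mem_sdiff.1 hx').2 (Finset.mem_sdiff.1 hx).1

theorem card_symmDiff_triangle (A B C : Finset X) :
    (symmDiff A C).card ≤ (symmDiff A B).card + (symmDiff B C).card := by
  refine (Finset.card_le_card (t := symmDiff A B ∪ symmDiff B C) ?_).trans
    (Finset.card_union_le _ _)
  exact symmDiff_triangle A B C

theorem Update.toFinset_applyList {P : List X} (u : Update X) :
    (u.applyList P).toFinset = u.apply P.toFinset := by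
  cases u with
  | insert x => simp [Update.applyList, Update.apply]
  | delete x =>
    ext y
    simp [Update.applyList, Update.apply]
    tauto

theorem Update.nodup_applyList {P : List X} {u : Update X} (hP : P.Nodup)
    (h : u.Allowed P.toFinset) : (u.applyList P).Nodup := by
  cases u with
  | insert x => exact List.nodup_cons.2 ⟨by simpa [Update.Allowed] using h, hP⟩
  | delete x => exact nodup_rfilter hP

theorem Update.mem_apply_iff {P : Finset X} (u : Update X) {q : X} (hq : q ≠ u.point) :
    q ∈ u.apply P ↔ q ∈ P := by
  cases u with
  | insert x => simp [Update.apply, show q ≠ x from hq]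
  | delete x => simp [Update.apply, show q ≠ x from hq]

theorem Update.card_apply_le (P : Finset X) (u : Update X) : (u.apply P).card ≤ P.card + 1 := by
  cases u with
  | insert x => exact Finset.card_insert_le _ _
  | delete x => exact Finset.card_erase_le.trans (Nat.le_succ _)

theorem Update.card_sdiff_apply_le (P Q : Finset X) (u : Update X) :
    (Q \ u.apply P).card ≤ (Q \ P).card + 1 ∧ (u.apply P \ Q).card ≤ (P \ Q).card + 1 := by
  constructor
  · refine (Finset.card_le_card (t := Insert.insert u.point (Q \ P)) fun x hx => ?_).trans
      (Finset.card_insert_le _ _)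
    rw [Finset.mem_sdiff] at hx
    by_cases hxu : x = u.point
    · exact Finset.mem_insert.2 (.inl hxu)
    · rw [u.mem_apply_iff hxu] at hx
      exact Finset.mem_insert_of_mem (Finset.mem_sdiff.2 hx)
  · refine (Finset.card_le_card (t := Insert.insert u.point (P \ Q)) fun x hx => ?_).trans
      (Finset.card_insert_le _ _)
    rw [Finset.mem_sdiff] at hx
    by_cases hxu : x = u.point
    · exact Finset.mem_insert.2 (.inl hxu)
    · rw [u.mem_apply_iff hxu] at hx
      exact Finset.mem_insert_of_mem (Finset.mem_sdiff.2 hx)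

theorem nearest_spec {P : List X} (hP : P ≠ []) (s : X) :
    nearest P s ∈ P ∧ ∀ p ∈ P, dist s (nearest P s) ≤ dist s p := by
  refine ⟨leastBy_mem ?_, fun p hp => leastBy_le (f := fun p => dist s p) hp⟩
  cases P with
  | nil => exact absurd rfl hP
  | cons a l => simp

/-- The representatives after an update. -/
theorem Update.applyReps_spec {P : List X} {reps : List (X × X)} {D : X → ℝ} {P₀ : Finset X}
    {u : Update X} (hmem : ∀ q ∈ reps, q.2 ∈ P)
    (hcover : ∀ p ∈ P, (p, p) ∈ reps ∨ p ∈ P₀ ∧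
      ∃ q ∈ reps, dist p q.1 ≤ D p ∧ dist q.1 q.2 ≤ dist q.1 p) :
    (u.applyReps (u.applyList P) reps).length ≤ reps.length + 1 ∧
      (∀ q ∈ u.applyReps (u.applyList P) reps, q.2 ∈ u.applyList P) ∧
      (∀ p ∈ u.applyList P, (p, p) ∈ u.applyReps (u.applyList P) reps ∨ p ∈ P₀ ∧
        ∃ q ∈ u.applyReps (u.applyList P) reps, dist p q.1 ≤ D p ∧ dist q.1 q.2 ≤ dist q.1 p) ∧
      ∀ q ∈ reps, q.2 ≠ u.point → ∃ q' ∈ u.applyReps (u.applyList P) reps, q'.2 = q.2 := by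
  cases u with
  | insert x =>
    simp only [Update.applyReps, Update.applyList, List.mem_cons, List.length_cons]
    refine ⟨le_rfl, ?_, ?_, fun q hq _ => ⟨q, .inr hq, rfl⟩⟩
    · rintro q (rfl | hq)
      exacts [.inl rfl, .inr (hmem q hq)]
    · rintro p (rfl | hp)
      · exact .inl (.inl rfl)
      · rcases hcover p hp with h | ⟨h, q, hq, hd⟩
        exacts [.inl (.inr h), .inr ⟨h, q, .inr hq, hd⟩]
  | delete x =>
    have hP' : ∀ p, p ∈ Update.applyList P (.delete x) ↔ p ∈ P ∧ p ≠ x := fun p => mem_rfilter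
    set P' := Update.applyList P (.delete x) with hP'def
    by_cases hne : P' = []
    · rw [Update.applyReps, if_pos hne]
      refine ⟨by simp, by simp, by simp [hne], fun q hq hqx => ?_⟩
      have := (hP' q.2).2 ⟨hmem q hq, hqx⟩
      simp [hne] at this
    · rw [Update.applyReps, if_neg hne]
      set f : X × X → X × X := fun q => if q.2 = x then (q.1, nearest P' q.1) else q with hf
      have hmem' : ∀ q ∈ reps, f q ∈ (reps.map f).reverse := fun q hq => by
        simpa using ⟨q.1, q.2, hq, rfl⟩
      have hfx : ∀ q : X × X, q.2 ≠ x → f q = q := fun q hq => by simp [hf, hq]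
      refine ⟨by simp, ?_, fun p hp => ?_, fun q hq hqx => ⟨f q, hmem' q hq, by rw [hfx q hqx]⟩⟩
      · intro q hq
        rw [List.mem_reverse, List.mem_map] at hq
        obtain ⟨q, hq, rfl⟩ := hq
        by_cases hqx : q.2 = x
        · simpa [hf, hqx] using (nearest_spec hne q.1).1
        · rw [hfx q hqx]
          exact (hP' _).2 ⟨hmem q hq, hqx⟩
      · obtain ⟨hpP, hpx⟩ := (hP' p).1 hp
        rcases hcover p hpP with h | ⟨h, q, hq, hd, hd'⟩
        · refine .inl ?_
          have := hmem' _ h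
          rwa [hfx (p, p) hpx] at this
        · refine .inr ⟨h, f q, hmem' q hq, ?_⟩
          by_cases hqx : q.2 = x
          · simp only [hf, hqx, if_true]
            exact ⟨hd, (nearest_spec hne q.1).2 p hp⟩
          · rw [hfx q hqx]
            exact ⟨hd, hd'⟩

/-- A lazy update loses at most one centre, so its recourse is at most 2 plus the growth of the
display. The growth telescopes over the epoch. -/
theorem card_symmDiff_add_card_le {A B : Finset X} (h : (A \ B).card ≤ 1) :
    (symmDiff A B).card + A.card ≤ 2 + B.card := by
  have h1 := Finset.card_sdiff_add_card_inter A B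
  have h2 := Finset.card_sdiff_add_card_inter B A
  rw [Finset.inter_comm] at h2
  rw [card_symmDiff_eq]
  omega

theorem Invariant.continue {k G i R j : ℕ} {P P₀ S₀ : Finset X} {s : State X} {g : X → ℕ} {Δ : ℝ}
    {u : Update X} (hX : ∀ x y : X, x ≠ y → 1 ≤ dist x y ∧ dist x y ≤ Δ)
    (h : Invariant k G i P R s P₀ S₀ j g) (hu : u.Allowed P) (hrem : 1 ≤ s.rem) :
    ∃ g', Invariant k G (i + 1) (u.apply P)
      (R + (symmDiff s.display (s.next u).display).card) (s.next u) P₀ S₀ (j + 1) g' := by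
  obtain ⟨g', hg', hpot⟩ := h.levels.update hX (P' := u.apply P) (p := u.point)
    fun q hq => u.mem_apply_iff hq
  have hpts : ∀ p, p ∈ s.pts ↔ p ∈ P := fun p => by rw [← h.pts_eq, List.mem_toFinset]
  have hpts' : ∀ p, p ∈ u.applyList s.pts ↔ p ∈ u.apply P := fun p => by
    rw [← h.pts_eq, ← u.toFinset_applyList, List.mem_toFinset]
  have hnext : s.next u = ⟨u.applyList s.pts, s.base, u.applyReps (u.applyList s.pts) s.reps,
      s.rem - 1, s.k⟩ := by rw [State.next, if_pos hrem]
  obtain ⟨h1, h2, h3, h4⟩ := Update.applyReps_spec (P := s.pts) (reps := s.reps) (P₀ := P₀)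
    (D := fun p => Metric.infDist p (S₀ : Set X)) (u := u)
    (fun q hq => (hpts _).2 (h.reps_mem q hq)) (fun p hp => h.reps_cover p ((hpts p).1 hp))
  have hdisp : (s.display \ (s.next u).display).card ≤ 1 := by
    rw [← Finset.card_singleton u.point]
    refine Finset.card_le_card fun y hy => ?_
    rw [Finset.mem_sdiff, State.display, State.display, List.mem_toFinset, List.mem_map, hnext,
      List.mem_toFinset, List.mem_map] at hy
    obtain ⟨⟨q, hq, rfl⟩, hn⟩ := hy
    by_contra hne
    exact hn (h4 q hq (by simpa using hne))
  have hrec := card_symmDiff_add_card_le hdisp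
  have hsd := u.card_sdiff_apply_le P P₀
  have hdebt := card_symmDiff_triangle (s.next u).display s.display s.base.toFinset
  rw [symmDiff_comm (s.next u).display s.display] at hdebt
  have hi : i + 1 - (j + 1) = i - j := by omega
  have hbase : (s.next u).base = s.base := by rw [hnext]
  refine ⟨g', ?_⟩
  constructor
  case k_eq => rw [hnext]; exact h.k_eq
  case nodup => rw [hnext]; exact Update.nodup_applyList h.nodup (by rwa [h.pts_eq])
  case pts_eq => rw [hnext]; exact (u.toFinset_applyList).trans (by rw [h.pts_eq])
  case base_nodup => rw [hbase]; exact h.base_nodup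
  case base_sub => rw [hbase]; exact h.base_sub
  case base_card => rw [hbase]; exact h.base_card
  case robust => rw [hbase]; exact h.robust
  case base_cost => rw [hbase]; exact h.base_cost
  case start_sub => rw [hbase]; exact h.start_sub
  case start_ne => exact h.start_ne
  case start_cost => exact h.start_cost
  case start_min => rw [hbase]; exact h.start_min
  case rem_eq =>
    have := h.rem_eq
    rw [hnext]
    dsimp only
    omega
  case del => exact hsd.1.trans (Nat.add_le_add_right h.del 1)
  case ins => exact hsd.2.trans (Nat.add_le_add_right h.ins 1)
  case reps_length =>
    rw [hnext]
    exact h1.trans (Nat.add_le_add_right h.reps_length 1)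
  case reps_mem =>
    rw [hnext]
    exact fun q hq => (hpts' _).1 (h2 q hq)
  case reps_cover =>
    rw [hnext]
    exact fun p hp => h3 p ((hpts' p).2 hp)
  case card_le => exact (u.card_apply_le P).trans (Nat.add_le_add_right h.card_le 1)
  case start_card_le => have := h.start_card_le; omega
  case levels => rw [hbase]; exact hg'
  case budget =>
    have := h.budget
    rw [hbase, hi]
    nlinarith
  case debt =>
    have := h.debt
    rw [hbase]
    omega

/-- Here `rem = 0`, so |S₀| = k - j. A set of k - (j + 1) centres is smaller than `S₀`, and
`start_min` supplies the hypothesis of `exists_next` for L = j + 1. -/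
theorem Invariant.renew {k G i R j : ℕ} {P P₀ S₀ : Finset X} {s : State X} {g : X → ℕ} {Δ : ℝ}
    {u : Update X} (hX : ∀ x y : X, x ≠ y → 1 ≤ dist x y ∧ dist x y ≤ Δ) (hΔ0 : 0 ≤ Δ)
    (hΔ : Δ < 2 ^ G) (hG : 1 ≤ G) (hk : 1 ≤ k) (h : Invariant k G i P R s P₀ S₀ j g)
    (hu : u.Allowed P) (hrem : ¬1 ≤ s.rem) :
    ∃ S₁ g', Invariant k G (i + 1) (u.apply P)
      (R + (symmDiff s.display (s.next u).display).card) (s.next u) (u.apply P) S₁ 0 g' := by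
  set P' := u.applyList s.pts with hP'
  have hP'nd : P'.Nodup := Update.nodup_applyList h.nodup (by rwa [h.pts_eq])
  have hP'set : P'.toFinset = u.apply P := by rw [hP', u.toFinset_applyList, h.pts_eq]
  have hP'len : P'.length = (u.apply P).card := by
    rw [← hP'set, List.toFinset_card_of_nodup hP'nd]
  have hsd := u.card_sdiff_apply_le P P₀
  have hdel := h.del
  have hins := h.ins
  have hremeq := h.rem_eq
  have hS₀base := Finset.card_le_card h.start_sub
  -- the new solution before it is made robust
  obtain ⟨W, hWP, hWcard, hWcost, hWU⟩ := exists_next (P' := u.apply P) (L := j + 1) hk h.base_sub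
    h.base_card (by omega) h.robust h.base_cost
    (fun S hS hne hc => by
      obtain ⟨T, h1, h2, h3, h4⟩ := h.start_min S hS hne (by omega)
      exact ⟨T, h1, h2, by omega, h4⟩) (by omega) (by omega)
  obtain ⟨hW₁P, hW₁nd, hW₁len, hW₁cost, hW₁U⟩ := nextCenters_spec (k := k) (U := s.base) (W := W)
    hP'nd (by rw [hP'set]; exact hWP) (by rw [hP'len]; exact hWcard)
    (by rw [hP'set]; exact hWcost)
  set W₁ := nextCenters k P' s.base with hW₁
  obtain ⟨hW₂P, hW₂nd, hW₂len, hrob, hW₂cost⟩ := robustify_spec hX hΔ0 hW₁P hW₁nd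
  set W₂ := robustify P' W₁ with hW₂
  have hcost₂ : ∀ S ⊆ P'.toFinset, S.Nonempty → S.card ≤ k →
      rcost W₂.toFinset P'.toFinset ≤ 2 ^ 24 * rcost S P'.toFinset := by
    intro S hS hne hc
    have hne₁ : W₁ ≠ [] := by
      have := Finset.card_pos.2 (hne.mono hS)
      rw [List.toFinset_card_of_nodup hP'nd] at this
      rw [← List.length_pos_iff, hW₁len]
      omega
    have h1 := hW₂cost hne₁
    have h2 := hW₁cost S hS hne hc
    have h3 := rcost_nonneg S P'.toFinset
    norm_num at h2 ⊢
    linarith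
  obtain ⟨hSnd, hSW, hSne, hScost, hSmin⟩ := startCenters_spec hP'nd hW₂nd hW₂P
    (hW₂len.trans hW₁len) hk hcost₂
  set S := startCenters k P' W₂ with hS
  have hnext : s.next u = newEpoch k P' s.base := by rw [State.next, if_neg hrem, h.k_eq]
  have hbase : (s.next u).base = W₂ := by rw [hnext]; rfl
  have hreps : (s.next u).reps = (S.map fun s => (s, s)).reverse := by rw [hnext]; rfl
  have hdisp : (s.next u).display = S.toFinset := by
    rw [State.display, hreps]
    ext
    simp
  have hW₁card := List.toFinset_card_of_nodup hW₁nd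
  have hW₂card := List.toFinset_card_of_nodup hW₂nd
  have hScard := List.toFinset_card_of_nodup hSnd
  have hSW' : S.toFinset ⊆ W₂.toFinset := fun x hx =>
    List.mem_toFinset.2 (hSW (List.mem_toFinset.1 hx))
  have hSk : S.length ≤ k := by
    have := Finset.card_le_card hSW'
    omega
  -- the potential
  obtain ⟨g₀, hg₀, hpot₀⟩ := h.levels.update hX (P' := u.apply P) (p := u.point)
    fun q hq => u.mem_apply_iff hq
  obtain ⟨g₁, hg₁, hpot₁⟩ := hg₀.change hX (W' := W₁.toFinset)
  rw [← hP'set] at hg₁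
  obtain ⟨g₂, hg₂, hpot₂⟩ := hg₁.robustify hX hΔ0 hΔ hW₁P hW₁nd
  rw [← hW₂] at hpot₂ hg₂
  refine ⟨S.toFinset, g₂, ?_⟩
  constructor
  case k_eq => rw [hnext]; rfl
  case nodup => rw [hnext]; exact hP'nd
  case pts_eq => rw [hnext]; exact hP'set
  case base_nodup => rw [hbase]; exact hW₂nd
  case base_sub =>
    rw [hbase, ← hP'set]
    exact fun x hx => List.mem_toFinset.2 (hW₂P (List.mem_toFinset.1 hx))
  case base_card => rw [hbase]; omega
  case robust => rw [hbase, ← hP'set]; exact hrob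
  case base_cost => rw [hbase, ← hP'set]; exact hcost₂
  case start_sub => rw [hbase]; exact hSW'
  case start_ne =>
    intro hne
    rw [← hP'set, List.toFinset_nonempty_iff] at hne
    exact (List.toFinset_nonempty_iff _).2 (hSne hne)
  case start_cost => rw [← hP'set, hScard]; exact hScost
  case start_min => rw [hbase, ← hP'set, hScard]; exact hSmin
  case rem_eq =>
    rw [hnext, hScard]
    change S.length + (k - S.length) + 0 = k
    omega
  case del => simp
  case ins => simp
  case reps_length => rw [hreps, hScard]; simp
  case reps_mem =>
    intro q hq
    rw [hreps, List.mem_reverse, List.mem_map] at hq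
    obtain ⟨x, hx, rfl⟩ := hq
    rw [← hP'set, List.mem_toFinset]
    exact hW₂P (hSW hx)
  case reps_cover =>
    intro p hp
    have hne : S.toFinset.Nonempty := by
      rw [← hP'set, List.mem_toFinset] at hp
      exact (List.toFinset_nonempty_iff _).2 (hSne (List.ne_nil_of_mem hp))
    refine .inr ⟨hp, (nn S.toFinset p, nn S.toFinset p), ?_, (infDist_eq_dist_nn hne p).ge, by simp⟩
    rw [hreps, List.mem_reverse, List.mem_map]
    exact ⟨_, List.mem_toFinset.1 (nn_mem hne p), rfl⟩
  case card_le => exact (u.card_apply_le P).trans (Nat.add_le_add_right h.card_le 1)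
  case start_card_le => exact (u.card_apply_le P).trans (Nat.add_le_add_right h.card_le 1)
  case levels => rw [hbase, ← hP'set]; exact hg₂
  case budget =>
    rw [hbase, hdisp]
    have hbud := h.budget
    have hdebt := h.debt
    have hij := h.start_card_le
    -- The recourse is measured along display, `base`, `W₁`, `W₂`, `S`. The first two legs are O(j +
    -- 1), the third is paid by the potential, and the last is left to the new budget.
    have ht1 := card_symmDiff_triangle s.display s.base.toFinset S.toFinset
    have ht2 := card_symmDiff_triangle s.base.toFinset W₁.toFinset S.toFinset
    have ht3 := card_symmDiff_triangle W₁.toFinset W₂.toFinset S.toFinset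
    have e1 := card_symmDiff_eq s.base.toFinset W₁.toFinset
    have e2 := card_symmDiff_eq W₁.toFinset W₂.toFinset
    have e3 := card_symmDiff_eq W₂.toFinset S.toFinset
    rw [Finset.sdiff_eq_empty_iff_subset.2 hSW', Finset.card_empty, add_zero] at e3
    have c1 := Finset.card_sdiff_add_card_inter s.base.toFinset W₁.toFinset
    have c2 := Finset.card_sdiff_add_card_inter W₁.toFinset s.base.toFinset
    rw [Finset.inter_comm] at c2
    have c3 := Finset.card_sdiff_add_card_inter W₁.toFinset W₂.toFinset
    have c4 := Finset.card_sdiff_add_card_inter W₂.toFinset W₁.toFinset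
    rw [Finset.inter_comm] at c4
    have c5 := Finset.card_sdiff_add_card_inter P₀ (u.apply P)
    have c6 : (P₀ ∩ u.apply P).card ≤ (u.apply P).card :=
      Finset.card_le_card Finset.inter_subset_right
    have c7 := Finset.card_sdiff_add_card_eq_card h.start_sub
    have hb := h.base_card
    have hdc : s.display.card ≤ S₀.card + j :=
      (List.toFinset_card_le _).trans ((List.length_map _).le.trans h.reps_length)
    have ha : (W₁.toFinset \ s.base.toFinset).card ≤ 2 ^ 45 * (j + 1) := hW₁U.trans hWU
    set a := (W₁.toFinset \ s.base.toFinset).card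
    have haG : a * G ≤ 2 ^ 45 * (j + 1) * G ^ 2 :=
      Nat.mul_le_mul ha (Nat.le_self_pow (by norm_num) G)
    have hjG : j + 1 ≤ (j + 1) * G ^ 2 := Nat.le_mul_of_pos_right _ (by positivity)
    have hGG : G * G = G ^ 2 := (pow_two G).symm
    rw [hGG] at hpot₀
    have hi : 2 ^ 48 * G ^ 2 * (i + 1 - 0) =
        2 ^ 48 * G ^ 2 * (i - j) + 2 ^ 48 * ((j + 1) * G ^ 2) := by
      obtain ⟨d, rfl⟩ : ∃ d, i = j + d := ⟨i - j, by omega⟩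
      rw [Nat.add_sub_cancel_left, Nat.sub_zero]
      ring
    have hj2 : 2 * G ^ 2 * j + 2 * G ^ 2 = 2 * ((j + 1) * G ^ 2) := by ring
    have haG' : a * G ≤ 2 ^ 45 * ((j + 1) * G ^ 2) := by rwa [← mul_assoc]
    rw [hi]
    generalize (j + 1) * G ^ 2 = y at *
    generalize 2 ^ 48 * G ^ 2 * (i - j) = z at *
    generalize 2 * G ^ 2 * j = y₁ at *
    generalize G ^ 2 = y₂ at *
    generalize a * G = b at *
    omega
  case debt =>
    rw [hbase, hdisp, symmDiff_comm, card_symmDiff_eq, Finset.sdiff_eq_empty_iff_subset.2 hSW']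
    simp

/-! ## Consequences of the invariant -/

theorem Invariant.rcost_display_le {k G i R j : ℕ} {P P₀ S₀ : Finset X} {s : State X} {g : X → ℕ}
    (h : Invariant k G i P R s P₀ S₀ j g) : rcost s.display P ≤ 2 * rcost S₀ P₀ := by
  have hrep : ∀ q ∈ s.reps, q.2 ∈ s.display := fun q hq =>
    List.mem_toFinset.2 (List.mem_map_of_mem hq)
  calc rcost s.display P ≤ ∑ p ∈ P, if p ∈ P₀ then 2 * Metric.infDist p (S₀ : Set X) else 0 := by
        refine Finset.sum_le_sum fun p hp => ?_
        have h0 : 0 ≤ Metric.infDist p (S₀ : Set X) := Metric.infDist_nonneg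
        rcases h.reps_cover p hp with h1 | ⟨h1, q, hq, hd, hd'⟩
        · have : Metric.infDist p (s.display : Set X) = 0 :=
            Metric.infDist_zero_of_mem (by simpa using hrep _ h1)
          rw [this]
          split_ifs <;> linarith
        · rw [if_pos h1]
          have h2 := infDist_le (hrep q hq) p
          have h3 := dist_triangle p q.1 q.2
          rw [dist_comm q.1 p] at hd'
          linarith
    _ = ∑ p ∈ P with p ∈ P₀, 2 * Metric.infDist p (S₀ : Set X) := (Finset.sum_filter _ _).symm
    _ ≤ ∑ p ∈ P₀, 2 * Metric.infDist p (S₀ : Set X) :=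
        Finset.sum_le_sum_of_subset_of_nonneg (fun p hp => (Finset.mem_filter.1 hp).2)
          fun _ _ _ => mul_nonneg (by norm_num) Metric.infDist_nonneg
    _ = 2 * rcost S₀ P₀ := by rw [rcost, Finset.mul_sum]

/-- Any `k` centres for `P`, with the at most `j` deleted points added and all moved into `P₀`, form
a solution that `S₀` competes with. The factor is 2^45 = 2·2^43·2: representatives, competitiveness,
and the move into `P₀`. -/
theorem Invariant.feasible {k G i R j : ℕ} {P P₀ S₀ : Finset X} {s : State X} {g : X → ℕ}
    (h : Invariant k G i P R s P₀ S₀ j g) :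
    s.display ⊆ P ∧ s.display.card ≤ k ∧ cost s.display P ≤ ((2 ^ 45 : ℕ) : ℝ≥0∞) * OPT k P := by
  refine ⟨fun x hx => ?_, ?_, ?_⟩
  · obtain ⟨q, hq, rfl⟩ := List.mem_map.1 (List.mem_toFinset.1 hx)
    exact h.reps_mem q hq
  · have h1 : s.display.card ≤ s.reps.length :=
      (List.toFinset_card_le _).trans (List.length_map _).le
    have := h.reps_length
    have := h.rem_eq
    omega
  rcases P.eq_empty_or_nonempty with rfl | hP
  · simp [cost]
  rw [mul_comm, ← ENNReal.div_le_iff_le_mul (.inl (by norm_num)) (.inl (ENNReal.natCast_ne_top _)),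
    OPT]
  refine le_iInf₂ fun S hS => ?_
  rw [ENNReal.div_le_iff_le_mul (.inl (by norm_num)) (.inl (ENNReal.natCast_ne_top _))]
  rcases S.eq_empty_or_nonempty with rfl | hSne
  · obtain ⟨p, hp⟩ := hP
    have : cost ∅ P = ⊤ := by
      rw [cost, ENNReal.sum_eq_top]
      exact ⟨p, hp, by simp⟩
    rw [this, ENNReal.top_mul (by norm_num)]
    exact le_top
  have hne : s.display.Nonempty := by
    obtain ⟨p, hp⟩ := hP
    rcases h.reps_cover p hp with h1 | ⟨-, q, h1, -⟩
    all_goals exact ⟨_, List.mem_toFinset.2 (List.mem_map_of_mem h1)⟩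
  have hcost : rcost s.display P ≤ rcost S P * (2 ^ 45 : ℕ) := by
    have h1 := h.rcost_display_le
    have hS0 := rcost_nonneg S P
    rcases P₀.eq_empty_or_nonempty with rfl | hP₀
    · have : rcost S₀ (∅ : Finset X) = 0 := by simp [rcost]
      have h2 : (0 : ℝ) ≤ rcost S P * (2 ^ 45 : ℕ) := by positivity
      linarith
    · have hne' : (S ∪ (P₀ \ P)).Nonempty := hSne.mono Finset.subset_union_left
      have h2 := h.start_cost ((S ∪ (P₀ \ P)).image (nn P₀)) (by
          intro x hx
          obtain ⟨y, -, rfl⟩ := Finset.mem_image.1 hx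
          exact nn_mem hP₀ y) (hne'.image _) (by
          have h3 : ((S ∪ (P₀ \ P)).image (nn P₀)).card ≤ _ := Finset.card_image_le
          have h4 := Finset.card_union_le S (P₀ \ P)
          have := h.del
          have := h.rem_eq
          omega)
      have h3 := rcost_image_nn_self_le (P := P₀) hne'
      have h4 := rcost_union_sdiff_le (P := P) (Q := P₀) hSne
      norm_num at h2 ⊢
      linarith
  rw [cost_eq_ofReal hne, cost_eq_ofReal hSne, ← ENNReal.ofReal_natCast,
    ← ENNReal.ofReal_mul (rcost_nonneg S P)]
  exact ENNReal.ofReal_le_ofReal hcost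

/-- The only unpaid term, the drop from `base` to `S₀`, is at most |P₀| and hence at most the number
of updates before the epoch. -/
theorem Invariant.recourse_le {k G i R j : ℕ} {P P₀ S₀ : Finset X} {s : State X} {g : X → ℕ}
    (hG : 1 ≤ G) (h : Invariant k G i P R s P₀ S₀ j g) : R ≤ 2 ^ 49 * G ^ 2 * i := by
  have h1 := h.budget
  have h2 := h.start_card_le
  have hdc : s.display.card ≤ S₀.card + j :=
    (List.toFinset_card_le _).trans ((List.length_map _).le.trans h.reps_length)
  have h3 : (s.base.toFinset \ S₀).card ≤ P₀.card :=
    Finset.card_le_card (Finset.sdiff_subset.trans h.base_sub)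
  have hG2 : 1 ≤ G ^ 2 := Nat.one_le_pow _ _ hG
  obtain ⟨d, rfl⟩ : ∃ d, i = j + d := ⟨i - j, by omega⟩
  rw [Nat.add_sub_cancel_left] at h1
  have h4 : d ≤ G ^ 2 * d := Nat.le_mul_of_pos_left _ hG2
  have h5 : j ≤ G ^ 2 * j := Nat.le_mul_of_pos_left _ hG2
  have e : 2 ^ 49 * G ^ 2 * (j + d) = 2 ^ 49 * (G ^ 2 * j) + 2 ^ 49 * (G ^ 2 * d) := by ring
  rw [mul_assoc, mul_assoc] at h1
  rw [e]
  omega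

/-! ## The main theorem -/

/-- The states of the algorithm. -/
noncomputable def states (k : ℕ) (σ : ℕ → Update X) : ℕ → State X
  | 0 => ⟨[], [], [], k, k⟩
  | i + 1 => (states k σ i).next (σ i)

theorem invariant_zero (k G : ℕ) (σ : ℕ → Update X) :
    Invariant k G 0 (input σ 0) 0 (states k σ 0) ∅ ∅ 0 fun _ => 0 := by
  constructor <;>
    simp [states, input, Robust, State.display, potential, Finset.subset_empty]
  case levels => exact ⟨by simp, by simp, by simp⟩

theorem exists_invariant {k G : ℕ} {σ : ℕ → Update X} {Δ : ℝ}
    (hX : ∀ x y : X, x ≠ y → 1 ≤ dist x y ∧ dist x y ≤ Δ) (hΔ0 : 0 ≤ Δ)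
    (hΔ : Δ < 2 ^ G) (hG : 1 ≤ G) (hk : 1 ≤ k) (hσ : ValidUpdates σ) (i : ℕ) :
    ∃ P₀ S₀ j g, Invariant k G i (input σ i)
      (∑ l ∈ Finset.range i, (symmDiff (states k σ l).display (states k σ (l + 1)).display).card)
      (states k σ i) P₀ S₀ j g := by
  induction i with
  | zero => exact ⟨∅, ∅, 0, _, by simpa using invariant_zero k G σ⟩
  | succ i ih =>
    obtain ⟨P₀, S₀, j, g, h⟩ := ih
    rw [Finset.sum_range_succ]
    by_cases hrem : 1 ≤ (states k σ i).rem
    · obtain ⟨g', h'⟩ := h.continue hX (hσ i) hrem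
      exact ⟨P₀, S₀, j + 1, g', h'⟩
    · obtain ⟨S₁, g', h'⟩ := h.renew hX hΔ0 hΔ hG hk (hσ i) hrem
      exact ⟨_, S₁, 0, g', h'⟩

/-- The running time of an update. -/
theorem Invariant.runs_step {k G i R j n : ℕ} {P P₀ S₀ : Finset X} {s : State X} {g : X → ℕ}
    {Δ : ℝ} {u : Update X} (hX : ∀ x y : X, x ≠ y → 1 ≤ dist x y ∧ dist x y ≤ Δ) (hΔ0 : 0 ≤ Δ)
    (hk : 1 ≤ k) (h : Invariant k G i P R s P₀ S₀ j g) (hu : u.Allowed P) (hP : P.card ≤ n)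
    (hP' : (u.apply P).card ≤ n) :
    Runs (2 ^ (n + k + 3)) .step (.cons s.val u.encode) (s.next u).val := by
  have hpow : 2 ^ (n + k + 3) = 8 * 2 ^ (n + k) := by ring
  have hlt : n + k < 2 ^ (n + k) := Nat.lt_two_pow_self
  have : Fact (5 ≤ 2 ^ (n + k + 3)) := ⟨by omega⟩
  have hnd : (u.applyList s.pts).Nodup := Update.nodup_applyList h.nodup (by rwa [h.pts_eq])
  have hlen : s.pts.length = P.card := by rw [← h.pts_eq, List.toFinset_card_of_nodup h.nodup]
  have hlen' : (u.applyList s.pts).length = (u.apply P).card := by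
    rw [← List.toFinset_card_of_nodup hnd, u.toFinset_applyList, h.pts_eq]
  have hbase := h.base_card
  rw [List.toFinset_card_of_nodup h.base_nodup] at hbase
  have h1 := h.reps_length
  have h2 := h.rem_eq
  refine Runs.step u hX hΔ0 (by rwa [h.k_eq]) hnd (by omega) ?_ (by omega) (by omega)
    (length_reps_newEpoch_le _ _ _)
  rw [hlen']
  exact Nat.pow_lt_pow_right (by norm_num) (by omega)

theorem displays_val (s : State X) : Displays s.val s.display :=
  ⟨(s.reps.map Prod.snd).reverse, _, by rw [ofList_eq_encList]; rfl, by
    simp [State.display]⟩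

theorem exists_log_bound {Δ : ℝ} (hΔ : 2 ≤ Δ) :
    1 ≤ Real.logb 2 Δ ∧ ∃ G : ℕ, 1 ≤ G ∧ Δ < 2 ^ G ∧ (G : ℝ) ≤ 2 * Real.logb 2 Δ := by
  have h1 : 1 ≤ Real.logb 2 Δ := by
    rw [Real.le_logb_iff_rpow_le (by norm_num) (by linarith)]
    simpa using hΔ
  refine ⟨h1, ⌊Real.logb 2 Δ⌋₊ + 1, by omega, ?_, ?_⟩
  · have := Nat.lt_floor_add_one (Real.logb 2 Δ)
    rw [Real.logb_lt_iff_lt_rpow (by norm_num) (by linarith)] at this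
    rw [← Real.rpow_natCast]
    push_cast
    exact this
  · have := Nat.floor_le (show 0 ≤ Real.logb 2 Δ by linarith)
    push_cast
    linarith

theorem exists_constant (a b : ℕ) : ∃ C : ℕ, 2 ^ 51 ≤ C ∧ 4 * a ≤ C ∧ 4 * b ≤ C :=
  ⟨2 ^ 51 + (4 * a + 4 * b), Nat.le_add_right _ _,
    (Nat.le_add_right _ _).trans (Nat.le_add_left _ _),
    (Nat.le_add_left _ _).trans (Nat.le_add_left _ _)⟩

theorem time_le {t e n k C : ℕ} {l : ℝ} (ht : t ≤ (2 ^ (n + k + 3)) ^ e) (hk : 1 ≤ k) (hl : 1 ≤ l)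
    (he : 4 * e ≤ C) : (t : ℝ) ≤ 2 ^ (C * (n + k)) * l ^ C := by
  have h1 : (t : ℝ) ≤ (2 ^ (n + k + 3)) ^ e := by exact_mod_cast ht
  have h2 : ((2 : ℝ) ^ (n + k + 3)) ^ e ≤ 2 ^ (C * (n + k)) := by
    rw [← pow_mul]
    refine pow_le_pow_right₀ (by norm_num) ?_
    calc (n + k + 3) * e ≤ (4 * (n + k)) * e := Nat.mul_le_mul_right _ (by omega)
      _ = 4 * e * (n + k) := by ring
      _ ≤ C * (n + k) := Nat.mul_le_mul_right _ he
  have h3 : (1 : ℝ) ≤ l ^ C := one_le_pow₀ hl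
  calc (t : ℝ) ≤ 2 ^ (C * (n + k)) * 1 := by linarith
    _ ≤ 2 ^ (C * (n + k)) * l ^ C := by gcongr

end DynKMedian

theorem theorem5p1 :
    ∃ (A : DynKMedian.DynAlg) (C : ℕ),
      ∀ (X : Type u) [MetricSpace X] [DecidableEq X] (Δ : ℝ) (k : ℕ),
        2 ≤ Δ → 1 ≤ k →
        (∀ x y : X, x ≠ y → 1 ≤ dist x y ∧ dist x y ≤ Δ) →
        ∀ σ : ℕ → DynKMedian.Update X, DynKMedian.ValidUpdates σ →
          ∃ (s : ℕ → DynKMedian.Val X) (t : ℕ → ℕ) (U : ℕ → Finset X),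
            A.Executes k σ s t ∧
            (∀ i, DynKMedian.Displays (s i) (U i)) ∧
            -- feasibility and approximation ratio
            (∀ i, U i ⊆ DynKMedian.input σ i ∧ (U i).card ≤ k ∧
              DynKMedian.cost (U i) (DynKMedian.input σ i) ≤
                (C : ENNReal) * DynKMedian.OPT k (DynKMedian.input σ i)) ∧
            -- amortized recourse
            (∀ T : ℕ, ((∑ i ∈ Finset.range T, (symmDiff (U i) (U (i + 1))).card : ℕ) : ℝ) ≤
              C * Real.logb 2 Δ ^ 2 * T) ∧
            -- update time
            (∀ i n : ℕ, (∀ j ≤ i, (DynKMedian.input σ j).card ≤ n) →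
              (t i : ℝ) ≤ 2 ^ (C * (n + k)) * Real.logb 2 Δ ^ C) := by
  obtain ⟨C, hC, hCinit, hCstep⟩ :=
    DynKMedian.exists_constant DynKMedian.Prog.init.ex DynKMedian.Prog.step.ex
  refine ⟨DynKMedian.algorithm, C, ?_⟩
  intro X _ _ Δ k hΔ hk hX σ hσ
  obtain ⟨hlog, G, hG1, hG2, hG3⟩ := DynKMedian.exists_log_bound hΔ
  have hΔ0 : 0 ≤ Δ := by linarith
  have hinv := DynKMedian.exists_invariant hX hΔ0 hG2 hG1 hk hσ
  have hstep : ∀ i n, (DynKMedian.input σ i).card ≤ n → (DynKMedian.input σ (i + 1)).card ≤ n →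
      DynKMedian.Runs (2 ^ (n + k + 3)) .step
        (.cons (DynKMedian.states k σ i).val (σ i).encode) (DynKMedian.states k σ (i + 1)).val := by
    intro i n h1 h2
    obtain ⟨P₀, S₀, j, g, h⟩ := hinv i
    exact h.runs_step hX hΔ0 hk (hσ i) h1 h2
  have hinit : ∀ n, DynKMedian.Runs (2 ^ (n + k + 3)) .init (.real k)
      (DynKMedian.states k σ 0).val := by
    intro n
    have : Fact (5 ≤ 2 ^ (n + k + 3)) := ⟨by
      have : 1 ≤ 2 ^ (n + k) := Nat.one_le_two_pow
      rw [pow_add]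
      omega⟩
    exact DynKMedian.Runs.init k
  choose t ht htrun using fun i => hstep i _ (le_max_left _ _) (le_max_right _ _)
  obtain ⟨t₀, ht₀, ht₀run⟩ := hinit 0
  refine ⟨fun i => (DynKMedian.states k σ i).val, fun i => Nat.casesOn (motive := fun _ => ℕ) i t₀ t,
    fun i => (DynKMedian.states k σ i).display, ⟨ht₀run, htrun⟩,
    fun i => DynKMedian.displays_val _, fun i => ?_, fun T => ?_, fun i n hn => ?_⟩
  · obtain ⟨P₀, S₀, j, g, h⟩ := hinv i
    obtain ⟨h1, h2, h3⟩ := h.feasible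
    refine ⟨h1, h2, h3.trans ?_⟩
    gcongr
    exact (Nat.pow_le_pow_right (by norm_num) (by norm_num)).trans hC
  · obtain ⟨P₀, S₀, j, g, h⟩ := hinv T
    have h1 : ((∑ l ∈ Finset.range T, (symmDiff (DynKMedian.states k σ l).display
        (DynKMedian.states k σ (l + 1)).display).card : ℕ) : ℝ) ≤ 2 ^ 49 * G ^ 2 * T := by
      exact_mod_cast h.recourse_le hG1
    refine h1.trans ?_
    have h2 : (G : ℝ) ^ 2 ≤ (2 * Real.logb 2 Δ) ^ 2 := by gcongr
    have h3 : (2 : ℝ) ^ 51 ≤ C := by exact_mod_cast hC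
    calc (2 : ℝ) ^ 49 * G ^ 2 * T ≤ 2 ^ 49 * (2 * Real.logb 2 Δ) ^ 2 * T := by gcongr
      _ = 2 ^ 51 * Real.logb 2 Δ ^ 2 * T := by ring
      _ ≤ C * Real.logb 2 Δ ^ 2 * T := by gcongr
  · cases i with
    | zero =>
      obtain ⟨t', ht', hrun'⟩ := hinit n
      obtain ⟨rfl, -⟩ := ht₀run.deterministic hrun'
      exact DynKMedian.time_le ht' hk hlog hCinit
    | succ i =>
      obtain ⟨t', ht', hrun'⟩ := hstep i n (hn i (Nat.le_succ i)) (hn (i + 1) le_rfl)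
      -- The time was chosen using the actual input sizes. Determinism shows that the bound for any
      -- admissible `n` concerns the same number of steps.
      obtain ⟨he, -⟩ := (htrun i).deterministic hrun'
      rw [← he] at ht'
      exact DynKMedian.time_le ht' hk hlog hCstep
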